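/- Let $n$ be a natural number, $0<T<\infty$, and let $b:[0,T]\times\mathbb{R}^n\to\mathbb{R}^n$ be a vector field, measurable in time, satisfying the following two conditions. (B1) There is a continuous nondecreasing function $G:[0,\infty)\to(0,\infty)$ with $\int_r^\infty \frac{ds}{G(s)}=\infty$ for some $r>0$ and a constant $C$ such that, for a.e. $t\in(0,T)$, $|b(t,x)|\le C\,G(|x|)$ for all $x\in\mathbb{R}^n$. (B2) There is a continuous nondecreasing function $\omega:[0,\infty)\to[0,\infty)$ with $\int_0^r \frac{ds}{\omega(s)}=\infty$ for some $r>0$ such that for every $R>0$ there is a constant $C_R$ such that, for a.e. $t\in(0,T)$, $|b(t,x)-b(t,y)|\le C_R\,\omega(|x-y|)$ for all $x,y\in B(0,R)$. Then $b$ has a unique flow $\phi$, that is, there are unique maps $\phi_t:\mathbb{R}^n\to\mathbb{R}^n$, $t\in[0,T]$, with $$\phi_t(x)=x+\int_0^t b(s,\phi_s(x))\,ds\qquad\text{for all } x\in\mathbb{R}^n,\ t\in[0,T],$$ and every $\phi_t$ is a homeomorphism of $\mathbb{R}^n$. Moreover, let $\mathcal{M}(\mathbb{R}^n)$ be the space of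 finite signed Borel measures on $\mathbb{R}^n$ with the total variation norm, and let $L^1(0,T;\mathcal{M}(\mathbb{R}^n))$ be the space of families $\rho=(\rho_t)_{t\in(0,T)}$ in $\mathcal{M}(\mathbb{R}^n)$, identified when equal for a.e. $t$, such that $t\mapsto\rho_t(A)$ is measurable for every Borel set $A$ and $\int_0^T\|\rho_t\|_{TV}\,dt<\infty$. Then for every $\rho_0\in\mathcal{M}(\mathbb{R}^n)$ the Cauchy problem $$\partial_t\rho+\operatorname{div}(b\rho)=0\ \text{ in }(0,T)\times\mathbb{R}^n,\qquad \rho(0,\cdot)=\rho_0,$$ has exactly one weak solution $\rho\in L^1(0,T;\mathcal{M}(\mathbb{R}^n))$, where $\rho$ is called a weak solution if $$\int_0^T\int_{\mathbb{R}^n}\big[\partial_t\varphi(t,x)+\langle b(t,x),\nabla\varphi(t,x)\rangle\big]\,d\rho_t(x)\,dt+\int_{\mathbb{R}^n}\varphi(0,x)\,d\rho_0(x)=0$$ for all $\varphi\in C_c^\infty([0,T)\times\mathbb{R}^n)$; and this solution is $\rho_t=(\phi_t)_\sharp\rho_0$, the push-forward of $\rho_0$ under the flow, $(\phi_t)_\sharp\rho_0(A)=\rho_0(\phi_t^{-1}(A))$,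 for a.e. $t\in(0,T)$. -/

import Mathlib

open Set MeasureTheory
open scoped ContDiff

/-- The Euclidean space `ℝⁿ`. -/
abbrev Rn (n : ℕ) : Type := EuclideanSpace ℝ (Fin n)

/-- The vector field `b` (of which only the values for times in `(0, T)` matter) is measurable in
time at every point of space, up to null sets of times. For fields which are continuous in `x` for
almost every `t` this is the same as (Lebesgue) measurability on `(0, T) × ℝⁿ`. -/
def MeasurableInTime {n : ℕ} (T : ℝ) (b : ℝ → Rn n → Rn n) : Prop :=
  ∀ x : Rn n, AEMeasurable (fun t => b t x) (volume.restrict (Ioo 0 T))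

/-- Growth condition: there is a continuous nondecreasing `G : [0,∞) → (0,∞)` with
`∫_r^∞ ds / G(s) = ∞` for some `r > 0`, such that the function `t ↦ sup_x |b(t,x)| / G(|x|)` is
essentially bounded on `(0, T)`. -/
def GrowthCondition {n : ℕ} (T : ℝ) (b : ℝ → Rn n → Rn n) : Prop :=
  ∃ G : ℝ → ℝ, ContinuousOn G (Ici 0) ∧ MonotoneOn G (Ici 0) ∧ (∀ s ∈ Ici (0 : ℝ), 0 < G s) ∧
    (∃ r : ℝ, 0 < r ∧ ∫⁻ s in Ioi r, (ENNReal.ofReal (G s))⁻¹ = (⊤ : ENNReal)) ∧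
    ∃ C : ℝ, ∀ᵐ t ∂(volume.restrict (Ioo 0 T)), ∀ x : Rn n, ‖b t x‖ ≤ C * G ‖x‖

/-- Local Osgood condition: there is a continuous nondecreasing `w : [0,∞) → [0,∞)` with
`∫_0^r ds / w(s) = ∞` for some `r > 0` (with the convention `1 / 0 = ∞`), such that for every
radius `R` the function `t ↦ sup_{x, y ∈ B(0,R)} |b(t,x) - b(t,y)| / w(|x - y|)` is essentially
bounded on `(0, T)`. -/
def OsgoodCondition {n : ℕ} (T : ℝ) (b : ℝ → Rn n → Rn n) : Prop :=
  ∃ w : ℝ → ℝ, ContinuousOn w (Ici 0) ∧ MonotoneOn w (Ici 0) ∧ (∀ s ∈ Ici (0 : ℝ), 0 ≤ w s) ∧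
    (∃ r : ℝ, 0 < r ∧ ∫⁻ s in Ioo 0 r, (ENNReal.ofReal (w s))⁻¹ = (⊤ : ENNReal)) ∧
    ∀ R : ℝ, 0 < R → ∃ C : ℝ, ∀ᵐ t ∂(volume.restrict (Ioo 0 T)),
      ∀ x ∈ Metric.ball (0 : Rn n) R, ∀ y ∈ Metric.ball (0 : Rn n) R,
        ‖b t x - b t y‖ ≤ C * w ‖x - y‖

/-- `ρ ∈ L¹(0, T; 𝓜(ℝⁿ))`: the map `t ↦ ρ_t` with values in the finite signed Borel measures is
weakly measurable, in the sense that `t ↦ ρ_t(A)` is measurable for every Borel set `A` (up to null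
sets of times), and `∫_0^T ‖ρ_t‖_TV dt < ∞`. Elements are identified when they agree for a.e. `t`.
(Measurability of `t ↦ ‖ρ_t‖_TV` is a consequence, the Borel `σ`-algebra being countably
generated.) -/
def MemL1Measures {n : ℕ} (T : ℝ) (ρ : ℝ → SignedMeasure (Rn n)) : Prop :=
  (∀ A : Set (Rn n), MeasurableSet A →
    AEMeasurable (fun t => ρ t A) (volume.restrict (Ioo 0 T))) ∧
  ∫⁻ t in Ioo 0 T, (ρ t).variation univ < (⊤ : ENNReal)

/-- Test functions in `C_c^∞([0,T) × ℝⁿ)`: (the restrictions to `[0,T) × ℝⁿ` of) smooth functions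
on `ℝ × ℝⁿ` with compact support contained in `(-∞,T) × ℝⁿ`. -/
def IsTestFunction {n : ℕ} (T : ℝ) (φ : ℝ × Rn n → ℝ) : Prop :=
  ContDiff ℝ ∞ φ ∧ HasCompactSupport φ ∧ tsupport φ ⊆ Iio T ×ˢ univ

/-- `ρ ∈ L¹(0, T; 𝓜(ℝⁿ))` is a weak solution of `∂_t ρ + div (b ρ) = 0` in `(0,T) × ℝⁿ` with
`ρ(0, ·) = ρ₀`. Here `∫ᵛ x, f x ∂•μ` is Mathlib's integral against a signed measure. If `b` is
measurable in time, continuous in space for a.e. time, and locally bounded uniformly in time, then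
all integrands are (absolutely) integrable for such a `ρ`. -/
def IsWeakSolution {n : ℕ} (T : ℝ) (b : ℝ → Rn n → Rn n) (ρ₀ : SignedMeasure (Rn n))
    (ρ : ℝ → SignedMeasure (Rn n)) : Prop :=
  MemL1Measures T ρ ∧
  ∀ φ : ℝ × Rn n → ℝ, IsTestFunction T φ →
    (∫ t in Ioo 0 T, ∫ᵛ x, (deriv (fun s => φ (s, x)) t +
        inner ℝ (b t x) (gradient (fun y => φ (t, y)) x)) ∂•(ρ t))
      + ∫ᵛ x, φ (0, x) ∂•ρ₀ = 0

/-- `φ` is a flow of `b` on `[0, T]`: for every `x`, the trajectory `t ↦ φ_t(x)` solves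
`φ_t(x) = x + ∫_0^t b(s, φ_s(x)) ds` on `[0, T]`, that is, it is absolutely continuous,
`φ_0(x) = x`, and `∂_t φ_t(x) = b(t, φ_t(x))` for a.e. `t`. -/
def IsFlow {n : ℕ} (T : ℝ) (b : ℝ → Rn n → Rn n) (φ : ℝ → Rn n → Rn n) : Prop :=
  ∀ x : Rn n, IntervalIntegrable (fun s => b s (φ s x)) volume 0 T ∧
    ∀ t ∈ Icc 0 T, φ t x = x + ∫ s in (0 : ℝ)..t, b s (φ s x)

open Filter Topology
open scoped Convolution

section

/-- A modulus `w` for which `w s - s` is nondecreasing and `∫₀¹ ds / w(s) = ∞`. -/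
structure OsgoodModulus (w : ℝ → ℝ) : Prop where
  cont : Continuous w
  mono : Monotone w
  add_le : ∀ r s, 0 ≤ r → r ≤ s → w r + (s - r) ≤ w s
  le : ∀ s, 0 ≤ s → s ≤ w s
  div : ∫⁻ s in Ioo 0 1, (ENNReal.ofReal (w s))⁻¹ = (⊤ : ENNReal)

theorem hasDerivAt_integral_inv {w : ℝ → ℝ} (hw : Continuous w) (hpos : ∀ s, 0 < s → 0 < w s)
    {c v : ℝ} (hc : 0 < c) (hv : 0 < v) :
    HasDerivAt (fun v => ∫ s in c..v, (w s)⁻¹) (w v)⁻¹ v := by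
  have hcont : ContinuousOn (fun s => (w s)⁻¹) (Ioi 0) :=
    hw.continuousOn.inv₀ fun s hs => (hpos s hs).ne'
  apply intervalIntegral.integral_hasDerivAt_right
  · apply (hcont.mono _).intervalIntegrable
    intro s hs
    exact lt_of_lt_of_le (lt_min hc hv) hs.1
  · exact hcont.stronglyMeasurableAtFilter isOpen_Ioi _ hv
  · exact hcont.continuousAt (Ioi_mem_nhds hv)

/-- Bihari's inequality. -/
theorem bihari {w F r : ℝ → ℝ} {a C T : ℝ} (hw : Continuous w) (hmono : Monotone w)
    (hpos : ∀ s, 0 < s → 0 < w s) (hF : ∀ v, 0 < v → HasDerivAt F (w v)⁻¹ v)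
    (hr : ContinuousOn r (Icc 0 T)) (hwr : ∀ s ∈ Icc 0 T, 0 ≤ w (r s)) (ha : 0 < a) (hC : 0 ≤ C)
    (h : ∀ t ∈ Icc 0 T, r t ≤ a + C * ∫ s in (0 : ℝ)..t, w (r s)) {t : ℝ} (ht : t ∈ Icc 0 T) :
    ∃ V, a ≤ V ∧ r t ≤ V ∧ F V ≤ F a + C * t := by
  set V : ℝ → ℝ := fun t => a + C * ∫ s in (0 : ℝ)..t, w (r s) with hV
  have hwrc : ContinuousOn (fun s => w (r s)) (Icc 0 T) := hw.comp_continuousOn hr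
  have hint : ∀ t ∈ Icc 0 T, IntervalIntegrable (fun s => w (r s)) volume 0 t := fun t ht =>
    (hwrc.mono (by rw [uIcc_of_le ht.1]; exact Icc_subset_Icc_right ht.2)).intervalIntegrable
  have hVa : ∀ t ∈ Icc 0 T, a ≤ V t := by
    intro t ht
    have : 0 ≤ ∫ s in (0 : ℝ)..t, w (r s) :=
      intervalIntegral.integral_nonneg ht.1 fun s hs => hwr s ⟨hs.1, hs.2.trans ht.2⟩
    simp only [hV]; nlinarith
  have hVd : ∀ t ∈ Ioo 0 T, HasDerivAt V (C * w (r t)) t := by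
    intro t ht
    have : HasDerivAt (fun t => ∫ s in (0 : ℝ)..t, w (r s)) (w (r t)) t := by
      apply intervalIntegral.integral_hasDerivAt_right (hint t ⟨ht.1.le, ht.2.le⟩)
      · exact (hwrc.mono Ioo_subset_Icc_self).stronglyMeasurableAtFilter isOpen_Ioo _ ht
      · exact hwrc.continuousAt (Icc_mem_nhds ht.1 ht.2)
    exact (this.const_mul C).const_add a
  have hVc : ContinuousOn V (Icc 0 T) := by
    have hT : 0 ≤ T := ht.1.trans ht.2
    have := intervalIntegral.continuousOn_primitive_interval' (hint T ⟨hT, le_rfl⟩)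
      (left_mem_uIcc)
    rw [uIcc_of_le hT] at this
    exact (this.const_mul C).const_add a
  have hFd : ∀ t ∈ Ioo 0 T, HasDerivAt (fun t => F (V t) - C * t)
      ((w (V t))⁻¹ * (C * w (r t)) - C) t := by
    intro t ht
    have h1 := (hF (V t) (ha.trans_le (hVa t ⟨ht.1.le, ht.2.le⟩))).comp t (hVd t ht)
    have h2 := (hasDerivAt_id t).const_mul C
    exact (h1.sub h2).congr_deriv (by simp)
  have hanti : AntitoneOn (fun t => F (V t) - C * t) (Icc 0 T) := by
    apply antitoneOn_of_deriv_nonpos (convex_Icc 0 T)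
    · apply ContinuousOn.sub _ (by fun_prop)
      intro t ht
      exact (hF (V t) (ha.trans_le (hVa t ht))).continuousAt.comp_continuousWithinAt (hVc t ht)
    · rw [interior_Icc]
      exact fun t ht => (hFd t ht).differentiableAt.differentiableWithinAt
    · rw [interior_Icc]
      intro t ht
      rw [(hFd t ht).deriv]
      have ht' : t ∈ Icc 0 T := ⟨ht.1.le, ht.2.le⟩
      have hp := hpos _ (ha.trans_le (hVa t ht'))
      have : (w (V t))⁻¹ * w (r t) ≤ 1 := by
        rw [inv_mul_le_one₀ hp]
        exact hmono (h t ht')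
      nlinarith
  refine ⟨V t, hVa t ht, h t ht, ?_⟩
  have := hanti ⟨le_rfl, ht.1.trans ht.2⟩ ht ht.1
  simp [hV] at this
  simp only [hV]; linarith

/-- A gauge adapted to a modulus: `ψ' = ψ / w`, `ψ` is concave and vanishes at `0`. -/
structure OsgoodGauge (w ψ : ℝ → ℝ) : Prop where
  pos : ∀ r, 0 < r → 0 < ψ r
  deriv : ∀ r, 0 < r → HasDerivAt ψ (ψ r / w r) r
  anti : AntitoneOn (fun r => ψ r / w r) (Ioi 0)
  lim : Tendsto ψ (𝓝[>] 0) (𝓝 0)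

theorem OsgoodModulus.pos {w : ℝ → ℝ} (hw : OsgoodModulus w) {s : ℝ} (hs : 0 < s) : 0 < w s :=
  hs.trans_le (hw.le s hs.le)

theorem OsgoodModulus.exists_gauge {w : ℝ → ℝ} (hw : OsgoodModulus w) :
    ∃ ψ, OsgoodGauge w ψ := by
  set F : ℝ → ℝ := fun v => ∫ s in (1 : ℝ)..v, (w s)⁻¹ with hFdef
  have hF : ∀ v, 0 < v → HasDerivAt F (w v)⁻¹ v := fun v hv =>
    hasDerivAt_integral_inv hw.cont (fun s hs => hw.pos hs) one_pos hv
  have hcont : ContinuousOn (fun s => (w s)⁻¹) (Ioi 0) :=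
    hw.cont.continuousOn.inv₀ fun s hs => (hw.pos hs).ne'
  refine ⟨fun v => Real.exp (F v), fun r _ => Real.exp_pos _, ?_, ?_, ?_⟩
  · intro r hr
    simpa [div_eq_mul_inv] using (hF r hr).exp
  · intro r hr s hs hrs
    have hr' : 0 < r := hr
    have hs' : 0 < s := hs
    set k := w r - r with hk
    have hk0 : 0 ≤ k := by have := hw.le r hr'.le; linarith
    have hD : AntitoneOn (fun σ => F σ - Real.log (k + σ)) (Ici r) := by
      have hd : ∀ σ, r ≤ σ → HasDerivAt (fun σ => F σ - Real.log (k + σ))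
          ((w σ)⁻¹ - 1 / (k + σ)) σ := by
        intro σ hσ
        have h1 : HasDerivAt (fun σ => k + σ) 1 σ := (hasDerivAt_id σ).const_add k
        exact (hF σ (hr'.trans_le hσ)).sub (h1.log (by positivity [hr'.trans_le hσ]))
      apply antitoneOn_of_deriv_nonpos (convex_Ici r)
      · exact fun σ hσ => (hd σ hσ).continuousAt.continuousWithinAt
      · rw [interior_Ici]
        exact fun σ hσ => (hd σ (le_of_lt hσ)).differentiableAt.differentiableWithinAt
      · rw [interior_Ici]
        intro σ hσ
        have hσ' : r < σ := hσ
        rw [(hd σ hσ'.le).deriv, one_div, sub_nonpos]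
        have := hw.add_le r σ hr'.le hσ'.le
        apply inv_anti₀ <;> linarith
    have h1 := hD (Set.mem_Ici.2 le_rfl) (show s ∈ Ici r from hrs) hrs
    simp only at h1
    have h2 : F s ≤ F r + Real.log (k + s) - Real.log (w r) := by
      have : k + r = w r := by simp [hk]
      rw [this] at h1; linarith
    have h3 := Real.exp_le_exp.2 h2
    rw [Real.exp_sub, Real.exp_add, Real.exp_log (by linarith), Real.exp_log (hw.pos hr')] at h3
    have h4 := hw.add_le r s hr'.le hrs
    have hwr := hw.pos hr'
    have hws := hw.pos hs'
    simp only
    rw [div_le_iff₀ hws]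
    calc _ ≤ _ := h3
      _ = Real.exp (F r) / w r * (k + s) := by ring
      _ ≤ _ := by gcongr; linarith
  · apply Real.tendsto_exp_atBot.comp
    have hmono : MonotoneOn F (Ioi 0) := by
      apply monotoneOn_of_deriv_nonneg (convex_Ioi 0)
      · exact fun σ hσ => (hF σ hσ).continuousAt.continuousWithinAt
      · rw [interior_Ioi]
        exact fun σ hσ => (hF σ hσ).differentiableAt.differentiableWithinAt
      · rw [interior_Ioi]
        intro σ hσ
        rw [(hF σ hσ).deriv]
        exact inv_nonneg.2 (hw.pos hσ).le
    rw [tendsto_atBot]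
    by_contra! hcon
    obtain ⟨N, hN⟩ := hcon
    have hb : ∀ v, 0 < v → N ≤ F v := by
      intro v hv
      by_contra! hlt
      apply hN
      filter_upwards [Ioo_mem_nhdsGT hv] with u hu
      exact not_lt.2 ((hmono hu.1 hv hu.2.le).trans hlt.le)
    have hint : IntegrableOn (fun s => (w s)⁻¹) (Ioc 0 1) := by
      apply integrableOn_Ioc_of_intervalIntegral_norm_bounded_left (ι := ℕ) (I := -N) (l := atTop)
        (a := fun k => 1 / ((k : ℝ) + 1)) (a₀ := 0)
      · intro k
        apply (ContinuousOn.integrableOn_Icc (hcont.mono _)).mono_set Ioc_subset_Icc_self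
        intro s hs
        exact lt_of_lt_of_le (by positivity) hs.1
      · exact tendsto_one_div_add_atTop_nhds_zero_nat
      · filter_upwards with k
        have hk : (0 : ℝ) < 1 / ((k : ℝ) + 1) := by positivity
        have hk1 : 1 / ((k : ℝ) + 1) ≤ 1 := by
          rw [div_le_one (by positivity)]; linarith [(Nat.cast_nonneg k : (0 : ℝ) ≤ k)]
        have := hb _ hk
        rw [hFdef] at this
        simp only at this
        rw [intervalIntegral.integral_symm, intervalIntegral.integral_of_le hk1] at this
        rw [setIntegral_congr_fun (g := fun s => (w s)⁻¹) measurableSet_Ioc]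
        · linarith
        · intro s hs
          exact Real.norm_of_nonneg (inv_nonneg.2 (hw.pos (hk.trans hs.1)).le)
    have h2 : ∫⁻ s in Ioo 0 1, (ENNReal.ofReal (w s))⁻¹ < ⊤ := by
      have h3 := (hint.mono_set Ioo_subset_Ioc_self).2
      rw [hasFiniteIntegral_iff_ofReal] at h3
      · refine lt_of_le_of_lt (le_of_eq ?_) h3
        apply setLIntegral_congr_fun measurableSet_Ioo
        intro s hs
        exact (ENNReal.ofReal_inv_of_pos (hw.pos hs.1)).symm
      · filter_upwards [self_mem_ae_restrict measurableSet_Ioo] with s hs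
        exact inv_nonneg.2 (hw.pos hs.1).le
    exact h2.ne hw.div

namespace OsgoodGauge

variable {w ψ : ℝ → ℝ}

theorem monotoneOn (hψ : OsgoodGauge w ψ) (hw : OsgoodModulus w) : MonotoneOn ψ (Ioi 0) := by
  apply monotoneOn_of_deriv_nonneg (convex_Ioi 0)
  · exact fun σ hσ => (hψ.deriv σ hσ).continuousAt.continuousWithinAt
  · rw [interior_Ioi]
    exact fun σ hσ => (hψ.deriv σ hσ).differentiableAt.differentiableWithinAt
  · rw [interior_Ioi]
    intro σ hσ
    rw [(hψ.deriv σ hσ).deriv]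
    exact div_nonneg (hψ.pos σ hσ).le (hw.pos hσ).le

theorem concaveOn (hψ : OsgoodGauge w ψ) : ConcaveOn ℝ (Ioi 0) ψ := by
  apply AntitoneOn.concaveOn_of_deriv (convex_Ioi 0)
  · exact fun σ hσ => (hψ.deriv σ hσ).continuousAt.continuousWithinAt
  · rw [interior_Ioi]
    exact fun σ hσ => (hψ.deriv σ hσ).differentiableAt.differentiableWithinAt
  · rw [interior_Ioi]
    exact hψ.anti.congr fun σ hσ => (hψ.deriv σ hσ).deriv.symm

theorem le_tangent (hψ : OsgoodGauge w ψ) {r a : ℝ} (hr : 0 < r) (ha : 0 ≤ a) :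
    ψ (r + a) ≤ ψ r + ψ r / w r * a := by
  rcases ha.eq_or_lt with rfl | ha
  · simp
  have := hψ.concaveOn.slope_le_of_hasDerivAt (x := r) (y := r + a) hr
    (show 0 < r + a by linarith) (by linarith) (hψ.deriv r hr)
  rw [slope_def_field, div_le_iff₀ (by linarith)] at this
  linarith

/-- Increments of a gauge decrease. -/
theorem increment_le (hψ : OsgoodGauge w ψ) {r s e : ℝ} (he : 0 < e) (hr : 0 ≤ r) (hs : 0 ≤ s) :
    ψ (r + s + e) - ψ (s + e) ≤ ψ (r + e) - ψ e := by
  have hd : ∀ σ, 0 ≤ σ → HasDerivAt (fun σ => ψ (r + σ + e) - ψ (σ + e))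
      (ψ (r + σ + e) / w (r + σ + e) - ψ (σ + e) / w (σ + e)) σ := by
    intro σ hσ
    have h1 : HasDerivAt (fun σ => r + σ + e) 1 σ := ((hasDerivAt_id σ).const_add r).add_const e
    have h2 : HasDerivAt (fun σ => σ + e) 1 σ := (hasDerivAt_id σ).add_const e
    exact (((hψ.deriv (r + σ + e) (by positivity)).comp σ h1).sub
      ((hψ.deriv (σ + e) (by positivity)).comp σ h2)).congr_deriv (by simp)
  have hanti : AntitoneOn (fun σ => ψ (r + σ + e) - ψ (σ + e)) (Ici 0) := by
    apply antitoneOn_of_deriv_nonpos (convex_Ici 0)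
    · exact fun σ hσ => (hd σ hσ).continuousAt.continuousWithinAt
    · rw [interior_Ici]
      exact fun σ hσ => (hd σ (le_of_lt hσ)).differentiableAt.differentiableWithinAt
    · rw [interior_Ici]
      intro σ hσ
      have hσ' : 0 < σ := hσ
      rw [(hd σ hσ'.le).deriv, sub_nonpos]
      exact hψ.anti (show 0 < σ + e by positivity) (show 0 < r + σ + e by positivity)
        (by linarith)
  have := hanti (Set.mem_Ici.2 le_rfl) (show s ∈ Ici 0 from hs) hs
  simpa using this

end OsgoodGauge

/-- Osgood's inequality: quantitative stability of trajectories. -/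
theorem OsgoodGauge.bihari {w ψ r : ℝ → ℝ} (hψ : OsgoodGauge w ψ) (hw : OsgoodModulus w)
    {a C T : ℝ} (hr : ContinuousOn r (Icc 0 T)) (hr0 : ∀ s ∈ Icc 0 T, 0 ≤ r s) (ha : 0 < a)
    (hC : 0 ≤ C) (h : ∀ t ∈ Icc 0 T, r t ≤ a + C * ∫ s in (0 : ℝ)..t, w (r s))
    {t : ℝ} (ht : t ∈ Icc 0 T) (hrt : 0 < r t) : ψ (r t) ≤ Real.exp (C * T) * ψ a := by
  obtain ⟨V, haV, hrV, hV⟩ := _root_.bihari (F := fun v => Real.log (ψ v)) hw.cont hw.mono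
    (fun s hs => hw.pos hs)
    (fun v hv => by
      have := (hψ.deriv v hv).log (hψ.pos v hv).ne'
      convert this using 1
      have := (hψ.pos v hv).ne'
      field_simp) hr
    (fun s hs => (hr0 s hs).trans (hw.le _ (hr0 s hs))) ha hC h ht
  have hV0 : 0 < V := ha.trans_le haV
  have h1 : ψ (r t) ≤ ψ V := hψ.monotoneOn hw hrt hV0 hrV
  have h2 := Real.exp_le_exp.2 hV
  rw [Real.exp_add, Real.exp_log (hψ.pos V hV0), Real.exp_log (hψ.pos a ha)] at h2
  have h3 : Real.exp (C * t) ≤ Real.exp (C * T) :=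
    Real.exp_le_exp.2 (mul_le_mul_of_nonneg_left ht.2 hC)
  nlinarith [hψ.pos a ha]

theorem OsgoodModulus.apply_zero {w : ℝ → ℝ} (hw : OsgoodModulus w) : w 0 = 0 := by
  by_contra hne
  have h0 : 0 < w 0 := lt_of_le_of_ne (hw.le 0 le_rfl) (Ne.symm hne)
  have : ∫⁻ s in Ioo 0 1, (ENNReal.ofReal (w s))⁻¹ ≤
      ∫⁻ _ in Ioo (0 : ℝ) 1, (ENNReal.ofReal (w 0))⁻¹ := by
    apply setLIntegral_mono measurable_const
    intro s hs
    exact ENNReal.inv_le_inv.2 (ENNReal.ofReal_le_ofReal (hw.mono hs.1.le))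
  rw [hw.div, top_le_iff] at this
  simp at this
  exact absurd this (not_le.2 h0)

end

section

theorem OsgoodModulus.stability {w : ℝ → ℝ} (hw : OsgoodModulus w) {C : ℝ} (hC : 0 ≤ C) (T : ℝ)
    {ε : ℝ} (hε : 0 < ε) :
    ∃ δ > 0, ∀ (r : ℝ → ℝ) (a T' : ℝ), T' ≤ T → ContinuousOn r (Icc 0 T') →
      (∀ s ∈ Icc 0 T', 0 ≤ r s) → 0 < a → a ≤ δ →
      (∀ t ∈ Icc 0 T', r t ≤ a + C * ∫ s in (0 : ℝ)..t, w (r s)) →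
      ∀ t ∈ Icc 0 T', r t < ε := by
  obtain ⟨ψ, hψ⟩ := hw.exists_gauge
  have h1 : Tendsto (fun a => Real.exp (C * T) * ψ a) (𝓝[>] 0) (𝓝 0) := by
    simpa using hψ.lim.const_mul (Real.exp (C * T))
  have h2 := h1.eventually (gt_mem_nhds (hψ.pos ε hε))
  obtain ⟨δ, hδ, hδ'⟩ := (mem_nhdsGT_iff_exists_Ioc_subset).1 h2
  refine ⟨δ, hδ, fun r a T' hT' hr hr0 ha haδ h t ht => ?_⟩
  by_contra! hεr
  have h3 := hψ.bihari hw hr hr0 ha hC h ht (hε.trans_le hεr)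
  have h4 : ψ ε ≤ ψ (r t) := hψ.monotoneOn hw hε (hε.trans_le hεr) hεr
  have h5 : Real.exp (C * T) * ψ a < ψ ε := hδ' ⟨ha, haδ⟩
  have h6 : Real.exp (C * T') ≤ Real.exp (C * T) :=
    Real.exp_le_exp.2 (mul_le_mul_of_nonneg_left hT' hC)
  nlinarith [hψ.pos a ha]

/-- A bounded vector field with a uniform Osgood modulus in space. -/
structure OsgoodField {n : ℕ} (b : ℝ → Rn n → Rn n) (K C : ℝ) (w : ℝ → ℝ) : Prop where
  meas : Measurable (Function.uncurry b)
  bound : ∀ t x, ‖b t x‖ ≤ K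
  mod : ∀ t x y, ‖b t x - b t y‖ ≤ C * w ‖x - y‖
  nonneg : 0 ≤ C

/-- `γ` is a trajectory of `b` on `[0, T]` starting at `x`. -/
def IsTrajectory {n : ℕ} (b : ℝ → Rn n → Rn n) (T : ℝ) (x : Rn n) (γ : ℝ → Rn n) : Prop :=
  Continuous γ ∧ ∀ t ∈ Icc 0 T, γ t = x + ∫ s in (0 : ℝ)..t, b s (γ s)

variable {n : ℕ} {b : ℝ → Rn n → Rn n} {w : ℝ → ℝ}

theorem intervalIntegrable_of_bounded {K : ℝ} {f : ℝ → Rn n} (hf : Measurable f)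
    (hK : ∀ t, ‖f t‖ ≤ K) (a c : ℝ) : IntervalIntegrable f volume a c := by
  rw [intervalIntegrable_iff]
  exact Measure.integrableOn_of_bounded (M := K) (by simp) hf.aestronglyMeasurable
    (ae_of_all _ hK)

theorem OsgoodField.measurable_comp {K C : ℝ} (hb : OsgoodField b K C w) {γ : ℝ → Rn n}
    (hγ : Measurable γ) : Measurable fun s => b s (γ s) :=
  hb.meas.comp (measurable_id.prodMk hγ)

theorem OsgoodModulus.continuous_of_le (hw : OsgoodModulus w) {C : ℝ} {f : Rn n → Rn n}
    (h : ∀ x y, ‖f x - f y‖ ≤ C * w ‖x - y‖) : Continuous f := by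
  rw [continuous_iff_continuousAt]
  intro x
  rw [ContinuousAt, tendsto_iff_norm_sub_tendsto_zero]
  have h1 : Tendsto (fun y => C * w ‖y - x‖) (𝓝 x) (𝓝 0) := by
    have : Continuous fun y => C * w ‖y - x‖ :=
      continuous_const.mul (hw.cont.comp (continuous_id.sub continuous_const).norm)
    simpa [hw.apply_zero] using this.tendsto x
  exact squeeze_zero (fun _ => norm_nonneg _) (fun y => h y x) h1

theorem OsgoodField.continuous {K C : ℝ} (hw : OsgoodModulus w) (hb : OsgoodField b K C w)
    (t : ℝ) : Continuous (b t) := hw.continuous_of_le (hb.mod t)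

/-- The Picard operator with delay `δ`. -/
noncomputable def delayPicard (b : ℝ → Rn n → Rn n) (x : Rn n) (δ : ℝ) (γ : ℝ → Rn n) :
    ℝ → Rn n := fun t => x + ∫ s in (0 : ℝ)..t, b s (γ (max (s - δ) 0))

theorem norm_primitive_sub_le {K : ℝ} {f : ℝ → Rn n} (hf : Measurable f)
    (hK : ∀ t, ‖f t‖ ≤ K) (t t' : ℝ) :
    ‖(∫ s in (0 : ℝ)..t, f s) - ∫ s in (0 : ℝ)..t', f s‖ ≤ K * |t - t'| := by
  rw [intervalIntegral.integral_interval_sub_left (intervalIntegrable_of_bounded hf hK _ _)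
    (intervalIntegrable_of_bounded hf hK _ _)]
  exact intervalIntegral.norm_integral_le_of_norm_le_const fun s _ => hK s

theorem continuous_of_norm_sub_le {K : ℝ} {γ : ℝ → Rn n}
    (h : ∀ t t', ‖γ t - γ t'‖ ≤ K * |t - t'|) : Continuous γ := by
  rw [continuous_iff_continuousAt]
  intro x
  rw [ContinuousAt, tendsto_iff_norm_sub_tendsto_zero]
  have h1 : Tendsto (fun y => K * |y - x|) (𝓝 x) (𝓝 0) := by
    have : Continuous fun y => K * |y - x| := by fun_prop
    simpa using this.tendsto x
  exact squeeze_zero (fun _ => norm_nonneg _) (fun y => h y x) h1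

theorem OsgoodField.delayPicard_lipschitz {K C : ℝ} (hb : OsgoodField b K C w) (x : Rn n)
    (δ : ℝ) {γ : ℝ → Rn n} (hγ : Continuous γ) (t t' : ℝ) :
    ‖delayPicard b x δ γ t - delayPicard b x δ γ t'‖ ≤ K * |t - t'| := by
  simp only [delayPicard, add_sub_add_left_eq_sub]
  exact norm_primitive_sub_le (hb.measurable_comp (by fun_prop)) (fun s => hb.bound _ _) _ _

theorem OsgoodField.exists_delayed {K C : ℝ} (hb : OsgoodField b K C w) (x : Rn n) (T : ℝ)
    {δ : ℝ} (hδ : 0 < δ) : ∃ γ : ℝ → Rn n, (∀ t t', ‖γ t - γ t'‖ ≤ K * |t - t'|) ∧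
      ∀ t ∈ Icc 0 T, γ t = x + ∫ s in (0 : ℝ)..t, b s (γ (max (s - δ) 0)) := by
  set g : ℕ → ℝ → Rn n := fun j => (delayPicard b x δ)^[j] (fun _ => x) with hg
  have hgs : ∀ j, g (j + 1) = delayPicard b x δ (g j) := fun j =>
    Function.iterate_succ_apply' _ _ _
  have hgc : ∀ j, Continuous (g j) := by
    intro j
    induction j with
    | zero => exact continuous_const
    | succ j ih =>
      rw [hgs]
      exact continuous_of_norm_sub_le (hb.delayPicard_lipschitz x δ ih)
  have hst : ∀ j : ℕ, ∀ t ∈ Icc 0 (j * δ), g (j + 1) t = g j t := by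
    intro j
    induction j with
    | zero =>
      intro t ht
      have : t = 0 := by simpa using ht
      rw [hgs, this]
      simp [delayPicard, hg]
    | succ j ih =>
      intro t ht
      have e : ∀ i, g (i + 1) t = x + ∫ s in (0 : ℝ)..t, b s (g i (max (s - δ) 0)) := fun i => by
        rw [hgs]; rfl
      rw [e (j + 1), e j]
      congr 1
      apply intervalIntegral.integral_congr
      intro s hs
      rw [uIcc_of_le ht.1] at hs
      have h2 := ht.2
      push_cast at h2
      simp only
      rw [ih]
      exact ⟨le_max_right _ _, max_le (by nlinarith [hs.2]) (by positivity)⟩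
  obtain ⟨N, hN⟩ := exists_nat_ge (T / δ)
  have hNT : T ≤ (N + 1 : ℕ) * δ := by
    rw [div_le_iff₀ hδ] at hN; push_cast; nlinarith
  refine ⟨g (N + 1), ?_, ?_⟩
  · rw [hgs]; exact hb.delayPicard_lipschitz x δ (hgc N)
  · intro t ht
    rw [← hst (N + 1) t ⟨ht.1, ht.2.trans hNT⟩, hgs (N + 1)]
    rfl

theorem OsgoodField.exists_trajectory {K C : ℝ} (hw : OsgoodModulus w)
    (hb : OsgoodField b K C w) (x : Rn n) {T : ℝ} (hT : 0 ≤ T) :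
    ∃ γ, IsTrajectory b T x γ := by
  have hK : 0 ≤ K := (norm_nonneg _).trans (hb.bound 0 0)
  have hd : ∀ k : ℕ, (0 : ℝ) < 1 / ((k : ℝ) + 1) := fun k => by positivity
  choose g hgL hg using fun k : ℕ => hb.exists_delayed x T (hd k)
  have hgc : ∀ k, Continuous (g k) := fun k => continuous_of_norm_sub_le (hgL k)
  have hshift : ∀ k, ∀ s, 0 ≤ s → ‖g k (max (s - 1 / ((k : ℝ) + 1)) 0) - g k s‖ ≤
      K * (1 / ((k : ℝ) + 1)) := by
    intro k s hs
    refine (hgL k _ _).trans (mul_le_mul_of_nonneg_left ?_ hK)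
    have := hd k
    rw [abs_le]
    constructor
    · linarith [le_max_left (s - 1 / ((k : ℝ) + 1)) 0]
    · have : max (s - 1 / ((k : ℝ) + 1)) 0 ≤ s := max_le (by linarith) hs
      linarith
  have hdlim := tendsto_one_div_add_atTop_nhds_zero_nat (𝕜 := ℝ)
  have hcauchy : ∀ ε > 0, ∃ N, ∀ k ≥ N, ∀ l ≥ N, ∀ t ∈ Icc 0 T, ‖g k t - g l t‖ < ε := by
    intro ε hε
    obtain ⟨δ, hδ, hstab⟩ := hw.stability hb.nonneg T hε
    have h1 : Tendsto (fun k : ℕ => K * (1 / ((k : ℝ) + 1))) atTop (𝓝 0) := by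
      simpa using hdlim.const_mul K
    obtain ⟨N, hN⟩ := eventually_atTop.1 (h1.eventually (gt_mem_nhds (half_pos hδ)))
    refine ⟨N, fun k hk l hl t ht => ?_⟩
    have := hstab (fun s => ‖g k s - g l s‖ + δ) δ T le_rfl
      (((hgc k).sub (hgc l)).norm.add continuous_const).continuousOn
      (fun s _ => by positivity) hδ le_rfl ?_ t ht
    · linarith
    intro t ht
    rw [hg k t ht, hg l t ht, add_sub_add_left_eq_sub, ← intervalIntegral.integral_sub
      (intervalIntegrable_of_bounded (hb.measurable_comp (by have := hgc k; fun_prop))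
        (fun _ => hb.bound _ _) _ _)
      (intervalIntegrable_of_bounded (hb.measurable_comp (by have := hgc l; fun_prop))
        (fun _ => hb.bound _ _) _ _), add_comm, ← intervalIntegral.integral_const_mul]
    gcongr
    apply intervalIntegral.norm_integral_le_of_norm_le ht.1
    · refine ae_of_all _ fun s hs => (hb.mod _ _ _).trans
        (mul_le_mul_of_nonneg_left (hw.mono ?_) hb.nonneg)
      have e : g k (max (s - 1 / ((k : ℝ) + 1)) 0) - g l (max (s - 1 / ((l : ℝ) + 1)) 0) =
          (g k (max (s - 1 / ((k : ℝ) + 1)) 0) - g k s) + (g k s - g l s) -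
          (g l (max (s - 1 / ((l : ℝ) + 1)) 0) - g l s) := by abel
      rw [e]
      have h2 := hshift k s hs.1.le
      have h3 := hshift l s hs.1.le
      have h4 := hN k hk
      have h5 := hN l hl
      refine (norm_sub_le _ _).trans ?_
      have := norm_add_le (g k (max (s - 1 / ((k : ℝ) + 1)) 0) - g k s) (g k s - g l s)
      linarith
    · apply Continuous.intervalIntegrable
      exact continuous_const.mul (hw.cont.comp
        (((hgc k).sub (hgc l)).norm.add continuous_const))
  have hlim : ∀ t ∈ Icc 0 T, ∃ y, Tendsto (fun k => g k t) atTop (𝓝 y) := by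
    intro t ht
    apply cauchySeq_tendsto_of_complete
    rw [Metric.cauchySeq_iff]
    intro ε hε
    obtain ⟨N, hN⟩ := hcauchy ε hε
    exact ⟨N, fun k hk l hl => by rw [dist_eq_norm]; exact hN k hk l hl t ht⟩
  choose! γ₀ hγ₀ using hlim
  set γ : ℝ → Rn n := fun t => γ₀ (projIcc 0 T hT t) with hγ
  have hγt : ∀ t ∈ Icc 0 T, γ t = γ₀ t := fun t ht => by
    simp only [hγ]; rw [projIcc_of_mem hT ht]
  have hγc : Continuous γ := by
    apply continuous_of_norm_sub_le (K := K)
    intro t t'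
    have h1 := ((hγ₀ _ (projIcc 0 T hT t).2).sub (hγ₀ _ (projIcc 0 T hT t').2)).norm
    refine le_of_tendsto h1 (Eventually.of_forall fun k => (hgL k _ _).trans ?_)
    exact mul_le_mul_of_nonneg_left (abs_projIcc_sub_projIcc hT) hK
  refine ⟨γ, hγc, fun t ht => ?_⟩
  have h1 : Tendsto (fun k => x + ∫ s in (0 : ℝ)..t, b s (g k (max (s - 1 / ((k : ℝ) + 1)) 0)))
      atTop (𝓝 (x + ∫ s in (0 : ℝ)..t, b s (γ s))) := by
    apply Tendsto.const_add
    apply intervalIntegral.tendsto_integral_filter_of_dominated_convergence (fun _ => K)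
    · exact Eventually.of_forall fun k =>
        (hb.measurable_comp (by have := hgc k; fun_prop)).aestronglyMeasurable
    · exact Eventually.of_forall fun k => ae_of_all _ fun s _ => hb.bound _ _
    · exact intervalIntegrable_const
    · refine ae_of_all _ fun s hs => ?_
      rw [uIoc_of_le ht.1] at hs
      have hsT : s ∈ Icc 0 T := ⟨hs.1.le, hs.2.trans ht.2⟩
      refine ((hb.continuous hw s).tendsto _).comp ?_
      rw [hγt s hsT]
      have h2 : Tendsto (fun k => g k (max (s - 1 / ((k : ℝ) + 1)) 0) - g k s) atTop (𝓝 0) := by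
        apply squeeze_zero_norm (fun k => hshift k s hs.1.le)
        simpa using hdlim.const_mul K
      simpa using h2.add (hγ₀ s hsT)
  refine tendsto_nhds_unique ?_ h1
  rw [hγt t ht]
  exact (hγ₀ t ht).congr fun k => hg k t ht

/-- A growth function `G` with `∫^∞ ds / G(s) = ∞`. -/
structure GrowthModulus (G : ℝ → ℝ) : Prop where
  cont : Continuous G
  mono : Monotone G
  pos : ∀ s, 0 < G s
  div : ∃ r : ℝ, 0 < r ∧ ∫⁻ s in Ioi r, (ENNReal.ofReal (G s))⁻¹ = (⊤ : ENNReal)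

/-- A vector field with controlled growth and a local Osgood modulus in space. -/
structure LocalOsgoodField {n : ℕ} (b : ℝ → Rn n → Rn n) (G w : ℝ → ℝ) : Prop where
  meas : Measurable (Function.uncurry b)
  growth : ∀ t x, ‖b t x‖ ≤ G ‖x‖
  mod : ∀ R : ℝ, 0 < R → ∃ C, 0 ≤ C ∧ ∀ t, ∀ x ∈ Metric.ball (0 : Rn n) R,
    ∀ y ∈ Metric.ball (0 : Rn n) R, ‖b t x - b t y‖ ≤ C * w ‖x - y‖

theorem GrowthModulus.tendsto_atTop {G : ℝ → ℝ} (hG : GrowthModulus G) :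
    Tendsto (fun v => ∫ s in (1 : ℝ)..v, (G s)⁻¹) atTop atTop := by
  have hcont : Continuous fun s => (G s)⁻¹ := hG.cont.inv₀ fun s => (hG.pos s).ne'
  set F : ℝ → ℝ := fun v => ∫ s in (1 : ℝ)..v, (G s)⁻¹ with hF
  have hint : ∀ a c, IntervalIntegrable (fun s => (G s)⁻¹) volume a c := fun a c =>
    hcont.intervalIntegrable a c
  have hmono : Monotone F := by
    intro a c hac
    have : F c - F a = ∫ s in a..c, (G s)⁻¹ :=
      intervalIntegral.integral_interval_sub_left (hint _ _) (hint _ _)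
    have h2 : 0 ≤ ∫ s in a..c, (G s)⁻¹ :=
      intervalIntegral.integral_nonneg hac fun s _ => (inv_nonneg.2 (hG.pos s).le)
    linarith
  refine tendsto_atTop_atTop_of_monotone hmono ?_
  by_contra! hcon
  obtain ⟨N, hN⟩ := hcon
  obtain ⟨r, -, hr⟩ := hG.div
  have h1 : IntegrableOn (fun s => (G s)⁻¹) (Ioi r) := by
    apply integrableOn_Ioi_of_intervalIntegral_norm_bounded (N - F r) r (b := fun k : ℕ => (k : ℝ))
      (l := atTop)
    · exact fun k => (hcont.integrableOn_Icc).mono_set Ioc_subset_Icc_self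
    · exact tendsto_natCast_atTop_atTop
    · refine Eventually.of_forall fun k => ?_
      have e : (fun s => ‖(G s)⁻¹‖) = fun s => (G s)⁻¹ := by
        ext s; exact Real.norm_of_nonneg (inv_nonneg.2 (hG.pos s).le)
      rw [e, ← intervalIntegral.integral_interval_sub_left (hint 1 _) (hint 1 _)]
      have := hN k
      linarith
  have h2 := h1.2
  rw [hasFiniteIntegral_iff_ofReal (ae_of_all _ fun s => inv_nonneg.2 (hG.pos s).le)] at h2
  refine h2.ne ?_
  rw [← hr]
  exact lintegral_congr fun s => ENNReal.ofReal_inv_of_pos (hG.pos s)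

namespace LocalOsgoodField

variable {G : ℝ → ℝ}

theorem measurable_comp (hb : LocalOsgoodField b G w) {γ : ℝ → Rn n}
    (hγ : Measurable γ) : Measurable fun s => b s (γ s) :=
  hb.meas.comp (measurable_id.prodMk hγ)

theorem intervalIntegrable (hb : LocalOsgoodField b G w) (hG : GrowthModulus G) {γ : ℝ → Rn n}
    (hγ : Continuous γ) (a c : ℝ) : IntervalIntegrable (fun s => b s (γ s)) volume a c :=
  ((hG.cont.comp hγ.norm).intervalIntegrable a c).mono_fun'
    (hb.measurable_comp hγ.measurable).aestronglyMeasurable (ae_of_all _ fun s => hb.growth s (γ s))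

end LocalOsgoodField

theorem GrowthModulus.exists_bound {G : ℝ → ℝ} (hG : GrowthModulus G) (T r₀ : ℝ) (hr₀ : 0 ≤ r₀) :
    ∃ R > 0, ∀ (b : ℝ → Rn n → Rn n) (T' : ℝ) (x : Rn n) (γ : ℝ → Rn n), T' ≤ T →
      (∀ t x, ‖b t x‖ ≤ G ‖x‖) → ‖x‖ ≤ r₀ → IsTrajectory b T' x γ →
      ∀ t ∈ Icc 0 T', ‖γ t‖ < R := by
  set F : ℝ → ℝ := fun v => ∫ s in (1 : ℝ)..v, (G s)⁻¹ with hF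
  obtain ⟨R, hR⟩ := ((hG.tendsto_atTop.eventually_gt_atTop (F (r₀ + 1) + T)).and
    (eventually_gt_atTop 0)).exists_forall_of_atTop
  refine ⟨R, (hR R le_rfl).2, fun b T' x γ hT' hb hx hγ t ht => ?_⟩
  obtain ⟨V, h1, h2, h3⟩ := bihari (F := F) (r := fun t => ‖γ t‖) (a := r₀ + 1) (C := 1) (T := T')
    hG.cont hG.mono
    (fun s _ => hG.pos s)
    (fun v hv => hasDerivAt_integral_inv hG.cont (fun s _ => hG.pos s) one_pos hv)
    hγ.1.norm.continuousOn (fun s _ => (hG.pos _).le) (by positivity) zero_le_one (by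
      intro s hs
      rw [hγ.2 s hs, one_mul]
      refine (norm_add_le _ _).trans (add_le_add (by linarith) ?_)
      apply intervalIntegral.norm_integral_le_of_norm_le hs.1
      · exact ae_of_all _ fun σ _ => hb _ _
      · exact (hG.cont.comp hγ.1.norm).intervalIntegrable _ _) ht
  by_contra! hle
  have := (hR V (hle.trans h2)).1
  have ht2 := ht.2
  linarith

/-- Radial cutoff: `1` on the ball of radius `R`, `0` outside the ball of radius `R + 1`. -/
noncomputable def radialCutoff (R : ℝ) (x : Rn n) : ℝ := max 0 (min 1 (R + 1 - ‖x‖))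

theorem radialCutoff_nonneg (R : ℝ) (x : Rn n) : 0 ≤ radialCutoff R x := le_max_left _ _

theorem radialCutoff_le_one (R : ℝ) (x : Rn n) : radialCutoff R x ≤ 1 :=
  max_le zero_le_one (min_le_left _ _)

theorem radialCutoff_eq_one {R : ℝ} {x : Rn n} (hx : ‖x‖ ≤ R) : radialCutoff R x = 1 := by
  have : (1 : ℝ) ≤ R + 1 - ‖x‖ := by linarith
  simp [radialCutoff, min_eq_left this]

theorem radialCutoff_eq_zero {R : ℝ} {x : Rn n} (hx : R + 1 ≤ ‖x‖) : radialCutoff R x = 0 := by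
  have : R + 1 - ‖x‖ ≤ 0 := by linarith
  exact max_eq_left ((min_le_right _ _).trans this)

theorem abs_radialCutoff_sub_le (R : ℝ) (x y : Rn n) :
    |radialCutoff R x - radialCutoff R y| ≤ ‖x - y‖ := by
  have h := abs_norm_sub_norm_le x y
  rw [abs_le] at h ⊢
  simp only [radialCutoff]
  constructor
  all_goals
    rcases max_cases 0 (min 1 (R + 1 - ‖x‖)) with h1 | h1 <;>
    rcases max_cases 0 (min 1 (R + 1 - ‖y‖)) with h2 | h2 <;>
    rcases min_cases 1 (R + 1 - ‖x‖) with h3 | h3 <;>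
    rcases min_cases 1 (R + 1 - ‖y‖) with h4 | h4 <;>
    linarith

theorem continuous_radialCutoff (R : ℝ) : Continuous (radialCutoff R : Rn n → ℝ) := by
  unfold radialCutoff; fun_prop

theorem LocalOsgoodField.cutoff {G : ℝ → ℝ} (hb : LocalOsgoodField b G w) (hG : GrowthModulus G)
    (hw : OsgoodModulus w) {R : ℝ} (hR : 0 < R) :
    ∃ C, OsgoodField (fun t x => radialCutoff R x • b t x) (G (R + 1)) C w := by
  obtain ⟨C, hC, hmod⟩ := hb.mod (R + 1) (by linarith)
  have hK : ∀ t x, ‖x‖ < R + 1 → ‖b t x‖ ≤ G (R + 1) := fun t x hx =>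
    (hb.growth t x).trans (hG.mono hx.le)
  have hkey : ∀ t x y, ‖x‖ < R + 1 →
      ‖radialCutoff R x • b t x - radialCutoff R y • b t y‖ ≤ (C + G (R + 1)) * w ‖x - y‖ := by
    intro t x y hx
    have hwn : ‖x - y‖ ≤ w ‖x - y‖ := hw.le _ (norm_nonneg _)
    have hwn0 : 0 ≤ w ‖x - y‖ := (norm_nonneg _).trans hwn
    have hc := abs_radialCutoff_sub_le R x y
    have hGp := hG.pos (R + 1)
    by_cases hy : ‖y‖ < R + 1
    · have e : radialCutoff R x • b t x - radialCutoff R y • b t y =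
          radialCutoff R y • (b t x - b t y) +
          (radialCutoff R x - radialCutoff R y) • b t x := by
        rw [smul_sub, sub_smul]; abel
      rw [e]
      refine (norm_add_le _ _).trans ?_
      rw [norm_smul, norm_smul, add_mul]
      refine add_le_add ?_ ?_
      · rw [Real.norm_of_nonneg (radialCutoff_nonneg R y)]
        have h1 := hmod t x (by simpa using hx) y (by simpa using hy)
        calc _ ≤ 1 * ‖b t x - b t y‖ := by gcongr; exact radialCutoff_le_one R y
          _ ≤ _ := by linarith
      · rw [mul_comm, Real.norm_eq_abs]
        exact mul_le_mul (hK t x hx) (hc.trans hwn) (abs_nonneg _) hGp.le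
    · rw [radialCutoff_eq_zero (not_lt.1 hy), zero_smul, sub_zero, norm_smul, Real.norm_eq_abs]
      rw [radialCutoff_eq_zero (not_lt.1 hy), sub_zero] at hc
      have := mul_le_mul (hK t x hx) (hc.trans hwn) (abs_nonneg _) hGp.le
      have h3 : 0 ≤ C * w ‖x - y‖ := by positivity
      linarith
  refine ⟨C + G (R + 1), ?_, ?_, ?_, ?_⟩
  · exact ((continuous_radialCutoff R).measurable.comp measurable_snd).smul hb.meas
  · intro t x
    rw [norm_smul, Real.norm_of_nonneg (radialCutoff_nonneg R x)]
    by_cases hx : ‖x‖ < R + 1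
    · have := hK t x hx
      have h2 := mul_le_mul (radialCutoff_le_one R x) this (norm_nonneg _) zero_le_one
      linarith
    · rw [radialCutoff_eq_zero (not_lt.1 hx), zero_mul]; exact (hG.pos _).le
  · intro t x y
    by_cases hx : ‖x‖ < R + 1
    · exact hkey t x y hx
    by_cases hy : ‖y‖ < R + 1
    · rw [norm_sub_rev, norm_sub_rev x y]; exact hkey t y x hy
    · rw [radialCutoff_eq_zero (not_lt.1 hx), radialCutoff_eq_zero (not_lt.1 hy)]
      have := hw.le _ (norm_nonneg (x - y))
      have h1 := norm_nonneg (x - y)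
      have h2 := (hG.pos (R + 1)).le
      simp only [zero_smul, sub_zero, norm_zero]
      exact mul_nonneg (by linarith) (h1.trans this)
  · have := (hG.pos (R + 1)).le
    linarith

namespace LocalOsgoodField

variable {G : ℝ → ℝ}

theorem exists_trajectory (hb : LocalOsgoodField b G w) (hG : GrowthModulus G)
    (hw : OsgoodModulus w) (x : Rn n) {T : ℝ} (hT : 0 ≤ T) : ∃ γ, IsTrajectory b T x γ := by
  obtain ⟨R, hR, hbd⟩ := hG.exists_bound (n := n) T ‖x‖ (norm_nonneg x)
  obtain ⟨C, hC⟩ := hb.cutoff hG hw hR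
  obtain ⟨γ, hγ⟩ := hC.exists_trajectory hw x hT
  have h1 := hbd _ T x γ le_rfl (fun t x => by
    rw [norm_smul, Real.norm_of_nonneg (radialCutoff_nonneg R x)]
    have h2 := mul_le_mul (radialCutoff_le_one R x) (hb.growth t x) (norm_nonneg _) zero_le_one
    linarith) le_rfl hγ
  refine ⟨γ, hγ.1, fun t ht => ?_⟩
  rw [hγ.2 t ht]
  congr 1
  apply intervalIntegral.integral_congr
  intro s hs
  rw [uIcc_of_le ht.1] at hs
  simp only
  rw [radialCutoff_eq_one (h1 s ⟨hs.1, hs.2.trans ht.2⟩).le, one_smul]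

theorem stability (hb : LocalOsgoodField b G w) (hG : GrowthModulus G)
    (hw : OsgoodModulus w) {r₀ : ℝ} (hr₀ : 0 ≤ r₀) (T : ℝ) {ε : ℝ} (hε : 0 < ε) :
    ∃ δ > 0, ∀ (T' : ℝ) (x y : Rn n) (γ η : ℝ → Rn n), T' ≤ T → ‖x‖ ≤ r₀ → ‖y‖ ≤ r₀ →
      ‖x - y‖ < δ → IsTrajectory b T' x γ → IsTrajectory b T' y η →
      ∀ t ∈ Icc 0 T', ‖γ t - η t‖ < ε := by
  obtain ⟨R, hR, hbd⟩ := hG.exists_bound (n := n) T r₀ hr₀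
  obtain ⟨C, hC, hmod⟩ := hb.mod R hR
  obtain ⟨δ, hδ, hstab⟩ := hw.stability hC T hε
  refine ⟨δ, hδ, fun T' x y γ η hT' hx hy hxy hγ hη t ht => ?_⟩
  have hγR := hbd b T' x γ hT' hb.growth hx hγ
  have hηR := hbd b T' y η hT' hb.growth hy hη
  refine hstab (fun s => ‖γ s - η s‖) δ T' hT' (hγ.1.sub hη.1).norm.continuousOn
    (fun s _ => norm_nonneg _) hδ le_rfl ?_ t ht
  intro t ht
  have e : γ t - η t = (x - y) + ∫ s in (0 : ℝ)..t, (b s (γ s) - b s (η s)) := by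
    rw [intervalIntegral.integral_sub (hb.intervalIntegrable hG hγ.1 _ _)
      (hb.intervalIntegrable hG hη.1 _ _), hγ.2 t ht, hη.2 t ht]
    abel
  rw [e]
  refine (norm_add_le _ _).trans (add_le_add hxy.le ?_)
  rw [← intervalIntegral.integral_const_mul]
  apply intervalIntegral.norm_integral_le_of_norm_le ht.1
  · refine ae_of_all _ fun s hs => ?_
    have hs' : s ∈ Icc 0 T' := ⟨hs.1.le, hs.2.trans ht.2⟩
    exact hmod s _ (by simpa using hγR s hs') _ (by simpa using hηR s hs')
  · exact (continuous_const.mul (hw.cont.comp (hγ.1.sub hη.1).norm)).intervalIntegrable _ _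

theorem trajectory_unique (hb : LocalOsgoodField b G w) (hG : GrowthModulus G)
    (hw : OsgoodModulus w) {T : ℝ} {x : Rn n} {γ η : ℝ → Rn n} (hγ : IsTrajectory b T x γ)
    (hη : IsTrajectory b T x η) : ∀ t ∈ Icc 0 T, γ t = η t := by
  intro t ht
  by_contra hne
  have hpos : 0 < ‖γ t - η t‖ := norm_pos_iff.2 (sub_ne_zero.2 hne)
  obtain ⟨δ, hδ, h⟩ := hb.stability hG hw (norm_nonneg x) T hpos
  exact lt_irrefl _ (h T x x γ η le_rfl le_rfl le_rfl (by simpa using hδ) hγ hη t ht)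

end LocalOsgoodField

/-- The time reversal of a vector field. -/
def timeReversal (t : ℝ) (b : ℝ → Rn n → Rn n) : ℝ → Rn n → Rn n := fun r x => -b (t - r) x

theorem timeReversal_timeReversal (t : ℝ) (b : ℝ → Rn n → Rn n) :
    timeReversal t (timeReversal t b) = b := by
  ext r x; simp [timeReversal]

theorem LocalOsgoodField.timeReversal {G : ℝ → ℝ} (hb : LocalOsgoodField b G w) (t : ℝ) :
    LocalOsgoodField (timeReversal t b) G w where
  meas := (hb.meas.comp ((measurable_const.sub measurable_fst).prodMk measurable_snd)).neg
  growth r x := by simpa [_root_.timeReversal] using hb.growth (t - r) x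
  mod R hR := by
    obtain ⟨C, hC, h⟩ := hb.mod R hR
    refine ⟨C, hC, fun r x hx y hy => ?_⟩
    have := h (t - r) x hx y hy
    simp only [_root_.timeReversal]
    rwa [neg_sub_neg, norm_sub_rev]

theorem IsTrajectory.mono {T T' : ℝ} {x : Rn n} {γ : ℝ → Rn n} (hγ : IsTrajectory b T x γ)
    (h : T' ≤ T) : IsTrajectory b T' x γ := ⟨hγ.1, fun t ht => hγ.2 t ⟨ht.1, ht.2.trans h⟩⟩

theorem LocalOsgoodField.trajectory_timeReversal {G : ℝ → ℝ} (hb : LocalOsgoodField b G w)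
    (hG : GrowthModulus G) {t : ℝ} (ht : 0 ≤ t) {x : Rn n} {γ : ℝ → Rn n}
    (hγ : IsTrajectory b t x γ) :
    IsTrajectory (_root_.timeReversal t b) t (γ t) (fun r => γ (t - r)) := by
  refine ⟨hγ.1.comp (continuous_const.sub continuous_id), fun r hr => ?_⟩
  have hi := hb.intervalIntegrable hG hγ.1
  have h1 : ∫ s in (0 : ℝ)..r, _root_.timeReversal t b s (γ (t - s)) =
      -∫ s in (t - r)..t, b s (γ s) := by
    simp only [_root_.timeReversal, intervalIntegral.integral_neg]
    rw [intervalIntegral.integral_comp_sub_left (fun s => b s (γ s)) t, sub_zero]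
  change γ (t - r) = _
  rw [h1, hγ.2 t ⟨ht, le_rfl⟩, hγ.2 (t - r) ⟨by linarith [hr.2], by linarith [hr.1]⟩,
    ← intervalIntegral.integral_interval_sub_left (hi 0 t) (hi 0 (t - r))]
  abel

theorem LocalOsgoodField.exists_flow {G : ℝ → ℝ} (hb : LocalOsgoodField b G w)
    (hG : GrowthModulus G) (hw : OsgoodModulus w) {T : ℝ} (hT : 0 ≤ T) :
    ∃ φ : ℝ → Rn n → Rn n, (∀ x, IsTrajectory b T x fun t => φ t x) ∧
      ∀ t ∈ Icc 0 T, IsHomeomorph (φ t) := by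
  choose γ hγ using fun x => hb.exists_trajectory hG hw x hT
  refine ⟨fun t x => γ x t, hγ, fun t ht => ?_⟩
  have hb' := hb.timeReversal t
  choose ζ hζ using fun y => hb'.exists_trajectory hG hw y ht.1
  have hγt : ∀ x, IsTrajectory b t x (γ x) := fun x => (hγ x).mono ht.2
  have cont : ∀ {c : ℝ → Rn n → Rn n} (_ : LocalOsgoodField c G w) {g : Rn n → ℝ → Rn n}
      (_ : ∀ x, IsTrajectory c t x (g x)), Continuous fun x => g x t := by
    intro c hc g hg
    rw [Metric.continuous_iff]
    intro x ε hε
    obtain ⟨δ, hδ, h⟩ := hc.stability hG hw (r₀ := ‖x‖ + 1) (by positivity) t hε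
    refine ⟨min δ 1, lt_min hδ one_pos, fun y hy => ?_⟩
    rw [dist_eq_norm] at hy ⊢
    refine h t y x _ _ le_rfl ?_ (by linarith) (hy.trans_le (min_le_left _ _)) (hg y) (hg x) t
      ⟨ht.1, le_rfl⟩
    have := norm_sub_norm_le y x
    linarith [hy.le.trans (min_le_right δ 1)]
  let e : Rn n ≃ₜ Rn n :=
    { toFun := fun x => γ x t
      invFun := fun y => ζ y t
      left_inv := fun x => by
        have h1 := hb.trajectory_timeReversal hG ht.1 (hγt x)
        have h2 := hb'.trajectory_unique hG hw (hζ (γ x t)) h1 t ⟨ht.1, le_rfl⟩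
        simp only at h2 ⊢
        rw [h2, sub_self, (hγt x).2 0 ⟨le_rfl, ht.1⟩]
        simp
      right_inv := fun y => by
        have h1 := hb'.trajectory_timeReversal hG ht.1 (hζ y)
        rw [timeReversal_timeReversal] at h1
        have h2 := hb.trajectory_unique hG hw (hγt (ζ y t)) h1 t ⟨ht.1, le_rfl⟩
        simp only at h2 ⊢
        rw [h2, sub_self, (hζ y).2 0 ⟨le_rfl, ht.1⟩]
        simp
      continuous_toFun := cont hb hγt
      continuous_invFun := cont hb' hζ }
  exact e.isHomeomorph

end

section

theorem exists_abs_deriv_smoothTransition_le :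
    ∃ c : ℝ, 0 < c ∧ ∀ t, |deriv Real.smoothTransition t| ≤ c := by
  have hc : Continuous (deriv Real.smoothTransition) :=
    (Real.smoothTransition.contDiff (n := 1)).continuous_deriv le_rfl
  obtain ⟨c, hc'⟩ := (isCompact_Icc (a := (0 : ℝ)) (b := 1)).exists_bound_of_continuousOn
    hc.continuousOn
  refine ⟨max c 1, by positivity, fun t => ?_⟩
  by_cases ht : t ∈ Icc (0 : ℝ) 1
  · exact (hc' t ht).trans (le_max_left _ _)
  · have : deriv Real.smoothTransition t = 0 := by
      rw [mem_Icc, not_and_or, not_le, not_le] at ht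
      rcases ht with ht | ht
      · have : Real.smoothTransition =ᶠ[𝓝 t] fun _ => 0 := by
          filter_upwards [Iio_mem_nhds ht] with s hs
          exact Real.smoothTransition.zero_of_nonpos (le_of_lt hs)
        rw [this.deriv_eq, deriv_const]
      · have : Real.smoothTransition =ᶠ[𝓝 t] fun _ => 1 := by
          filter_upwards [Ioi_mem_nhds ht] with s hs
          exact Real.smoothTransition.one_of_one_le (le_of_lt hs)
        rw [this.deriv_eq, deriv_const]
    rw [this, abs_zero]; positivity

theorem deriv_smoothTransition_eq_zero {t : ℝ} (ht : t ∉ Ioo (0 : ℝ) 1) :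
    deriv Real.smoothTransition t = 0 := by
  have hmin : ∀ s ≤ (0 : ℝ), deriv Real.smoothTransition s = 0 := fun s hs => by
    apply IsLocalMin.deriv_eq_zero
    refine Eventually.of_forall fun y => ?_
    rw [Real.smoothTransition.zero_of_nonpos hs]
    exact Real.smoothTransition.nonneg y
  have hmax : ∀ s ≥ (1 : ℝ), deriv Real.smoothTransition s = 0 := fun s hs => by
    apply IsLocalMax.deriv_eq_zero
    refine Eventually.of_forall fun y => ?_
    rw [Real.smoothTransition.one_of_one_le hs]
    exact Real.smoothTransition.le_one y
  rw [mem_Ioo, not_and_or, not_lt, not_lt] at ht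
  exact ht.elim (hmin t) (hmax t)

/-- The derivative of `Φ` along the space-time field `(1, b)`. -/
noncomputable def transportDeriv {n : ℕ} (b : ℝ → Rn n → Rn n) (Φ : ℝ × Rn n → ℝ)
    (p : ℝ × Rn n) : ℝ := fderiv ℝ Φ p (1, b p.1 p.2)

/-- The integral against the difference of two measures. -/
noncomputable def integralDiff {X : Type*} [MeasurableSpace X] (M₁ M₂ : Measure X) (f : X → ℝ) :
    ℝ := (∫ p, f p ∂M₁) - ∫ p, f p ∂M₂

section integralDiff

variable {X : Type*} [MeasurableSpace X] {M₁ M₂ : Measure X} {f g : X → ℝ}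

theorem integralDiff_add (hf : Integrable f (M₁ + M₂)) (hg : Integrable g (M₁ + M₂)) :
    integralDiff M₁ M₂ (fun p => f p + g p) = integralDiff M₁ M₂ f + integralDiff M₁ M₂ g := by
  rw [integrable_add_measure] at hf hg
  simp only [integralDiff]
  rw [integral_add hf.1 hg.1, integral_add hf.2 hg.2]; ring

theorem integralDiff_sub (hf : Integrable f (M₁ + M₂)) (hg : Integrable g (M₁ + M₂)) :
    integralDiff M₁ M₂ (fun p => f p - g p) = integralDiff M₁ M₂ f - integralDiff M₁ M₂ g := by
  rw [integrable_add_measure] at hf hg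
  simp only [integralDiff]
  rw [integral_sub hf.1 hg.1, integral_sub hf.2 hg.2]; ring

theorem integralDiff_const_mul (c : ℝ) :
    integralDiff M₁ M₂ (fun p => c * f p) = c * integralDiff M₁ M₂ f := by
  simp only [integralDiff, integral_const_mul]; ring

theorem integralDiff_congr (h : f =ᵐ[M₁ + M₂] g) :
    integralDiff M₁ M₂ f = integralDiff M₁ M₂ g := by
  simp only [integralDiff]
  rw [integral_congr_ae ((Measure.le_add_right le_rfl).absolutelyContinuous.ae_le h),
    integral_congr_ae ((Measure.le_add_left le_rfl).absolutelyContinuous.ae_le h)]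

theorem abs_integralDiff_le (hf : Integrable f (M₁ + M₂)) :
    |integralDiff M₁ M₂ f| ≤ ∫ p, |f p| ∂(M₁ + M₂) := by
  have h := hf
  rw [integrable_add_measure] at h
  rw [integral_add_measure h.1.abs h.2.abs]
  refine (abs_sub _ _).trans (add_le_add ?_ ?_)
  · exact abs_integral_le_integral_abs
  · exact abs_integral_le_integral_abs

theorem abs_integralDiff_le_of_le {h : X → ℝ} (hf : Integrable f (M₁ + M₂))
    (hh : Integrable h (M₁ + M₂)) (hle : ∀ᵐ p ∂(M₁ + M₂), |f p| ≤ h p) :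
    |integralDiff M₁ M₂ f| ≤ ∫ p, h p ∂(M₁ + M₂) :=
  (abs_integralDiff_le hf).trans (integral_mono_ae hf.abs hh hle)

theorem tendsto_integralDiff {ι : Type*} {l : Filter ι} [l.IsCountablyGenerated]
    {F : ι → X → ℝ} (bound : X → ℝ)
    (hF : ∀ᶠ i in l, AEStronglyMeasurable (F i) (M₁ + M₂))
    (hb : ∀ᶠ i in l, ∀ᵐ p ∂(M₁ + M₂), ‖F i p‖ ≤ bound p) (hbi : Integrable bound (M₁ + M₂))
    (hlim : ∀ᵐ p ∂(M₁ + M₂), Tendsto (fun i => F i p) l (𝓝 (f p))) :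
    Tendsto (fun i => integralDiff M₁ M₂ (F i)) l (𝓝 (integralDiff M₁ M₂ f)) := by
  have h1 : M₁ ≪ M₁ + M₂ := (Measure.le_add_right le_rfl).absolutelyContinuous
  have h2 : M₂ ≪ M₁ + M₂ := (Measure.le_add_left le_rfl).absolutelyContinuous
  rw [integrable_add_measure] at hbi
  exact (tendsto_integral_filter_of_dominated_convergence bound
      (hF.mono fun i h => h.mono_ac h1) (hb.mono fun i h => h1.ae_le h) hbi.1
      (h1.ae_le hlim)).sub
    (tendsto_integral_filter_of_dominated_convergence bound
      (hF.mono fun i h => h.mono_ac h2) (hb.mono fun i h => h2.ae_le h) hbi.2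
      (h2.ae_le hlim))

end integralDiff

/-- Smooth functions on space-time with support in a cylinder of radius `R`. -/
def SpaceSupported {n : ℕ} (R : ℝ) (Φ : ℝ × Rn n → ℝ) : Prop :=
  ContDiff ℝ ∞ Φ ∧ ∀ p, R ≤ ‖p.2‖ → Φ p = 0

/-- The difference `M₁ - M₂`, concentrated on `(0, T) × ℝⁿ`, solves the continuity equation with
vanishing initial datum, as far as test functions supported in the cylinder of radius `R` can
tell. -/
structure LocalWeakSolution {n : ℕ} (T R : ℝ) (b : ℝ → Rn n → Rn n)
    (M₁ M₂ : Measure (ℝ × Rn n)) : Prop where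
  ac : (M₁ + M₂).map Prod.fst ≪ volume
  supp : ∀ᵐ p ∂(M₁ + M₂), p.1 ∈ Ioo 0 T
  weak : ∀ φ, IsTestFunction T φ → (∀ p, R ≤ ‖p.2‖ → φ p = 0) →
    integralDiff M₁ M₂ (transportDeriv b φ) = 0

/-- The integral of `⟨b, ∇g⟩` against `M₁ - M₂` over times up to `s`. -/
noncomputable def flux {n : ℕ} (b : ℝ → Rn n → Rn n) (M₁ M₂ : Measure (ℝ × Rn n)) (s : ℝ)
    (g : Rn n → ℝ) : ℝ :=
  integralDiff M₁ M₂ ({p | p.1 ≤ s}.indicator (transportDeriv b fun p => g p.2))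

variable {n : ℕ}

theorem exists_timeDensity (E : Measure (ℝ × Rn n)) [IsFiniteMeasure E]
    (hE : E.map Prod.fst ≪ volume) :
    ∃ m : ℝ → ℝ, (∀ t, 0 ≤ m t) ∧ Integrable m ∧
      (∀ a c, a ≤ c → E.real (Ioc a c ×ˢ univ) = ∫ t in a..c, m t) ∧
      ∫ t, m t = E.real univ := by
  have hfin : IsFiniteMeasure (E.map Prod.fst) := inferInstance
  have key : ∀ S, MeasurableSet S →
      ∫ t in S, ((E.map Prod.fst).rnDeriv volume t).toReal = E.real (S ×ˢ univ) := by
    intro S hS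
    rw [Measure.setIntegral_toReal_rnDeriv hE]
    rw [measureReal_def, measureReal_def, Measure.map_apply measurable_fst hS]
    congr 2
    ext; simp
  refine ⟨fun t => ((E.map Prod.fst).rnDeriv volume t).toReal, fun t => ENNReal.toReal_nonneg,
    Measure.integrable_toReal_rnDeriv, fun a c hac => ?_, ?_⟩
  · rw [intervalIntegral.integral_of_le hac, key _ measurableSet_Ioc]
  · have := key univ MeasurableSet.univ
    simpa using this

theorem SpaceSupported.exists_bound {R : ℝ} {Φ : ℝ × Rn n → ℝ} (hΦ : SpaceSupported R Φ)
    (a c : ℝ) : ∃ L, 0 ≤ L ∧ ∀ p : ℝ × Rn n, p.1 ∈ Icc a c → |Φ p| ≤ L ∧ ‖fderiv ℝ Φ p‖ ≤ L := by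
  have hcomp : IsCompact (Icc a c ×ˢ Metric.closedBall (0 : Rn n) R) :=
    isCompact_Icc.prod (isCompact_closedBall _ _)
  obtain ⟨L₁, h₁⟩ := hcomp.exists_bound_of_continuousOn hΦ.1.continuous.continuousOn
  obtain ⟨L₂, h₂⟩ := hcomp.exists_bound_of_continuousOn
    (hΦ.1.continuous_fderiv (by simp)).continuousOn
  refine ⟨max 0 (max L₁ L₂), le_max_left _ _, fun p hp => ?_⟩
  by_cases hx : ‖p.2‖ ≤ R
  · have hmem : p ∈ Icc a c ×ˢ Metric.closedBall (0 : Rn n) R := ⟨hp, by simpa using hx⟩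
    exact ⟨(h₁ p hmem).trans ((le_max_left _ _).trans (le_max_right _ _)),
      (h₂ p hmem).trans ((le_max_right _ _).trans (le_max_right _ _))⟩
  · push Not at hx
    have he : Φ =ᶠ[𝓝 p] fun _ => 0 := by
      have : {q : ℝ × Rn n | R < ‖q.2‖} ∈ 𝓝 p :=
        (isOpen_lt continuous_const (by fun_prop)).mem_nhds hx
      filter_upwards [this] with q hq
      exact hΦ.2 q (le_of_lt hq)
    rw [he.fderiv_eq, hΦ.2 p hx.le]
    simp

theorem SpaceSupported.snd {R : ℝ} {g : Rn n → ℝ} (hg : ContDiff ℝ ∞ g)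
    (h0 : ∀ x, R ≤ ‖x‖ → g x = 0) : SpaceSupported R fun p : ℝ × Rn n => g p.2 :=
  ⟨hg.comp contDiff_snd, fun _ hp => h0 _ hp⟩

theorem measurable_transportDeriv {b : ℝ → Rn n → Rn n} (hb : Measurable (Function.uncurry b))
    {Φ : ℝ × Rn n → ℝ} (hΦ : ContDiff ℝ ∞ Φ) : Measurable (transportDeriv b Φ) := by
  have h1 : Continuous fun q : (ℝ × Rn n) × (ℝ × Rn n) => fderiv ℝ Φ q.1 q.2 :=
    ((hΦ.continuous_fderiv (by simp)).comp continuous_fst).clm_apply continuous_snd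
  exact h1.measurable.comp (measurable_id.prodMk (measurable_const.prodMk hb))

section weak

variable {T R K : ℝ} {b : ℝ → Rn n → Rn n} {M₁ M₂ : Measure (ℝ × Rn n)}
  [IsFiniteMeasure M₁] [IsFiniteMeasure M₂]

theorem abs_transportDeriv_le (hbd : ∀ t x, ‖b t x‖ ≤ K) {Φ : ℝ × Rn n → ℝ} {L : ℝ}
    {p : ℝ × Rn n} (h : ‖fderiv ℝ Φ p‖ ≤ L) : |transportDeriv b Φ p| ≤ L * (1 + K) := by
  refine ((fderiv ℝ Φ p).le_opNorm _).trans ?_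
  have : ‖((1 : ℝ), b p.1 p.2)‖ ≤ 1 + K := by
    have h0 := hbd p.1 p.2
    rw [Prod.norm_def]
    simp only [norm_one]
    have := norm_nonneg (b p.1 p.2)
    exact max_le (by linarith) (by linarith)
  exact mul_le_mul h this (norm_nonneg _) ((norm_nonneg _).trans h)

theorem LocalWeakSolution.integrable_transportDeriv (hM : LocalWeakSolution T R b M₁ M₂)
    (hb : Measurable (Function.uncurry b)) (hbd : ∀ t x, ‖b t x‖ ≤ K) {R' : ℝ}
    {Φ : ℝ × Rn n → ℝ} (hΦ : SpaceSupported R' Φ) :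
    Integrable (transportDeriv b Φ) (M₁ + M₂) := by
  obtain ⟨L, hL, hL'⟩ := hΦ.exists_bound 0 T
  refine Integrable.of_bound (measurable_transportDeriv hb hΦ.1).aestronglyMeasurable
    (L * (1 + K)) ?_
  filter_upwards [hM.supp] with p hp
  exact abs_transportDeriv_le hbd (hL' p ⟨hp.1.le, hp.2.le⟩).2

theorem measurableSet_fst_le (s : ℝ) : MeasurableSet {p : ℝ × Rn n | p.1 ≤ s} :=
  measurableSet_le measurable_fst measurable_const

theorem exists_cutoff_estimate : ∃ c : ℝ, 0 < c ∧ ∀ {n : ℕ} {T R K : ℝ} {b : ℝ → Rn n → Rn n}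
    {M₁ M₂ : Measure (ℝ × Rn n)} [IsFiniteMeasure M₁] [IsFiniteMeasure M₂]
    (_ : LocalWeakSolution T R b M₁ M₂) (_ : Measurable (Function.uncurry b))
    (_ : ∀ t x, ‖b t x‖ ≤ K) {Φ : ℝ × Rn n → ℝ} (_ : SpaceSupported R Φ) {t₀ : ℝ} (_ : t₀ < T)
    {β : ℝ → ℝ} {β₀ : ℝ} (_ : Tendsto β (𝓝[>] 0) (𝓝 β₀))
    (_ : ∀ᶠ δ in 𝓝[>] 0, ∫ p in Ioo t₀ (t₀ + δ) ×ˢ univ, |Φ p| ∂(M₁ + M₂) ≤ δ * β δ),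
    |integralDiff M₁ M₂ ({p | p.1 ≤ t₀}.indicator (transportDeriv b Φ))| ≤ c * β₀ := by
  obtain ⟨c, hc, hcb⟩ := exists_abs_deriv_smoothTransition_le
  refine ⟨c, hc, ?_⟩
  intro n T R K b M₁ M₂ _ _ hM hb hbd Φ hΦ t₀ ht₀ β β₀ hβ hle
  set χ := Real.smoothTransition with hχ
  have hχs : ContDiff ℝ ∞ χ := Real.smoothTransition.contDiff
  have hD := hM.integrable_transportDeriv hb hbd hΦ
  obtain ⟨L, hL, hL'⟩ := hΦ.exists_bound 0 T
  have hΦi : Integrable Φ (M₁ + M₂) := by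
    refine Integrable.of_bound hΦ.1.continuous.aestronglyMeasurable L ?_
    filter_upwards [hM.supp] with p hp
    exact (hL' p ⟨hp.1.le, hp.2.le⟩).1
  set θ : ℝ → ℝ → ℝ := fun δ t => 1 - χ ((t - t₀) / δ) with hθ
  have hθ01 : ∀ δ t, |θ δ t| ≤ 1 := fun δ t => by
    have h1 := Real.smoothTransition.nonneg ((t - t₀) / δ)
    have h2 := Real.smoothTransition.le_one ((t - t₀) / δ)
    rw [abs_le]; constructor <;> simp only [hθ, hχ] <;> linarith
  have hθd : ∀ δ t, HasDerivAt (θ δ) (-(deriv χ ((t - t₀) / δ) * δ⁻¹)) t := by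
    intro δ t
    have h1 : HasDerivAt (fun t => (t - t₀) / δ) (δ⁻¹) t := by
      simpa [div_eq_mul_inv] using ((hasDerivAt_id t).sub_const t₀).mul_const δ⁻¹
    have h2 : HasDerivAt χ (deriv χ ((t - t₀) / δ)) ((t - t₀) / δ) :=
      (hχs.differentiable (by simp) _).hasDerivAt
    exact (h2.comp t h1).const_sub 1
  have hθs : ∀ δ, ContDiff ℝ ∞ (θ δ) := fun δ => by
    have : ContDiff ℝ ∞ fun t : ℝ => (t - t₀) / δ := by fun_prop
    exact contDiff_const.sub (hχs.comp this)
  have hlim : Tendsto (fun δ => integralDiff M₁ M₂ fun p => θ δ p.1 * transportDeriv b Φ p)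
      (𝓝[>] 0) (𝓝 (integralDiff M₁ M₂ ({p | p.1 ≤ t₀}.indicator (transportDeriv b Φ)))) := by
    apply tendsto_integralDiff (fun p => |transportDeriv b Φ p|)
    · refine Eventually.of_forall fun δ => ?_
      exact (((hθs δ).continuous.comp continuous_fst).measurable.mul
        (measurable_transportDeriv hb hΦ.1)).aestronglyMeasurable
    · refine Eventually.of_forall fun δ => ae_of_all _ fun p => ?_
      rw [norm_mul, Real.norm_eq_abs, Real.norm_eq_abs]
      exact mul_le_of_le_one_left (abs_nonneg _) (hθ01 δ p.1)
    · exact hD.abs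
    · refine ae_of_all _ fun p => ?_
      by_cases hp : p.1 ≤ t₀
      · rw [indicator_of_mem (show p ∈ {p : ℝ × Rn n | p.1 ≤ t₀} from hp)]
        refine tendsto_const_nhds.congr' ?_
        filter_upwards [self_mem_nhdsWithin] with δ hδ
        have : (p.1 - t₀) / δ ≤ 0 := div_nonpos_of_nonpos_of_nonneg (by linarith) (le_of_lt hδ)
        simp [hθ, hχ, Real.smoothTransition.zero_of_nonpos this]
      · rw [indicator_of_notMem (show p ∉ {p : ℝ × Rn n | p.1 ≤ t₀} from hp)]
        refine tendsto_const_nhds.congr' ?_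
        push Not at hp
        filter_upwards [Ioo_mem_nhdsGT (sub_pos.2 hp)] with δ hδ
        have : 1 ≤ (p.1 - t₀) / δ := by rw [one_le_div hδ.1]; exact hδ.2.le
        simp [hθ, hχ, Real.smoothTransition.one_of_one_le this]
  refine le_of_tendsto_of_tendsto hlim.abs (hβ.const_mul c) ?_
  filter_upwards [hle, Ioo_mem_nhdsGT (sub_pos.2 ht₀)] with δ hδ hδ'
  have hδ0 := hδ'.1
  set φ : ℝ × Rn n → ℝ := fun p => χ (p.1 + 2) * (θ δ p.1 * Φ p) with hφ
  have hφs : ContDiff ℝ ∞ φ := by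
    have h1 : ContDiff ℝ ∞ fun p : ℝ × Rn n => χ (p.1 + 2) :=
      hχs.comp (contDiff_fst.add contDiff_const)
    exact h1.mul (((hθs δ).comp contDiff_fst).mul hΦ.1)
  have hsub : tsupport φ ⊆ Icc (-2) (t₀ + δ) ×ˢ Metric.closedBall (0 : Rn n) R := by
    apply closure_minimal _ (isClosed_Icc.prod Metric.isClosed_closedBall)
    intro p hp
    simp only [hφ, Function.mem_support, mul_ne_zero_iff] at hp
    refine ⟨⟨?_, ?_⟩, ?_⟩
    · by_contra! h
      exact hp.1 (Real.smoothTransition.zero_of_nonpos (by linarith))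
    · by_contra! h
      apply hp.2.1
      have : 1 ≤ (p.1 - t₀) / δ := by rw [one_le_div hδ0]; linarith
      simp [hθ, hχ, Real.smoothTransition.one_of_one_le this]
    · by_contra h
      rw [mem_closedBall_zero_iff, not_le] at h
      exact hp.2.2 (hΦ.2 p h.le)
  have htest : IsTestFunction T φ := by
    refine ⟨hφs, ?_, ?_⟩
    · exact (isCompact_Icc.prod (isCompact_closedBall _ _)).of_isClosed_subset
        (isClosed_tsupport _) hsub
    · intro p hp
      exact ⟨lt_of_le_of_lt (hsub hp).1.2 (by linarith [hδ'.2]), mem_univ _⟩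
  have hweak := hM.weak φ htest (fun p hp => by simp [hφ, hΦ.2 p hp])
  have hae : transportDeriv b φ =ᵐ[M₁ + M₂] fun p => θ δ p.1 * transportDeriv b Φ p +
      -(deriv χ ((p.1 - t₀) / δ) * δ⁻¹) * Φ p := by
    filter_upwards [hM.supp] with p hp
    have he : φ =ᶠ[𝓝 p] fun p => θ δ p.1 * Φ p := by
      have : {q : ℝ × Rn n | -1 < q.1} ∈ 𝓝 p :=
        (isOpen_lt continuous_const continuous_fst).mem_nhds (by
          change -1 < p.1; linarith [hp.1])
      filter_upwards [this] with q hq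
      have hq' : -1 < q.1 := hq
      simp only [hφ]
      rw [hχ, Real.smoothTransition.one_of_one_le (by linarith), one_mul]
    have h1 : HasFDerivAt (fun p : ℝ × Rn n => θ δ p.1)
        ((-(deriv χ ((p.1 - t₀) / δ) * δ⁻¹)) • ContinuousLinearMap.fst ℝ ℝ (Rn n)) p :=
      (hθd δ p.1).comp_hasFDerivAt p hasFDerivAt_fst
    have h2 := (hΦ.1.differentiable (by simp) p).hasFDerivAt
    have h3 := h1.fun_mul h2
    simp only [transportDeriv]
    rw [he.fderiv_eq, h3.fderiv]
    simp
    ring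
  have hi1 : Integrable (fun p => θ δ p.1 * transportDeriv b Φ p) (M₁ + M₂) :=
    hD.bdd_mul ((hθs δ).continuous.comp continuous_fst).aestronglyMeasurable
      (ae_of_all _ fun p => hθ01 δ p.1)
  have hχc : Continuous fun p : ℝ × Rn n => -(deriv χ ((p.1 - t₀) / δ) * δ⁻¹) := by
    have : Continuous (deriv χ) := hχs.continuous_deriv (by simp)
    fun_prop
  have hχb : ∀ p : ℝ × Rn n, |-(deriv χ ((p.1 - t₀) / δ) * δ⁻¹)| ≤ c * δ⁻¹ := fun p => by
    rw [abs_neg, abs_mul, abs_of_pos (inv_pos.2 hδ0)]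
    exact mul_le_mul_of_nonneg_right (hcb _) (inv_pos.2 hδ0).le
  have hi2 : Integrable (fun p => -(deriv χ ((p.1 - t₀) / δ) * δ⁻¹) * Φ p) (M₁ + M₂) :=
    hΦi.bdd_mul hχc.aestronglyMeasurable (ae_of_all _ hχb)
  rw [integralDiff_congr hae, integralDiff_add hi1 hi2] at hweak
  rw [eq_neg_of_add_eq_zero_left hweak, abs_neg]
  have hms : MeasurableSet (Ioo t₀ (t₀ + δ) ×ˢ (univ : Set (Rn n))) :=
    measurableSet_Ioo.prod MeasurableSet.univ
  have h4 : |integralDiff M₁ M₂ fun p => -(deriv χ ((p.1 - t₀) / δ) * δ⁻¹) * Φ p| ≤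
      ∫ p, (Ioo t₀ (t₀ + δ) ×ˢ (univ : Set (Rn n))).indicator (fun p => c * δ⁻¹ * |Φ p|) p
        ∂(M₁ + M₂) := by
    apply abs_integralDiff_le_of_le hi2 ((hΦi.abs.const_mul _).indicator hms)
    refine ae_of_all _ fun p => ?_
    by_cases hp : p ∈ Ioo t₀ (t₀ + δ) ×ˢ (univ : Set (Rn n))
    · rw [indicator_of_mem hp, abs_mul]
      exact mul_le_mul_of_nonneg_right (hχb p) (abs_nonneg _)
    · rw [indicator_of_notMem hp, hχ, deriv_smoothTransition_eq_zero]
      · simp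
      · intro hmem
        apply hp
        refine ⟨⟨?_, ?_⟩, mem_univ _⟩
        · have := hmem.1
          rw [div_pos_iff] at this
          rcases this with h | h <;> linarith
        · have := hmem.2
          rw [div_lt_one hδ0] at this
          linarith
  rw [integral_indicator hms, integral_const_mul] at h4
  refine h4.trans ?_
  rw [mul_assoc]
  refine mul_le_mul_of_nonneg_left ?_ hc.le
  rw [inv_mul_le_iff₀ hδ0]
  exact hδ

theorem LocalWeakSolution.flux_eq (hM : LocalWeakSolution T R b M₁ M₂)
    (hb : Measurable (Function.uncurry b)) (hbd : ∀ t x, ‖b t x‖ ≤ K)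
    {Φ : ℝ × Rn n → ℝ} (hΦ : SpaceSupported R Φ) {t₀ : ℝ} (ht₀ : t₀ ∈ Ico 0 T) :
    flux b M₁ M₂ t₀ (fun x => Φ (t₀, x)) =
      integralDiff M₁ M₂ ({p | p.1 ≤ t₀}.indicator (transportDeriv b Φ)) := by
  obtain ⟨c, hc, hcut⟩ := exists_cutoff_estimate
  obtain ⟨m, -, hmi, hm, -⟩ := exists_timeDensity (M₁ + M₂) hM.ac
  have hfr : SpaceSupported R fun p : ℝ × Rn n => Φ (t₀, p.2) :=
    SpaceSupported.snd (hΦ.1.comp (contDiff_const.prodMk contDiff_id)) fun x hx => hΦ.2 _ hx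
  have hΨ : SpaceSupported R fun p : ℝ × Rn n => Φ p - Φ (t₀, p.2) :=
    ⟨hΦ.1.sub hfr.1, fun p hp => by
      have h1 := hfr.2 p hp
      simp only at h1 ⊢
      rw [hΦ.2 p hp, h1, sub_zero]⟩
  obtain ⟨L, hL, hL'⟩ := hΦ.exists_bound 0 T
  have hlip : ∀ t ∈ Icc 0 T, ∀ x, |Φ (t, x) - Φ (t₀, x)| ≤ L * |t - t₀| := by
    intro t ht x
    have h1 : ∀ s ∈ Icc 0 T, HasDerivWithinAt (fun s => Φ (s, x))
        (fderiv ℝ Φ (s, x) (1, 0)) (Icc 0 T) s := by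
      intro s _
      have h2 : HasDerivAt (fun s : ℝ => (s, x)) ((1 : ℝ), (0 : Rn n)) s :=
        (hasDerivAt_id s).prodMk (hasDerivAt_const s x)
      exact ((hΦ.1.differentiable (by simp) (s, x)).hasFDerivAt.comp_hasDerivAt s
        h2).hasDerivWithinAt
    have h3 := (convex_Icc 0 T).norm_image_sub_le_of_norm_hasDerivWithin_le (C := L) h1
      (fun s hs => by
        refine ((fderiv ℝ Φ (s, x)).le_opNorm _).trans ?_
        have h4 := (hL' (s, x) hs).2
        have h5 : ‖((1 : ℝ), (0 : Rn n))‖ = 1 := by simp [Prod.norm_def]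
        rw [h5, mul_one]
        exact h4) ⟨ht₀.1, ht₀.2.le⟩ ht
    simpa [Real.norm_eq_abs] using h3
  have hβ : Tendsto (fun δ => L * ∫ t in t₀..t₀ + δ, m t) (𝓝[>] 0) (𝓝 0) := by
    have h1 : Continuous fun x => ∫ t in t₀..x, m t :=
      intervalIntegral.continuous_primitive (fun a c => hmi.intervalIntegrable) t₀
    have h2 : Continuous fun δ => L * ∫ t in t₀..t₀ + δ, m t :=
      continuous_const.mul (h1.comp (continuous_const.add continuous_id))
    have := (h2.tendsto 0).mono_left (nhdsWithin_le_nhds (s := Ioi 0))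
    simpa using this
  have key := hcut hM hb hbd hΨ ht₀.2 hβ (by
    filter_upwards [self_mem_nhdsWithin, Ioo_mem_nhdsGT (sub_pos.2 ht₀.2)] with δ hδ hδ'
    have hms : MeasurableSet (Ioo t₀ (t₀ + δ) ×ˢ (univ : Set (Rn n))) :=
      measurableSet_Ioo.prod MeasurableSet.univ
    have hδ0 : 0 < δ := hδ
    calc ∫ p in Ioo t₀ (t₀ + δ) ×ˢ univ, |Φ p - Φ (t₀, p.2)| ∂(M₁ + M₂)
        ≤ ∫ p in Ioo t₀ (t₀ + δ) ×ˢ univ, L * δ ∂(M₁ + M₂) := by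
          apply integral_mono_of_nonneg (ae_of_all _ fun _ => abs_nonneg _)
            (integrable_const _)
          filter_upwards [self_mem_ae_restrict hms] with p hp
          have hp1 : p.1 ∈ Ioo t₀ (t₀ + δ) := hp.1
          refine (hlip p.1 ⟨ht₀.1.trans hp1.1.le, by linarith [hp1.2, hδ'.2]⟩ p.2).trans ?_
          rw [abs_of_pos (sub_pos.2 hp1.1)]
          exact mul_le_mul_of_nonneg_left (by linarith [hp1.2]) hL
      _ = (M₁ + M₂).real (Ioo t₀ (t₀ + δ) ×ˢ univ) * (L * δ) := by
          rw [setIntegral_const, smul_eq_mul]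
      _ ≤ (M₁ + M₂).real (Ioc t₀ (t₀ + δ) ×ˢ univ) * (L * δ) := by
          apply mul_le_mul_of_nonneg_right _ (by positivity)
          exact measureReal_mono (prod_mono Ioo_subset_Ioc_self le_rfl)
      _ = δ * (L * ∫ t in t₀..t₀ + δ, m t) := by
          rw [hm _ _ (by linarith)]; ring)
  rw [mul_zero] at key
  have h0 := abs_nonpos_iff.1 key
  have e : {p : ℝ × Rn n | p.1 ≤ t₀}.indicator
      (transportDeriv b fun p => Φ p - Φ (t₀, p.2)) = fun p =>
      {p : ℝ × Rn n | p.1 ≤ t₀}.indicator (transportDeriv b Φ) p -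
      {p : ℝ × Rn n | p.1 ≤ t₀}.indicator (transportDeriv b fun p => Φ (t₀, p.2)) p := by
    ext p
    by_cases hp : p ∈ {p : ℝ × Rn n | p.1 ≤ t₀}
    · simp only [indicator_of_mem hp, transportDeriv]
      rw [fderiv_fun_sub (hΦ.1.differentiable (by simp) p) (hfr.1.differentiable (by simp) p)]
      simp
    · simp only [indicator_of_notMem hp, sub_zero]
  rw [e, integralDiff_sub ((hM.integrable_transportDeriv hb hbd hΦ).indicator
    (measurableSet_fst_le _)) ((hM.integrable_transportDeriv hb hbd hfr).indicator
    (measurableSet_fst_le _)), sub_eq_zero] at h0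
  exact h0.symm

/-- Almost every time slice of the flux is controlled by the sup norm. -/
theorem exists_abs_flux_le : ∃ c : ℝ, 0 < c ∧ ∀ {n : ℕ} {T R K : ℝ} {b : ℝ → Rn n → Rn n}
    {M₁ M₂ : Measure (ℝ × Rn n)} [IsFiniteMeasure M₁] [IsFiniteMeasure M₂]
    (_ : LocalWeakSolution T R b M₁ M₂) (_ : Measurable (Function.uncurry b))
    (_ : ∀ t x, ‖b t x‖ ≤ K) {m : ℝ → ℝ}
    (_ : ∀ a c, a ≤ c → (M₁ + M₂).real (Ioc a c ×ˢ univ) = ∫ t in a..c, m t) {s : ℝ} (_ : s < T)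
    (_ : HasDerivAt (fun x => ∫ t in s..x, m t) (m s) s)
    {g : Rn n → ℝ} (_ : ContDiff ℝ ∞ g) (_ : ∀ x, R ≤ ‖x‖ → g x = 0) {N : ℝ}
    (_ : ∀ x, |g x| ≤ N), |flux b M₁ M₂ s g| ≤ c * (m s * N) := by
  obtain ⟨c, hc, hcut⟩ := exists_cutoff_estimate
  refine ⟨c, hc, ?_⟩
  intro n T R K b M₁ M₂ _ _ hM hb hbd m hm s hs hd g hg hg0 N hN
  have hN0 : 0 ≤ N := (abs_nonneg _).trans (hN 0)
  have hβ : Tendsto (fun δ => (δ⁻¹ * ∫ t in s..s + δ, m t) * N) (𝓝[>] 0) (𝓝 (m s * N)) := by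
    have := (hasDerivAt_iff_tendsto_slope_zero.1 hd).mono_left
      (nhdsWithin_mono 0 (show Ioi (0 : ℝ) ⊆ {0}ᶜ from fun x hx => (ne_of_gt hx)))
    simp only [intervalIntegral.integral_same, sub_zero, smul_eq_mul] at this
    exact this.mul_const N
  refine hcut hM hb hbd (SpaceSupported.snd hg hg0) hs hβ ?_
  filter_upwards [self_mem_nhdsWithin] with δ hδ
  have hδ0 : 0 < δ := hδ
  have hms : MeasurableSet (Ioo s (s + δ) ×ˢ (univ : Set (Rn n))) :=
    measurableSet_Ioo.prod MeasurableSet.univ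
  calc ∫ p in Ioo s (s + δ) ×ˢ univ, |g p.2| ∂(M₁ + M₂)
      ≤ ∫ p in Ioo s (s + δ) ×ˢ univ, N ∂(M₁ + M₂) :=
        integral_mono_of_nonneg (ae_of_all _ fun _ => abs_nonneg _) (integrable_const _)
          (ae_of_all _ fun p => hN p.2)
    _ = (M₁ + M₂).real (Ioo s (s + δ) ×ˢ univ) * N := by
        rw [setIntegral_const, smul_eq_mul]
    _ ≤ (M₁ + M₂).real (Ioc s (s + δ) ×ˢ univ) * N := by
        apply mul_le_mul_of_nonneg_right _ hN0
        exact measureReal_mono (prod_mono Ioo_subset_Ioc_self le_rfl)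
    _ = δ * (δ⁻¹ * (∫ t in s..s + δ, m t) * N) := by
        rw [hm _ _ (by linarith)]; field_simp

end weak

end

section

/-- A Gronwall inequality for functions whose increments have an absolutely continuous upper
bound. -/
theorem le_exp_mul_of_deriv_le {A F f : ℝ → ℝ} {a b C : ℝ} (hab : a ≤ b) (hC : 0 ≤ C)
    (hA : ∀ s ∈ Icc a b, 0 ≤ A s) (hF : IntervalIntegrable F volume a b) (hF0 : ∀ s, 0 ≤ F s)
    (hAF : ∀ s t, a ≤ s → s ≤ t → t ≤ b → A t - A s ≤ ∫ x in s..t, F x)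
    (hf : IntervalIntegrable f volume a b) (hf0 : ∀ s, 0 ≤ f s)
    (hd : ∀ᵐ s, s ∈ Ioo a b → DifferentiableAt ℝ A s → deriv A s ≤ C * A s + f s) :
    A b ≤ Real.exp (C * (b - a)) * (A a + ∫ x in a..b, f x) := by
  set D : ℝ → ℝ := fun t => Real.exp (-(C * (t - a))) * A t with hD
  set P : ℝ → ℝ := fun t => (∫ x in a..t, F x) - D t with hP
  have hsub : ∀ s t, a ≤ s → s ≤ t → t ≤ b → IntervalIntegrable F volume s t := by
    intro s t h1 h2 h3
    apply hF.mono_set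
    rw [uIcc_of_le h2, uIcc_of_le hab]
    exact Icc_subset_Icc h1 h3
  have hmono : MonotoneOn P (uIcc a b) := by
    rw [uIcc_of_le hab]
    intro s hs t ht hst
    have h1 : (∫ x in a..t, F x) - ∫ x in a..s, F x = ∫ x in s..t, F x :=
      intervalIntegral.integral_interval_sub_left (hsub a t le_rfl ht.1 ht.2)
        (hsub a s le_rfl hs.1 hs.2)
    have h2 := hAF s t hs.1 hst ht.2
    have h3 : 0 ≤ ∫ x in s..t, F x :=
      intervalIntegral.integral_nonneg hst fun x _ => hF0 x
    have h4 : Real.exp (-(C * (t - a))) ≤ Real.exp (-(C * (s - a))) :=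
      Real.exp_le_exp.2 (by nlinarith)
    have h5 : Real.exp (-(C * (t - a))) ≤ 1 :=
      Real.exp_le_one_iff.2 (by nlinarith [ht.1])
    have h6 := Real.exp_pos (-(C * (t - a)))
    have h7 : D t - D s ≤ ∫ x in s..t, F x := by
      simp only [hD]
      nlinarith [hA s hs, hA t ht]
    simp only [hP]; linarith
  have hPi := hmono.intervalIntegrable_deriv
  have hle := hmono.intervalIntegral_deriv_mem_uIcc
  have hPab : P a ≤ P b := hmono left_mem_uIcc right_mem_uIcc hab
  rw [uIcc_of_le (by linarith)] at hle
  have hae : ∀ᵐ s, s ∈ Ioo a b → F s - f s ≤ deriv P s := by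
    filter_upwards [hmono.ae_differentiableWithinAt_of_mem, hF.ae_hasDerivAt_integral, hd]
      with s h1 h2 h3 hs
    have hs' : s ∈ uIcc a b := by rw [uIcc_of_le hab]; exact ⟨hs.1.le, hs.2.le⟩
    have hPd : DifferentiableAt ℝ P s := (h1 hs').differentiableAt (by
      rw [uIcc_of_le hab]; exact Icc_mem_nhds hs.1 hs.2)
    have hN := h2 hs' a left_mem_uIcc
    have hDd : DifferentiableAt ℝ D s := by
      have : D = fun t => (∫ x in a..t, F x) - P t := by ext t; simp [hP]
      rw [this]
      exact hN.differentiableAt.sub hPd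
    have he : ∀ (κ : ℝ), HasDerivAt (fun t => Real.exp (κ * (t - a)))
        (Real.exp (κ * (s - a)) * κ) s := by
      intro κ
      have := (((hasDerivAt_id s).sub_const a).const_mul κ).exp
      simpa using this
    have hAd : DifferentiableAt ℝ A s := by
      have : A = fun t => Real.exp (C * (t - a)) * D t := by
        ext t
        simp only [hD]
        rw [← mul_assoc, ← Real.exp_add]; simp
      rw [this]
      exact (he C).differentiableAt.mul hDd
    have h4 := h3 hs hAd
    have h5 : HasDerivAt D (Real.exp (-(C * (s - a))) * -C * A s +
        Real.exp (-(C * (s - a))) * deriv A s) s := by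
      have := (he (-C)).mul hAd.hasDerivAt
      simp only [neg_mul] at this
      exact this.congr_deriv (by ring)
    have h6 : deriv P s = F s - (Real.exp (-(C * (s - a))) * -C * A s +
        Real.exp (-(C * (s - a))) * deriv A s) := (hN.sub h5).deriv
    rw [h6]
    have h7 : Real.exp (-(C * (s - a))) ≤ 1 :=
      Real.exp_le_one_iff.2 (by nlinarith [hs.1])
    have h8 := Real.exp_pos (-(C * (s - a)))
    have h9 := hf0 s
    nlinarith
  have h1 : ∫ x in a..b, (F x - f x) ≤ ∫ x in a..b, deriv P x := by
    rw [intervalIntegral.integral_of_le hab, intervalIntegral.integral_of_le hab,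
      integral_Ioc_eq_integral_Ioo, integral_Ioc_eq_integral_Ioo]
    apply setIntegral_mono_on_ae
    · exact (hF.sub hf).1.mono_set Ioo_subset_Ioc_self
    · exact hPi.1.mono_set Ioo_subset_Ioc_self
    · exact measurableSet_Ioo
    · exact hae
  rw [intervalIntegral.integral_sub hF hf] at h1
  have h2 : D b ≤ D a + ∫ x in a..b, f x := by
    have := h1.trans hle.2
    simp only [hP, intervalIntegral.integral_same] at this
    linarith
  simp only [hD, sub_self, mul_zero, neg_zero, Real.exp_zero, one_mul] at h2
  have h3 := mul_le_mul_of_nonneg_left h2 (Real.exp_pos (C * (b - a))).le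
  rwa [← mul_assoc, ← Real.exp_add, add_neg_cancel, Real.exp_zero, one_mul] at h3

section mollify

variable {G E : Type*} [NormedAddCommGroup G] [NormedSpace ℝ G] [HasContDiffBump G]
  [FiniteDimensional ℝ G] [MeasurableSpace G] [BorelSpace G] {μ : Measure G} [μ.IsAddHaarMeasure]
  [NormedAddCommGroup E] [NormedSpace ℝ E]

/-- Mollification of a function. -/
noncomputable def mollify (φ : ContDiffBump (0 : G)) (μ : Measure G) (g : G → E) : G → E :=
  φ.normed μ ⋆[ContinuousLinearMap.lsmul ℝ ℝ, μ] g

theorem contDiff_mollify (φ : ContDiffBump (0 : G)) {g : G → E} (hg : LocallyIntegrable g μ) :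
    ContDiff ℝ ∞ (mollify φ μ g) :=
  φ.hasCompactSupport_normed.contDiff_convolution_left _ φ.contDiff_normed hg

theorem mollify_integrable (φ : ContDiffBump (0 : G)) {g : G → E} (hg : LocallyIntegrable g μ)
    (x : G) : Integrable (fun z => φ.normed μ z • g (x - z)) μ := by
  have := φ.hasCompactSupport_normed.convolutionExists_left (ContinuousLinearMap.lsmul ℝ ℝ)
    (φ.contDiff_normed (n := 0) (μ := μ)).continuous hg x
  simpa [ConvolutionExistsAt] using this

theorem norm_mollify_sub_le (φ : ContDiffBump (0 : G)) {g : G → E} (hg : LocallyIntegrable g μ)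
    {x y : G} {k : ℝ} (h : ∀ z, ‖g (x - z) - g (y - z)‖ ≤ k) :
    ‖mollify φ μ g x - mollify φ μ g y‖ ≤ k := by
  have e : mollify φ μ g x - mollify φ μ g y =
      ∫ z, φ.normed μ z • (g (x - z) - g (y - z)) ∂μ := by
    simp only [smul_sub]
    rw [integral_sub (mollify_integrable φ hg x) (mollify_integrable φ hg y)]
    rfl
  rw [e]
  calc _ ≤ ∫ z, φ.normed μ z * k ∂μ := by
        apply norm_integral_le_of_norm_le (φ.integrable_normed.mul_const k)
        refine ae_of_all _ fun z => ?_
        rw [norm_smul, Real.norm_of_nonneg (φ.nonneg_normed z)]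
        exact mul_le_mul_of_nonneg_left (h z) (φ.nonneg_normed z)
    _ = k := by rw [integral_mul_const, φ.integral_normed, one_mul]

theorem norm_mollify_le (φ : ContDiffBump (0 : G)) {g : G → E} {k : ℝ} (h : ∀ z, ‖g z‖ ≤ k)
    (x : G) : ‖mollify φ μ g x‖ ≤ k := by
  have e : mollify φ μ g x = ∫ z, φ.normed μ z • g (x - z) ∂μ := rfl
  rw [e]
  calc _ ≤ ∫ z, φ.normed μ z * k ∂μ := by
        apply norm_integral_le_of_norm_le (φ.integrable_normed.mul_const k)
        refine ae_of_all _ fun z => ?_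
        rw [norm_smul, Real.norm_of_nonneg (φ.nonneg_normed z)]
        exact mul_le_mul_of_nonneg_left (h _) (φ.nonneg_normed z)
    _ = k := by rw [integral_mul_const, φ.integral_normed, one_mul]

end mollify

variable {n : ℕ}

/-- A function which has modulus of continuity `k` up to an error `a` is close to a smooth function
with modulus `k`. -/
theorem exists_smooth_modulus {k : ℝ → ℝ} (k0 : k 0 = 0) (kmono : MonotoneOn k (Ici 0))
    (ksub : ∀ r s, 0 ≤ r → 0 ≤ s → k (r + s) ≤ k r + k s) {Λ : ℝ} (hΛ : 0 ≤ Λ)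
    (klip : ∀ r, 0 ≤ r → k r ≤ Λ * r) {v : Rn n → ℝ} {a r₁ : ℝ} (ha : 0 ≤ a)
    (hv : ∀ x y, |v x - v y| ≤ k ‖x - y‖ + a) (hv0 : ∀ x, r₁ ≤ ‖x‖ → v x = 0) {κ : ℝ}
    (hκ : 0 < κ) :
    ∃ u : Rn n → ℝ, ContDiff ℝ ∞ u ∧ (∀ x y, |u x - u y| ≤ k ‖x - y‖) ∧
      (∀ x, |u x - v x| ≤ 2 * a + κ) ∧ ∀ x, r₁ + κ ≤ ‖x‖ → u x = 0 := by
  set u₁ : Rn n → ℝ := fun x => ⨅ y, (v y + k ‖x - y‖) with hu₁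
  have hlow : ∀ x y, v x - a ≤ v y + k ‖x - y‖ := fun x y => by
    have := (abs_le.1 (hv x y)).2; linarith
  have hbdd : ∀ x, BddBelow (range fun y => v y + k ‖x - y‖) := fun x =>
    ⟨v x - a, by rintro _ ⟨y, rfl⟩; exact hlow x y⟩
  have h1l : ∀ x, v x - a ≤ u₁ x := fun x => le_ciInf (hlow x)
  have h1u : ∀ x, u₁ x ≤ v x := fun x => by
    have := ciInf_le (hbdd x) x
    simpa [k0] using this
  have h1m' : ∀ x y, u₁ x ≤ u₁ y + k ‖x - y‖ := by
    intro x y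
    rw [← sub_le_iff_le_add]
    refine le_ciInf fun z => ?_
    have h1 : u₁ x ≤ v z + k ‖x - z‖ := ciInf_le (hbdd x) z
    have h2 : k ‖x - z‖ ≤ k ‖x - y‖ + k ‖y - z‖ := by
      refine (kmono (norm_nonneg _)
        (add_nonneg (norm_nonneg (x - y)) (norm_nonneg (y - z))) ?_).trans
        (ksub _ _ (norm_nonneg _) (norm_nonneg _))
      have := norm_add_le (x - y) (y - z)
      simpa using this
    linarith
  have h1m : ∀ x y, |u₁ x - u₁ y| ≤ k ‖x - y‖ := by
    intro x y
    have h2 := h1m' x y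
    have h3 := h1m' y x
    rw [norm_sub_rev] at h3
    rw [abs_le]; constructor <;> linarith
  set u₂ : Rn n → ℝ := fun x => max (u₁ x) 0 + min (u₁ x + a) 0 with hu₂
  have h2m : ∀ x y, |u₂ x - u₂ y| ≤ k ‖x - y‖ := by
    intro x y
    have h := h1m x y
    rw [abs_le] at h ⊢
    simp only [hu₂]
    constructor
    all_goals
      rcases max_cases (u₁ x) 0 with h1 | h1 <;>
      rcases max_cases (u₁ y) 0 with h2 | h2 <;>
      rcases min_cases (u₁ x + a) 0 with h3 | h3 <;>
      rcases min_cases (u₁ y + a) 0 with h4 | h4 <;>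
      linarith
  have h2v : ∀ x, |u₂ x - v x| ≤ 2 * a := by
    intro x
    have h1 := h1l x
    have h2 := h1u x
    rw [abs_le]
    simp only [hu₂]
    constructor
    all_goals
      rcases max_cases (u₁ x) 0 with h1 | h1 <;>
      rcases min_cases (u₁ x + a) 0 with h3 | h3 <;>
      linarith
  have h20 : ∀ x, r₁ ≤ ‖x‖ → u₂ x = 0 := by
    intro x hx
    have h1 := h1l x
    have h2 := h1u x
    rw [hv0 x hx] at h1 h2
    simp only [hu₂]
    rw [max_eq_right h2, min_eq_right (by linarith), add_zero]
  have h2c : Continuous u₂ := by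
    rw [continuous_iff_continuousAt]
    intro x
    rw [ContinuousAt, tendsto_iff_norm_sub_tendsto_zero]
    have h1 : Tendsto (fun y => Λ * ‖y - x‖) (𝓝 x) (𝓝 0) := by
      have : Continuous fun y => Λ * ‖y - x‖ := by fun_prop
      simpa using this.tendsto x
    exact squeeze_zero (fun _ => norm_nonneg _)
      (fun y => (h2m y x).trans (klip _ (norm_nonneg _))) h1
  set ρ : ℝ := κ / (Λ + 1) with hρ
  have hρ0 : 0 < ρ := by positivity
  have hρκ : ρ ≤ κ := div_le_self hκ.le (by linarith)
  have hρΛ : Λ * ρ ≤ κ := by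
    rw [hρ, mul_div_assoc', div_le_iff₀ (by positivity)]; nlinarith
  let φ : ContDiffBump (0 : Rn n) := ⟨ρ / 2, ρ, by positivity, by linarith⟩
  have hloc : LocallyIntegrable u₂ (volume : Measure (Rn n)) := h2c.locallyIntegrable
  refine ⟨mollify φ volume u₂, contDiff_mollify φ hloc, fun x y => ?_, fun x => ?_, fun x hx => ?_⟩
  · refine norm_mollify_sub_le φ hloc fun z => ?_
    have := h2m (x - z) (y - z)
    simpa using this
  · have h3 : |mollify φ volume u₂ x - u₂ x| ≤ κ := by
      have := φ.dist_normed_convolution_le (μ := volume) (x₀ := x) (ε := κ)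
        h2c.aestronglyMeasurable (fun y hy => by
          rw [Real.dist_eq]
          refine (h2m y x).trans ((klip _ (norm_nonneg _)).trans ?_)
          have hy' : ‖y - x‖ < ρ := by simpa [dist_eq_norm] using hy
          exact (mul_le_mul_of_nonneg_left hy'.le hΛ).trans hρΛ)
      rwa [Real.dist_eq] at this
    have := abs_add_le (mollify φ volume u₂ x - u₂ x) (u₂ x - v x)
    have h4 := h2v x
    rw [sub_add_sub_cancel] at this
    linarith
  · have hball : ∀ y ∈ Metric.ball x φ.rOut, u₂ y = 0 := by
      intro y hy
      apply h20
      have hy' : ‖y - x‖ < ρ := by simpa [dist_eq_norm] using hy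
      have := norm_sub_norm_le x y
      rw [norm_sub_rev] at this
      linarith
    have hx0 : u₂ x = 0 := hball x (Metric.mem_ball_self φ.rOut_pos)
    have := φ.normed_convolution_eq_right (μ := volume) (g := u₂) (x₀ := x)
      fun y hy => by rw [hball y hy, hx0]
    rw [mollify, this, hx0]

end

section

variable {n : ℕ}

/-- Approximation of an Osgood field by smooth fields with the same modulus. -/
theorem OsgoodField.exists_smooth_approx {b : ℝ → Rn n → Rn n} {K C : ℝ} {w : ℝ → ℝ}
    (hw : OsgoodModulus w) (hb : OsgoodField b K C w) {T R : ℝ}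
    (hsupp : ∀ t x, t ∉ Ioo 0 T ∨ R ≤ ‖x‖ → b t x = 0) (M : Measure (ℝ × Rn n))
    [IsFiniteMeasure M] (hM : M.map Prod.fst ≪ volume) {δ : ℝ} (hδ : 0 < δ) :
    ∃ B : ℝ × Rn n → Rn n, ContDiff ℝ ∞ B ∧ HasCompactSupport B ∧ (∀ p, ‖B p‖ ≤ K) ∧
      (∀ t x y, ‖B (t, x) - B (t, y)‖ ≤ C * w ‖x - y‖) ∧
      ∫ p, ‖b p.1 p.2 - B p‖ ∂M < δ := by
  have hHaar : (volume : Measure (ℝ × Rn n)).IsAddHaarMeasure := by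
    rw [Measure.volume_eq_prod]; infer_instance
  set g : ℝ × Rn n → Rn n := Function.uncurry b with hg
  let φ : ℕ → ContDiffBump (0 : ℝ × Rn n) := fun k =>
    ⟨1 / ((k : ℝ) + 1), 2 * (1 / ((k : ℝ) + 1)), by positivity, by
      have : (0 : ℝ) < 1 / ((k : ℝ) + 1) := by positivity
      linarith⟩
  have hgc : HasCompactSupport g := by
    have hcomp : IsCompact (Icc 0 T ×ˢ Metric.closedBall (0 : Rn n) R) :=
      isCompact_Icc.prod (isCompact_closedBall _ _)
    apply HasCompactSupport.intro hcomp
    intro p hp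
    apply hsupp p.1 p.2
    by_contra! hcon
    apply hp
    refine ⟨⟨hcon.1.1.le, hcon.1.2.le⟩, by simpa using hcon.2.le⟩
  have hloc : LocallyIntegrable g (volume : Measure (ℝ × Rn n)) := by
    rw [locallyIntegrable_iff]
    intro k hk
    exact Measure.integrableOn_of_bounded (M := K) hk.measure_lt_top.ne
      hb.meas.aestronglyMeasurable (ae_of_all _ fun p => hb.bound p.1 p.2)
  set B : ℕ → ℝ × Rn n → Rn n := fun k => mollify (φ k) volume g with hB
  have hBs : ∀ k, ContDiff ℝ ∞ (B k) := fun k => contDiff_mollify _ hloc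
  have hBb : ∀ k p, ‖B k p‖ ≤ K := fun k p =>
    norm_mollify_le (μ := volume) (g := g) (k := K) (φ k) (fun q => hb.bound q.1 q.2) p
  have hBm : ∀ k t x y, ‖B k (t, x) - B k (t, y)‖ ≤ C * w ‖x - y‖ := by
    intro k t x y
    refine norm_mollify_sub_le (μ := volume) (φ k) hloc (x := (t, x)) (y := (t, y))
      (k := C * w ‖x - y‖) fun z => ?_
    have := hb.mod (t - z.1) (x - z.2) (y - z.2)
    simp only [sub_sub_sub_cancel_right] at this
    exact this
  have hd := tendsto_one_div_add_atTop_nhds_zero_nat (𝕜 := ℝ)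
  have hlim : ∀ᵐ p : ℝ × Rn n, Tendsto (fun k => B k p) atTop (𝓝 (g p)) := by
    apply ContDiffBump.ae_convolution_tendsto_right_of_locallyIntegrable (K := 2) _ _ hloc
    · have := hd.const_mul 2
      rwa [mul_zero] at this
    · exact Eventually.of_forall fun k => le_rfl
  have hlim2 : ∀ᵐ t : ℝ, ∀ x, Tendsto (fun k => B k (t, x)) atTop (𝓝 (b t x)) := by
    have h1 := Measure.ae_ae_of_ae_prod hlim
    filter_upwards [h1] with t ht x
    have hdense : Dense {x | Tendsto (fun k => B k (t, x)) atTop (𝓝 (g (t, x)))} :=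
      Measure.dense_of_ae ht
    rw [Metric.tendsto_atTop]
    intro ε hε
    have hcw : Continuous fun y : Rn n => C * w ‖y - x‖ :=
      continuous_const.mul (hw.cont.comp (continuous_id.sub continuous_const).norm)
    have hnear : {y : Rn n | C * w ‖y - x‖ < ε / 3} ∈ 𝓝 x := by
      apply hcw.continuousAt.eventually (gt_mem_nhds _)
      simp [hw.apply_zero]; positivity
    obtain ⟨y, hy1, hy2⟩ := hdense.inter_nhds_nonempty hnear
    obtain ⟨N, hN⟩ := Metric.tendsto_atTop.1 hy1 (ε / 3) (by positivity)
    refine ⟨N, fun k hk => ?_⟩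
    have h2 := hN k hk
    have h3 := hBm k t y x
    have h4 := hb.mod t y x
    have hy2' : C * w ‖y - x‖ < ε / 3 := hy2
    rw [dist_eq_norm] at h2 ⊢
    have e : B k (t, x) - b t x = (B k (t, y) - g (t, y)) + (b t y - b t x) -
        (B k (t, y) - B k (t, x)) := by
      simp only [hg, Function.uncurry]; abel
    rw [e]
    refine (norm_sub_le _ _).trans_lt ?_
    have := norm_add_le (B k (t, y) - g (t, y)) (b t y - b t x)
    linarith
  have hlim3 : ∀ᵐ p ∂M, Tendsto (fun k => B k p) atTop (𝓝 (b p.1 p.2)) := by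
    have := ae_of_ae_map measurable_fst.aemeasurable (hM.ae_le hlim2)
    filter_upwards [this] with p hp
    exact hp p.2
  have hlim4 : Tendsto (fun k => ∫ p, ‖b p.1 p.2 - B k p‖ ∂M) atTop (𝓝 (∫ _, (0 : ℝ) ∂M)) := by
    apply tendsto_integral_of_dominated_convergence (fun _ => K + K)
    · exact fun k => ((hb.meas.sub (hBs k).continuous.measurable).norm).aestronglyMeasurable
    · exact integrable_const _
    · refine fun k => ae_of_all _ fun p => ?_
      rw [norm_norm]
      exact (norm_sub_le _ _).trans (add_le_add (hb.bound _ _) (hBb k p))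
    · filter_upwards [hlim3] with p hp
      have := (tendsto_const_nhds (x := b p.1 p.2)).sub hp
      simpa using this.norm
  rw [integral_zero] at hlim4
  obtain ⟨k, hk⟩ := (hlim4.eventually (gt_mem_nhds hδ)).exists
  exact ⟨B k, hBs k, (φ k).hasCompactSupport_normed.convolution _ hgc, hBb k, hBm k, hk⟩

end

section

namespace OsgoodGauge

variable {w ψ : ℝ → ℝ}

theorem shift_monotoneOn (hψ : OsgoodGauge w ψ) (hw : OsgoodModulus w) {ε : ℝ} (hε : 0 < ε) :
    MonotoneOn (fun r => ψ (r + ε) - ψ ε) (Ici 0) := by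
  intro r hr s hs hrs
  have hr' : 0 ≤ r := hr
  have hs' : 0 ≤ s := hs
  have := hψ.monotoneOn hw (show 0 < r + ε by positivity) (show 0 < s + ε by positivity)
    (by linarith)
  simp only; linarith

theorem shift_add_le (hψ : OsgoodGauge w ψ) {ε : ℝ} (hε : 0 < ε) {r s : ℝ} (hr : 0 ≤ r)
    (hs : 0 ≤ s) : ψ (r + s + ε) - ψ ε ≤ (ψ (r + ε) - ψ ε) + (ψ (s + ε) - ψ ε) := by
  have := hψ.increment_le hε hr hs
  linarith

theorem shift_le_mul (hψ : OsgoodGauge w ψ) {ε : ℝ} (hε : 0 < ε) {r : ℝ} (hr : 0 ≤ r) :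
    ψ (r + ε) - ψ ε ≤ ψ ε / w ε * r := by
  have := hψ.le_tangent hε hr
  rw [add_comm] at this
  linarith

theorem shift_step (hψ : OsgoodGauge w ψ) (hw : OsgoodModulus w) {ε C h : ℝ} (hε : 0 < ε)
    (hC : 0 ≤ C) (hh : 0 ≤ h) {r : ℝ} (hr : 0 ≤ r) :
    ψ (r + h * (C * w r) + ε) - ψ ε ≤
      (1 + h * C) * (ψ (r + ε) - ψ ε) + h * C * ψ ε := by
  have hwr : 0 ≤ w r := hr.trans (hw.le r hr)
  have hre : 0 < r + ε := by linarith
  have h1 := hψ.le_tangent hre (show 0 ≤ h * (C * w r) by positivity)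
  have h2 : ψ (r + ε) / w (r + ε) * (h * (C * w r)) ≤ h * C * ψ (r + ε) := by
    have h3 := hw.pos hre
    have h4 : w r ≤ w (r + ε) := hw.mono (by linarith)
    have h5 := hψ.pos _ hre
    rw [div_mul_eq_mul_div, div_le_iff₀ h3]
    have : 0 ≤ h * C * ψ (r + ε) := by positivity
    nlinarith
  have e : r + h * (C * w r) + ε = r + ε + h * (C * w r) := by ring
  rw [e]; nlinarith

theorem min_mul_le_shift (hψ : OsgoodGauge w ψ) (hw : OsgoodModulus w) {ε : ℝ} (hε : 0 < ε)
    {r : ℝ} (hr : 0 ≤ r) : min r 1 * (ψ 1 - ψ ε) ≤ ψ (r + ε) - ψ ε := by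
  have h1 : ψ 1 ≤ ψ (1 + ε) := hψ.monotoneOn hw (show (0 : ℝ) < 1 by norm_num)
    (show 0 < 1 + ε by positivity) (by linarith)
  rcases le_total r 1 with hr1 | hr1
  · rw [min_eq_left hr1]
    have h2 := hψ.concaveOn.2 (show (1 + ε) ∈ Ioi 0 by simp; positivity) (show ε ∈ Ioi 0 from hε)
      hr (sub_nonneg.2 hr1) (by ring)
    simp only [smul_eq_mul] at h2
    have e : r * (1 + ε) + (1 - r) * ε = r + ε := by ring
    rw [e] at h2
    nlinarith
  · rw [min_eq_right hr1, one_mul]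
    have := hψ.shift_monotoneOn hw hε (show (0 : ℝ) ≤ 1 by norm_num) hr hr1
    simp only at this
    linarith

end OsgoodGauge

variable {n : ℕ} {T R K : ℝ} {b : ℝ → Rn n → Rn n} {M₁ M₂ : Measure (ℝ × Rn n)}

theorem transportDeriv_snd {g : Rn n → ℝ} (hg : ContDiff ℝ ∞ g) (p : ℝ × Rn n) :
    transportDeriv b (fun p => g p.2) p = fderiv ℝ g p.2 (b p.1 p.2) := by
  have h1 : HasFDerivAt (fun p : ℝ × Rn n => g p.2)
      ((fderiv ℝ g p.2).comp (ContinuousLinearMap.snd ℝ ℝ (Rn n))) p :=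
    (hg.differentiable (by simp) p.2).hasFDerivAt.comp p hasFDerivAt_snd
  simp [transportDeriv, h1.fderiv]

theorem norm_fderiv_le_of_modulus {u : Rn n → ℝ} {Λ : ℝ} (hΛ : 0 ≤ Λ)
    (h : ∀ x y, |u x - u y| ≤ Λ * ‖x - y‖) (x : Rn n) : ‖fderiv ℝ u x‖ ≤ Λ := by
  have : LipschitzWith ⟨Λ, hΛ⟩ u := LipschitzWith.of_dist_le_mul fun x y => by
    rw [Real.dist_eq, dist_eq_norm]; exact h x y
  exact norm_fderiv_le_of_lipschitz ℝ this

theorem flux_const_mul (c : ℝ) {g : Rn n → ℝ} (hg : ContDiff ℝ ∞ g) (s : ℝ) :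
    flux b M₁ M₂ s (fun x => c * g x) = c * flux b M₁ M₂ s g := by
  simp only [flux]
  rw [← integralDiff_const_mul]
  congr 1
  ext p
  by_cases hp : p ∈ {p : ℝ × Rn n | p.1 ≤ s}
  · simp only [indicator_of_mem hp]
    rw [transportDeriv_snd hg, transportDeriv_snd (contDiff_const.mul hg),
      fderiv_const_mul (hg.differentiable (by simp) _)]
    simp
  · simp only [indicator_of_notMem hp, mul_zero]

theorem indicator_sub_indicator_le {D : ℝ × Rn n → ℝ} {s t : ℝ} (hst : s ≤ t) :
    (fun p => {p : ℝ × Rn n | p.1 ≤ t}.indicator D p - {p : ℝ × Rn n | p.1 ≤ s}.indicator D p) =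
      (Ioc s t ×ˢ (univ : Set (Rn n))).indicator D := by
  ext p
  by_cases h1 : p.1 ≤ s
  · have h2 : p.1 ≤ t := h1.trans hst
    rw [indicator_of_mem (show p ∈ {p : ℝ × Rn n | p.1 ≤ t} from h2),
      indicator_of_mem (show p ∈ {p : ℝ × Rn n | p.1 ≤ s} from h1), indicator_of_notMem, sub_self]
    exact fun h => absurd h.1.1 (not_lt.2 h1)
  · rw [indicator_of_notMem (show p ∉ {p : ℝ × Rn n | p.1 ≤ s} from h1), sub_zero]
    by_cases h2 : p.1 ≤ t
    · rw [indicator_of_mem (show p ∈ {p : ℝ × Rn n | p.1 ≤ t} from h2), indicator_of_mem]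
      exact ⟨⟨not_le.1 h1, h2⟩, mem_univ _⟩
    · rw [indicator_of_notMem (show p ∉ {p : ℝ × Rn n | p.1 ≤ t} from h2), indicator_of_notMem]
      exact fun h => h2 h.1.2

section flux

variable [IsFiniteMeasure M₁] [IsFiniteMeasure M₂]

theorem LocalWeakSolution.flux_sub (hM : LocalWeakSolution T R b M₁ M₂)
    (hb : Measurable (Function.uncurry b)) (hbd : ∀ t x, ‖b t x‖ ≤ K) {R' : ℝ} {f g : Rn n → ℝ}
    (hf : ContDiff ℝ ∞ f) (hf0 : ∀ x, R' ≤ ‖x‖ → f x = 0) (hg : ContDiff ℝ ∞ g)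
    (hg0 : ∀ x, R' ≤ ‖x‖ → g x = 0) (s : ℝ) :
    flux b M₁ M₂ s (fun x => f x - g x) = flux b M₁ M₂ s f - flux b M₁ M₂ s g := by
  simp only [flux]
  rw [← integralDiff_sub
    ((hM.integrable_transportDeriv hb hbd (SpaceSupported.snd hf hf0)).indicator
      (measurableSet_fst_le s))
    ((hM.integrable_transportDeriv hb hbd (SpaceSupported.snd hg hg0)).indicator
      (measurableSet_fst_le s))]
  congr 1
  ext p
  by_cases hp : p ∈ {p : ℝ × Rn n | p.1 ≤ s}
  · simp only [indicator_of_mem hp]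
    rw [transportDeriv_snd hf, transportDeriv_snd hg, transportDeriv_snd (hf.sub hg),
      fderiv_fun_sub (hf.differentiable (by simp) _) (hg.differentiable (by simp) _)]
    simp
  · simp only [indicator_of_notMem hp, sub_zero]

theorem LocalWeakSolution.abs_integralDiff_Ioc_le (hM : LocalWeakSolution T R b M₁ M₂)
    (hb : Measurable (Function.uncurry b)) (hbd : ∀ t x, ‖b t x‖ ≤ K) {R' : ℝ}
    {Φ : ℝ × Rn n → ℝ} (hΦ : SpaceSupported R' Φ) {s t : ℝ} (hst : s ≤ t) {q : ℝ × Rn n → ℝ}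
    (hq : Integrable q (M₁ + M₂))
    (hle : ∀ p : ℝ × Rn n, p.1 ∈ Ioc s t → |transportDeriv b Φ p| ≤ q p) :
    |integralDiff M₁ M₂ ({p | p.1 ≤ t}.indicator (transportDeriv b Φ)) -
      integralDiff M₁ M₂ ({p | p.1 ≤ s}.indicator (transportDeriv b Φ))| ≤
      ∫ p in Ioc s t ×ˢ univ, q p ∂(M₁ + M₂) := by
  have hD := hM.integrable_transportDeriv hb hbd hΦ
  have hms : MeasurableSet (Ioc s t ×ˢ (univ : Set (Rn n))) :=
    measurableSet_Ioc.prod MeasurableSet.univ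
  rw [← integralDiff_sub (hD.indicator (measurableSet_fst_le t))
    (hD.indicator (measurableSet_fst_le s)), indicator_sub_indicator_le hst,
    ← integral_indicator hms]
  apply abs_integralDiff_le_of_le (hD.indicator hms) (hq.indicator hms)
  refine ae_of_all _ fun p => ?_
  by_cases hp : p ∈ Ioc s t ×ˢ (univ : Set (Rn n))
  · rw [indicator_of_mem hp, indicator_of_mem hp]
    exact hle p hp.1
  · rw [indicator_of_notMem hp, indicator_of_notMem hp, abs_zero]

theorem LocalWeakSolution.abs_flux_sub_le (hM : LocalWeakSolution T R b M₁ M₂)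
    (hb : Measurable (Function.uncurry b)) (hbd : ∀ t x, ‖b t x‖ ≤ K) {R' : ℝ} {g : Rn n → ℝ}
    (hg : ContDiff ℝ ∞ g) (hg0 : ∀ x, R' ≤ ‖x‖ → g x = 0) {Λ : ℝ}
    (hΛ : ∀ x, ‖fderiv ℝ g x‖ ≤ Λ) {s t : ℝ} (hst : s ≤ t) :
    |flux b M₁ M₂ t g - flux b M₁ M₂ s g| ≤
      Λ * K * (M₁ + M₂).real (Ioc s t ×ˢ univ) := by
  refine (hM.abs_integralDiff_Ioc_le hb hbd (SpaceSupported.snd hg hg0) hst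
    (integrable_const (Λ * K)) ?_).trans ?_
  · intro p _
    rw [transportDeriv_snd hg]
    exact ((fderiv ℝ g p.2).le_opNorm _).trans (mul_le_mul (hΛ _) (hbd _ _) (norm_nonneg _)
      ((norm_nonneg _).trans (hΛ p.2)))
  · rw [setIntegral_const, smul_eq_mul, mul_comm]

/-- One backward step along the frozen field `B (s, ·)`. -/
theorem LocalWeakSolution.flux_step {R₀ : ℝ} (hR₀ : 0 ≤ R₀)
    (hM : LocalWeakSolution T (R₀ + 3) b M₁ M₂)
    (hb : Measurable (Function.uncurry b)) (hbd : ∀ t x, ‖b t x‖ ≤ K) {B : ℝ × Rn n → Rn n}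
    (hB : ContDiff ℝ ∞ B) (hBK : ∀ p, ‖B p‖ ≤ K) {L : ℝ} (hL : ∀ p, ‖fderiv ℝ B p‖ ≤ L)
    {s t : ℝ} (hs : 0 ≤ s) (hst : s < t) (ht : t < T) (hK : 2 * (t - s) * K ≤ 1)
    {u : Rn n → ℝ} (hu : ContDiff ℝ ∞ u) {r : ℝ} (hr : r ≤ R₀ + 1)
    (hu0 : ∀ x, r ≤ ‖x‖ → u x = 0) {Λ : ℝ} (hΛ : ∀ x, ‖fderiv ℝ u x‖ ≤ Λ) :
    |flux b M₁ M₂ t u - flux b M₁ M₂ s (fun x => u (x + (t - s) • B (s, x)))| ≤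
      Λ * ((∫ p in Ioc s t ×ˢ univ, ‖b p.1 p.2 - B p‖ ∂(M₁ + M₂)) +
        (t - s) * (L * (1 + K)) * (M₁ + M₂).real (Ioc s t ×ˢ univ)) := by
  have hK0 : 0 ≤ K := (norm_nonneg _).trans (hBK 0)
  have hL0 : 0 ≤ L := (norm_nonneg _).trans (hL 0)
  have hΛ0 : 0 ≤ Λ := (norm_nonneg _).trans (hΛ 0)
  have hh : 0 < t - s := sub_pos.2 hst
  let κ : ContDiffBump (0 : Rn n) := ⟨R₀ + 2, R₀ + 3, by linarith, by linarith⟩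
  set Y : ℝ × Rn n → Rn n := fun p => p.2 + (t - p.1) • B (s, p.2) with hY
  have hYs : ContDiff ℝ ∞ Y := by
    have h1 : ContDiff ℝ ∞ fun p : ℝ × Rn n => B (s, p.2) :=
      hB.comp (contDiff_const.prodMk contDiff_snd)
    exact contDiff_snd.add ((contDiff_const.sub contDiff_fst).smul h1)
  set Φ : ℝ × Rn n → ℝ := fun p => κ p.2 * u (Y p) with hΦ
  have hκ1 : ∀ x : Rn n, ‖x‖ ≤ R₀ + 2 → κ x = 1 := fun x hx =>
    κ.one_of_mem_closedBall (by simpa [κ] using hx)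
  have hκ0 : ∀ x : Rn n, R₀ + 3 ≤ ‖x‖ → κ x = 0 := fun x hx =>
    κ.zero_of_le_dist (by simpa [κ] using hx)
  have hΦS : SpaceSupported (R₀ + 3) Φ :=
    ⟨(κ.contDiff.comp contDiff_snd).mul (hu.comp hYs), fun p hp => by simp [hΦ, hκ0 p.2 hp]⟩
  have hΦeq : ∀ p : ℝ × Rn n, |t - p.1| ≤ 2 * (t - s) → Φ p = u (Y p) := by
    intro p hp
    by_cases hx : ‖p.2‖ ≤ R₀ + 2
    · simp [hΦ, hκ1 _ hx]
    · have : u (Y p) = 0 := by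
        apply hu0
        have h1 : ‖p.2‖ - ‖(t - p.1) • B (s, p.2)‖ ≤ ‖Y p‖ := by
          have := norm_sub_norm_le p.2 (-((t - p.1) • B (s, p.2)))
          rw [norm_neg, sub_neg_eq_add] at this
          exact this
        have h2 : ‖(t - p.1) • B (s, p.2)‖ ≤ 2 * (t - s) * K := by
          rw [norm_smul]
          exact mul_le_mul hp (hBK _) (norm_nonneg _) (by positivity)
        push Not at hx
        linarith
      simp [hΦ, this]
  have e1 := hM.flux_eq hb hbd hΦS (t₀ := t) ⟨hs.trans hst.le, ht⟩
  have e2 := hM.flux_eq hb hbd hΦS (t₀ := s) ⟨hs, hst.trans ht⟩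
  have f1 : (fun x => Φ (t, x)) = u := by
    ext x
    rw [hΦeq _ (by simp; linarith)]
    simp [hY]
  have f2 : (fun x => Φ (s, x)) = fun x => u (x + (t - s) • B (s, x)) := by
    ext x
    rw [hΦeq _ (by simp only; rw [abs_of_pos hh]; linarith)]
  rw [f1] at e1
  rw [f2] at e2
  rw [e1, e2]
  have hbB : Integrable (fun p : ℝ × Rn n => ‖b p.1 p.2 - B p‖) (M₁ + M₂) := by
    refine Integrable.of_bound
      (hb.sub hB.continuous.measurable).norm.aestronglyMeasurable (K + K) (ae_of_all _ fun p => ?_)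
    rw [norm_norm]
    exact (norm_sub_le _ _).trans (add_le_add (hbd _ _) (hBK _))
  have hle := hM.abs_integralDiff_Ioc_le hb hbd hΦS hst.le
    (q := fun p => Λ * (‖b p.1 p.2 - B p‖ + (t - s) * (L * (1 + K))))
    ((hbB.add (integrable_const _)).const_mul _) (by
      intro p hp
      have hev : Φ =ᶠ[𝓝 p] fun p => u (Y p) := by
        have : {q : ℝ × Rn n | |t - q.1| < 2 * (t - s)} ∈ 𝓝 p := by
          apply (isOpen_lt (by fun_prop) continuous_const).mem_nhds
          change |t - p.1| < 2 * (t - s)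
          rw [abs_of_nonneg (by linarith [hp.2])]
          linarith [hp.1]
        filter_upwards [this] with q hq
        exact hΦeq q (le_of_lt hq)
      have hY' : HasFDerivAt Y (ContinuousLinearMap.snd ℝ ℝ (Rn n) +
          ((t - p.1) • ((fderiv ℝ B (s, p.2)).comp
            ((ContinuousLinearMap.inr ℝ ℝ (Rn n)).comp (ContinuousLinearMap.snd ℝ ℝ (Rn n)))) +
          (-(ContinuousLinearMap.fst ℝ ℝ (Rn n))).smulRight (B (s, p.2)))) p := by
        have h1 : HasFDerivAt (fun q : ℝ × Rn n => (s, q.2))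
            ((ContinuousLinearMap.inr ℝ ℝ (Rn n)).comp (ContinuousLinearMap.snd ℝ ℝ (Rn n))) p :=
          (hasFDerivAt_prodMk_right s p.2).comp p hasFDerivAt_snd
        have h2 : HasFDerivAt (fun q : ℝ × Rn n => B (s, q.2)) _ p :=
          ((hB.differentiable (by simp) (s, p.2)).hasFDerivAt).comp p h1
        have h3 : HasFDerivAt (fun q : ℝ × Rn n => t - q.1)
            (-(ContinuousLinearMap.fst ℝ ℝ (Rn n))) p := hasFDerivAt_fst.const_sub t
        exact hasFDerivAt_snd.add (h3.smul h2)
      have hcomp := ((hu.differentiable (by simp) (Y p)).hasFDerivAt).comp p hY'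
      have e3 : transportDeriv b Φ p = fderiv ℝ u (Y p) (b p.1 p.2 +
          ((t - p.1) • fderiv ℝ B (s, p.2) (0, b p.1 p.2) - B (s, p.2))) := by
        simp only [transportDeriv]
        rw [hev.fderiv_eq]
        have : fderiv ℝ (fun p => u (Y p)) p = _ := hcomp.fderiv
        rw [this]
        simp [sub_eq_add_neg]
      rw [e3]
      refine ((fderiv ℝ u (Y p)).le_opNorm _).trans (mul_le_mul (hΛ _) ?_ (norm_nonneg _) hΛ0)
      have e4 : b p.1 p.2 + ((t - p.1) • fderiv ℝ B (s, p.2) (0, b p.1 p.2) - B (s, p.2)) =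
          (b p.1 p.2 - B p) + (B p - B (s, p.2)) +
            (t - p.1) • fderiv ℝ B (s, p.2) (0, b p.1 p.2) := by abel
      rw [e4]
      have h1 : ‖B p - B (s, p.2)‖ ≤ L * (t - s) := by
        have := convex_univ.norm_image_sub_le_of_norm_fderiv_le (𝕜 := ℝ) (f := B) (C := L)
          (fun q _ => hB.differentiable (by simp) q) (fun q _ => hL q) (mem_univ (s, p.2))
          (mem_univ p)
        refine this.trans (mul_le_mul_of_nonneg_left ?_ hL0)
        have e5 : p - (s, p.2) = (p.1 - s, (0 : Rn n)) := by ext <;> simp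
        rw [e5, Prod.norm_def]
        simp only [norm_zero, Real.norm_eq_abs]
        rw [abs_of_pos (sub_pos.2 hp.1)]
        exact max_le (by linarith [hp.2]) hh.le
      have h2 : ‖(t - p.1) • fderiv ℝ B (s, p.2) (0, b p.1 p.2)‖ ≤ (t - s) * (L * K) := by
        rw [norm_smul, Real.norm_of_nonneg (by linarith [hp.2])]
        refine mul_le_mul (by linarith [hp.1]) ?_ (norm_nonneg _) hh.le
        refine ((fderiv ℝ B (s, p.2)).le_opNorm _).trans (mul_le_mul (hL _) ?_ (norm_nonneg _) hL0)
        rw [Prod.norm_def]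
        simpa using hbd p.1 p.2
      refine (norm_add_le _ _).trans ?_
      have := norm_add_le (b p.1 p.2 - B p) (B p - B (s, p.2))
      nlinarith)
  refine hle.trans (le_of_eq ?_)
  rw [integral_const_mul, integral_add hbB.integrableOn (integrable_const _), setIntegral_const,
    smul_eq_mul]
  ring

end flux

end

section

variable {n : ℕ} {T R K : ℝ} {b : ℝ → Rn n → Rn n} {M₁ M₂ : Measure (ℝ × Rn n)}

theorem LocalWeakSolution.flux_of_nonpos (hM : LocalWeakSolution T R b M₁ M₂) {s : ℝ} (hs : s ≤ 0)
    (g : Rn n → ℝ) : flux b M₁ M₂ s g = 0 := by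
  have h : {p : ℝ × Rn n | p.1 ≤ s}.indicator (transportDeriv b fun p => g p.2)
      =ᵐ[M₁ + M₂] fun _ => 0 := by
    filter_upwards [hM.supp] with p hp
    refine indicator_of_notMem (fun h => ?_) _
    exact absurd hp.1 (not_lt.2 (le_trans (show p.1 ≤ s from h) hs))
  rw [flux, integralDiff_congr h]
  simp [integralDiff]

/-- Smooth functions with modulus of continuity `k` vanishing outside the ball of radius `r`. -/
def modulusClass (n : ℕ) (k : ℝ → ℝ) (r : ℝ) : Set (Rn n → ℝ) :=
  {u | ContDiff ℝ ∞ u ∧ (∀ x, r ≤ ‖x‖ → u x = 0) ∧ ∀ x y, |u x - u y| ≤ k ‖x - y‖}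

theorem modulusClass_mono {k : ℝ → ℝ} {r r' : ℝ} (h : r ≤ r') :
    modulusClass n k r ⊆ modulusClass n k r' :=
  fun _ hu => ⟨hu.1, fun x hx => hu.2.1 x (h.trans hx), hu.2.2⟩

theorem zero_mem_modulusClass {k : ℝ → ℝ} (hk : ∀ r, 0 ≤ r → 0 ≤ k r) (r : ℝ) :
    (fun _ => (0 : ℝ)) ∈ modulusClass n k r :=
  ⟨contDiff_const, fun _ _ => rfl, fun x y => by simpa using hk _ (norm_nonneg (x - y))⟩

theorem norm_fderiv_le_of_mem_modulusClass {k : ℝ → ℝ} {r Λ : ℝ} (hΛ : 0 ≤ Λ)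
    (hk : ∀ r, 0 ≤ r → k r ≤ Λ * r) {u : Rn n → ℝ} (hu : u ∈ modulusClass n k r) (x : Rn n) :
    ‖fderiv ℝ u x‖ ≤ Λ :=
  norm_fderiv_le_of_modulus hΛ (fun x y => (hu.2.2 x y).trans (hk _ (norm_nonneg _))) x

section window

variable [IsFiniteMeasure M₁] [IsFiniteMeasure M₂]

/-- The class of functions with modulus `ψ (· + ε) - ψ ε` is propagated backwards by the frozen
field, up to small errors. -/
theorem exists_flux_le_step : ∃ c : ℝ, 0 < c ∧ ∀ {n : ℕ} {T R₀ K C : ℝ} {b : ℝ → Rn n → Rn n}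
    {w ψ : ℝ → ℝ} {M₁ M₂ : Measure (ℝ × Rn n)} [IsFiniteMeasure M₁] [IsFiniteMeasure M₂]
    (_ : OsgoodModulus w) (_ : OsgoodGauge w ψ) (_ : OsgoodField b K C w) (_ : 0 ≤ R₀)
    (_ : LocalWeakSolution T (R₀ + 3) b M₁ M₂) {B : ℝ × Rn n → Rn n} (_ : ContDiff ℝ ∞ B)
    (_ : ∀ p, ‖B p‖ ≤ K) (_ : ∀ t x y, ‖B (t, x) - B (t, y)‖ ≤ C * w ‖x - y‖)
    {L : ℝ} (_ : ∀ p, ‖fderiv ℝ B p‖ ≤ L) {m : ℝ → ℝ}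
    (_ : ∀ a c, a ≤ c → (M₁ + M₂).real (Ioc a c ×ˢ univ) = ∫ t in a..c, m t)
    {s t : ℝ} (_ : 0 ≤ s) (_ : s < t) (_ : t < T)
    (_ : HasDerivAt (fun x => ∫ t in s..x, m t) (m s) s) (_ : 2 * (t - s) * K ≤ 1)
    (_ : t - s ≤ 1) {ε : ℝ} (_ : 0 < ε) {r : ℝ} (_ : r ≤ R₀ + 1) {u : Rn n → ℝ}
    (_ : u ∈ modulusClass n (fun r => ψ (r + ε) - ψ ε) r),
    ∃ v ∈ modulusClass n (fun r => ψ (r + ε) - ψ ε) (r + (K + 1) * (t - s)),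
      flux b M₁ M₂ t u ≤ (1 + (t - s) * C) * flux b M₁ M₂ s v +
        c * (m s * (2 * ((t - s) * C * ψ ε) + (t - s) ^ 2)) +
        ψ ε / w ε * ((∫ p in Ioc s t ×ˢ univ, ‖b p.1 p.2 - B p‖ ∂(M₁ + M₂)) +
        (t - s) * (L * (1 + K)) * (M₁ + M₂).real (Ioc s t ×ˢ univ)) := by
  obtain ⟨c, hc, hflux⟩ := exists_abs_flux_le
  refine ⟨c, hc, ?_⟩
  intro n T R₀ K C b w ψ M₁ M₂ _ _ hw hψ hb hR₀ hM B hB hBK hBm L hL m hm s t hs hst ht hd hK hts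
    ε hε r hr u hu
  set k : ℝ → ℝ := fun r => ψ (r + ε) - ψ ε with hk
  set h : ℝ := t - s with hh
  have hh0 : 0 < h := sub_pos.2 hst
  have hC := hb.nonneg
  have hK0 : 0 ≤ K := (norm_nonneg _).trans (hBK 0)
  have hψε := hψ.pos ε hε
  have hΛ : 0 ≤ ψ ε / w ε := (div_pos hψε (hw.pos hε)).le
  have hkΛ : ∀ r, 0 ≤ r → k r ≤ ψ ε / w ε * r := fun r hr => hψ.shift_le_mul hε hr
  have hkm : MonotoneOn k (Ici 0) := hψ.shift_monotoneOn hw hε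
  have hq : 0 < 1 + h * C := by positivity
  set v₀ : Rn n → ℝ := fun x => u (x + h • B (s, x)) with hv₀
  have hstep := hM.flux_step hR₀ hb.meas hb.bound hB hBK hL hs hst ht hK hu.1 hr hu.2.1
    (norm_fderiv_le_of_mem_modulusClass hΛ hkΛ hu)
  have hv₀s : ContDiff ℝ ∞ v₀ := by
    have h1 : ContDiff ℝ ∞ fun x : Rn n => B (s, x) := hB.comp (contDiff_const.prodMk contDiff_id)
    exact hu.1.comp (contDiff_id.add (h1.const_smul h))
  have hv₀m : ∀ x y, |v₀ x - v₀ y| ≤ (1 + h * C) * k ‖x - y‖ + h * C * ψ ε := by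
    intro x y
    refine (hu.2.2 _ _).trans ((hkm (norm_nonneg _) ?_ ?_).trans
      (hψ.shift_step hw hε hC hh0.le (norm_nonneg (x - y))))
    · have := (norm_nonneg _).trans (hBm s x y)
      exact add_nonneg (norm_nonneg _) (mul_nonneg hh0.le this)
    · have e : x + h • B (s, x) - (y + h • B (s, y)) = (x - y) + h • (B (s, x) - B (s, y)) := by
        rw [smul_sub]; abel
      rw [e]
      refine (norm_add_le _ _).trans (add_le_add le_rfl ?_)
      rw [norm_smul, Real.norm_of_nonneg hh0.le]
      exact mul_le_mul_of_nonneg_left (hBm s x y) hh0.le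
  have hv₀0 : ∀ x, r + h * K ≤ ‖x‖ → v₀ x = 0 := by
    intro x hx
    apply hu.2.1
    have h1 : ‖x‖ - ‖h • B (s, x)‖ ≤ ‖x + h • B (s, x)‖ := by
      have := norm_sub_norm_le x (-(h • B (s, x)))
      rwa [norm_neg, sub_neg_eq_add] at this
    have h2 : ‖h • B (s, x)‖ ≤ h * K := by
      rw [norm_smul, Real.norm_of_nonneg hh0.le]
      exact mul_le_mul_of_nonneg_left (hBK _) hh0.le
    linarith
  obtain ⟨v, hvs, hvm, hvv, hv0⟩ := exists_smooth_modulus (k := fun r => (1 + h * C) * k r)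
    (by simp [hk]) (fun a ha b hb hab => mul_le_mul_of_nonneg_left (hkm ha hb hab) hq.le)
    (fun r s hr hs => by
      have := mul_le_mul_of_nonneg_left (hψ.shift_add_le hε hr hs) hq.le
      rw [mul_add] at this
      exact this)
    (mul_nonneg hq.le hΛ) (fun r hr => by
      have := mul_le_mul_of_nonneg_left (hkΛ r hr) hq.le
      rwa [← mul_assoc] at this)
    (show 0 ≤ h * C * ψ ε by positivity) hv₀m hv₀0 (show 0 < h ^ 2 by positivity)
  have hhh : h ^ 2 ≤ h := by nlinarith
  have hv0' : ∀ x, r + (K + 1) * h ≤ ‖x‖ → v x = 0 := fun x hx => hv0 x (by nlinarith)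
  have hKh : h * K ≤ 1 / 2 := by linarith
  have hdiff := hM.flux_sub hb.meas hb.bound (R' := r + (K + 1) * h) hv₀s
    (fun x hx => hv₀0 x (by nlinarith)) hvs hv0' s
  have hsmall := hflux hM hb.meas hb.bound hm (hst.trans ht) hd (hv₀s.sub hvs) (fun x hx => by
      rw [hv₀0 x (by linarith), hv0 x (by linarith), sub_zero]) (N := 2 * (h * C * ψ ε) + h ^ 2)
      (fun x => by rw [abs_sub_comm]; exact hvv x)
  refine ⟨fun x => (1 + h * C)⁻¹ * v x, ⟨contDiff_const.mul hvs, fun x hx => ?_, fun x y => ?_⟩, ?_⟩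
  · simp only [hv0' x hx, mul_zero]
  · rw [← mul_sub, abs_mul, abs_of_pos (inv_pos.2 hq), inv_mul_le_iff₀ hq]
    exact hvm x y
  · rw [flux_const_mul _ hvs, mul_inv_cancel_left₀ hq.ne']
    have h1 := (abs_le.1 hstep).2
    have h2 := (abs_le.1 hsmall).2
    linarith

theorem exists_flux_le_window : ∃ c : ℝ, 0 < c ∧ ∀ {n : ℕ} {T R₀ K C : ℝ} {b : ℝ → Rn n → Rn n}
    {w ψ : ℝ → ℝ} {M₁ M₂ : Measure (ℝ × Rn n)} [IsFiniteMeasure M₁] [IsFiniteMeasure M₂]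
    (_ : OsgoodModulus w) (_ : OsgoodGauge w ψ) (_ : OsgoodField b K C w) (_ : 0 ≤ R₀)
    (_ : LocalWeakSolution T (R₀ + 3) b M₁ M₂) {R₁ : ℝ}
    (_ : ∀ t x, t ∉ Ioo 0 T ∨ R₁ ≤ ‖x‖ → b t x = 0)
    {τ₁ τ₂ : ℝ} (_ : 0 ≤ τ₁) (_ : τ₁ ≤ τ₂) (_ : τ₂ < T) (_ : (K + 1) * (τ₂ - τ₁) ≤ 1)
    (_ : ∀ g : Rn n → ℝ, ContDiff ℝ ∞ g → (∀ x, R₀ + 1 ≤ ‖x‖ → g x = 0) →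
      flux b M₁ M₂ τ₁ g = 0) {ε : ℝ} (_ : 0 < ε) {u : Rn n → ℝ}
    (_ : u ∈ modulusClass n (fun r => ψ (r + ε) - ψ ε) R₀),
    flux b M₁ M₂ τ₂ u ≤
      Real.exp (C * (τ₂ - τ₁)) * (c * (2 * C * ψ ε) * (M₁ + M₂).real univ) := by
  obtain ⟨c, hc, hstep⟩ := exists_flux_le_step
  refine ⟨c, hc, ?_⟩
  intro n T R₀ K C b w ψ M₁ M₂ _ _ hw hψ hb hR₀ hM R₁ hsupp τ₁ τ₂ hτ₁ hτ hτ₂ hKτ hzero ε hε u hu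
  set k : ℝ → ℝ := fun r => ψ (r + ε) - ψ ε with hk
  set M := M₁ + M₂ with hMdef
  set Λ : ℝ := ψ ε / w ε with hΛdef
  have hψε := hψ.pos ε hε
  have hΛ : 0 < Λ := div_pos hψε (hw.pos hε)
  have hC := hb.nonneg
  have hK0 : 0 ≤ K := (norm_nonneg _).trans (hb.bound 0 0)
  have hkΛ : ∀ r, 0 ≤ r → k r ≤ Λ * r := fun r hr => hψ.shift_le_mul hε hr
  have hkm : MonotoneOn k (Ici 0) := hψ.shift_monotoneOn hw hε
  have hk0 : ∀ r, 0 ≤ r → 0 ≤ k r := fun r hr => by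
    have := hkm (mem_Ici.2 le_rfl) hr hr
    simpa [hk] using this
  -- it suffices to prove the bound up to an arbitrarily small error
  suffices H : ∀ δ > 0, flux b M₁ M₂ τ₂ u ≤
      Real.exp (C * (τ₂ - τ₁)) * (c * (2 * C * ψ ε) * M.real univ + Λ * δ) by
    refine le_of_tendsto_of_tendsto (f := fun _ : ℝ => flux b M₁ M₂ τ₂ u) (b := 𝓝[>] (0 : ℝ))
      (g := fun δ => Real.exp (C * (τ₂ - τ₁)) * (c * (2 * C * ψ ε) * M.real univ + Λ * δ))
      tendsto_const_nhds ?_ (by filter_upwards [self_mem_nhdsWithin] with δ hδ using H δ hδ)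
    have : Continuous fun δ => Real.exp (C * (τ₂ - τ₁)) *
        (c * (2 * C * ψ ε) * M.real univ + Λ * δ) := by fun_prop
    have h2 := (this.tendsto 0).mono_left (nhdsWithin_le_nhds (s := Ioi 0))
    simpa using h2
  intro δ hδ
  obtain ⟨B, hB, hBc, hBK, hBm, hBδ⟩ := hb.exists_smooth_approx hw hsupp M hM.ac hδ
  obtain ⟨L, hL⟩ : ∃ L, ∀ p, ‖fderiv ℝ B p‖ ≤ L :=
    (hBc.fderiv ℝ).exists_bound_of_continuous (hB.continuous_fderiv (by simp))
  obtain ⟨m, hm0, hmi, hm, hmt⟩ := exists_timeDensity M hM.ac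
  have hbB : Integrable (fun p : ℝ × Rn n => ‖b p.1 p.2 - B p‖) M := by
    refine Integrable.of_bound
      (hb.meas.sub hB.continuous.measurable).norm.aestronglyMeasurable (K + K)
      (ae_of_all _ fun p => ?_)
    rw [norm_norm]
    exact (norm_sub_le _ _).trans (add_le_add (hb.bound _ _) (hBK _))
  set E : Measure (ℝ × Rn n) := M.withDensity fun p => ENNReal.ofReal ‖b p.1 p.2 - B p‖ with hE
  have hEf : IsFiniteMeasure E := isFiniteMeasure_withDensity_ofReal hbB.2
  have hEr : ∀ S, MeasurableSet S → E.real S = ∫ p in S, ‖b p.1 p.2 - B p‖ ∂M := by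
    intro S hS
    rw [measureReal_def, hE, withDensity_apply _ hS, integral_eq_lintegral_of_nonneg_ae
      (ae_of_all _ fun _ => norm_nonneg _) hbB.1.restrict]
  obtain ⟨e, he0, hei, he, het⟩ := exists_timeDensity E
    (((withDensity_absolutelyContinuous _ _).map measurable_fst).trans hM.ac)
  set 𝒦 : ℝ → Set (Rn n → ℝ) := fun s => modulusClass n k (R₀ + (K + 1) * (τ₂ - s)) with h𝒦
  set A : ℝ → ℝ := fun s => sSup (flux b M₁ M₂ s '' 𝒦 s) with hA
  have hΛu : ∀ s, ∀ v ∈ 𝒦 s, ∀ x, ‖fderiv ℝ v x‖ ≤ Λ := fun s v hv x =>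
    norm_fderiv_le_of_mem_modulusClass hΛ.le hkΛ hv x
  have hsubflux : ∀ s t, s ≤ t → ∀ v ∈ 𝒦 t, τ₁ ≤ s → s ≤ t → t ≤ τ₂ →
      |flux b M₁ M₂ t v - flux b M₁ M₂ s v| ≤ Λ * K * ∫ x in s..t, m x := by
    intro s t hst v hv h1 h2 h3
    rw [← hm s t hst]
    exact hM.abs_flux_sub_le hb.meas hb.bound hv.1 hv.2.1 (hΛu t v hv) hst
  have hbdd : ∀ s ∈ Icc τ₁ τ₂, BddAbove (flux b M₁ M₂ s '' 𝒦 s) := by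
    intro s hs
    refine ⟨Λ * K * M.real (Ioc 0 s ×ˢ univ), ?_⟩
    rintro _ ⟨v, hv, rfl⟩
    have h1 := hM.abs_flux_sub_le hb.meas hb.bound hv.1 hv.2.1 (hΛu s v hv) (hτ₁.trans hs.1)
    rw [hM.flux_of_nonpos le_rfl, sub_zero] at h1
    exact (le_abs_self _).trans h1
  have hne : ∀ s, (flux b M₁ M₂ s '' 𝒦 s).Nonempty := fun s =>
    ⟨_, mem_image_of_mem _ (zero_mem_modulusClass hk0 _)⟩
  have hAnn : ∀ s ∈ Icc τ₁ τ₂, 0 ≤ A s := by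
    intro s hs
    have : flux b M₁ M₂ s (fun _ => 0) = 0 := by
      have := flux_const_mul (b := b) (M₁ := M₁) (M₂ := M₂) 0
        (contDiff_const (c := (0 : ℝ)) (𝕜 := ℝ) (E := Rn n) (n := ∞)) s
      simpa using this
    rw [← this]
    exact le_csSup (hbdd s hs) (mem_image_of_mem _ (zero_mem_modulusClass hk0 _))
  have hAF : ∀ s t, τ₁ ≤ s → s ≤ t → t ≤ τ₂ → A t - A s ≤ ∫ x in s..t, Λ * K * m x := by
    intro s t h1 h2 h3
    rw [intervalIntegral.integral_const_mul, sub_le_iff_le_add']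
    refine csSup_le (hne t) ?_
    rintro _ ⟨v, hv, rfl⟩
    have hv' : v ∈ 𝒦 s := modulusClass_mono (by nlinarith) hv
    have h4 := le_csSup (hbdd s ⟨h1, h2.trans h3⟩) (mem_image_of_mem _ hv')
    have h5 := (abs_le.1 (hsubflux s t h2 v hv h1 h2 h3)).2
    have h6 : flux b M₁ M₂ s v ≤ A s := h4
    linarith
  have hA1 : A τ₁ ≤ 0 := by
    refine csSup_le (hne _) ?_
    rintro _ ⟨v, hv, rfl⟩
    exact (hzero v hv.1 fun x hx => hv.2.1 x (by linarith)).le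
  set f : ℝ → ℝ := fun s => c * (2 * C * ψ ε) * m s + Λ * e s with hf
  have hfi : Integrable f := (hmi.const_mul _).add (hei.const_mul _)
  have hder : ∀ᵐ s, s ∈ Ioo τ₁ τ₂ → DifferentiableAt ℝ A s → deriv A s ≤ C * A s + f s := by
    have hmd := (hmi.intervalIntegrable (a := τ₁) (b := τ₂)).ae_hasDerivAt_integral
    have hed := (hei.intervalIntegrable (a := τ₁) (b := τ₂)).ae_hasDerivAt_integral
    filter_upwards [hmd, hed] with s hms hes hs hAs
    have hsI : s ∈ uIcc τ₁ τ₂ := by rw [uIcc_of_le hτ]; exact ⟨hs.1.le, hs.2.le⟩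
    have hms' := hms hsI s hsI
    have hes' := hes hsI s hsI
    have slope : ∀ {F : ℝ → ℝ} {F' : ℝ}, HasDerivAt F F' s →
        Tendsto (fun h => h⁻¹ * (F (s + h) - F s)) (𝓝[>] 0) (𝓝 F') := fun hF => by
      have := (hasDerivAt_iff_tendsto_slope_zero.1 hF).mono_left
        (nhdsWithin_mono 0 (show Ioi (0 : ℝ) ⊆ {0}ᶜ from fun x hx => (ne_of_gt hx)))
      simpa only [smul_eq_mul] using this
    have l1 := slope hAs.hasDerivAt
    have l2 := slope hms'
    have l3 := slope hes'
    simp only [intervalIntegral.integral_same, sub_zero] at l2 l3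
    have l0 : Tendsto (fun h : ℝ => h) (𝓝[>] 0) (𝓝 0) := nhdsWithin_le_nhds
    have lr : Tendsto (fun h => C * A s + c * (m s * (2 * (C * ψ ε) + h)) +
        Λ * (h⁻¹ * (∫ x in s..s + h, e x) + h * ((L * (1 + K)) * (h⁻¹ * ∫ x in s..s + h, m x))))
        (𝓝[>] 0) (𝓝 (C * A s + c * (m s * (2 * (C * ψ ε) + 0)) +
          Λ * (e s + 0 * ((L * (1 + K)) * m s)))) := by
      exact ((((l0.const_add _).const_mul _).const_mul _).const_add _).add
        ((l3.add (l0.mul (l2.const_mul _))).const_mul _)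
    have hfin : deriv A s ≤ C * A s + c * (m s * (2 * (C * ψ ε) + 0)) +
          Λ * (e s + 0 * ((L * (1 + K)) * m s)) := by
      refine le_of_tendsto_of_tendsto l1 lr ?_
      have hη : (0 : ℝ) < min (τ₂ - s) (min 1 (1 / (2 * (K + 1)))) :=
        lt_min (sub_pos.2 hs.2) (lt_min one_pos (by positivity))
      filter_upwards [Ioo_mem_nhdsGT hη] with h hh
      have hh0 : 0 < h := hh.1
      have hh1 : h < τ₂ - s := hh.2.trans_le (min_le_left _ _)
      have hh2 : h ≤ 1 := (hh.2.trans_le ((min_le_right _ _).trans (min_le_left _ _))).le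
      have hh3 : h ≤ 1 / (2 * (K + 1)) :=
        (hh.2.trans_le ((min_le_right _ _).trans (min_le_right _ _))).le
      rw [le_div_iff₀ (by positivity)] at hh3
      have hsI' : s ∈ Icc τ₁ τ₂ := ⟨hs.1.le, hs.2.le⟩
      have key : A (s + h) ≤ (1 + h * C) * A s + c * (m s * (2 * (h * C * ψ ε) + h ^ 2)) +
          Λ * ((∫ x in s..s + h, e x) + h * (L * (1 + K)) * ∫ x in s..s + h, m x) := by
        refine csSup_le (hne _) ?_
        rintro _ ⟨v, hv, rfl⟩
        obtain ⟨v', hv', hle⟩ := hstep hw hψ hb hR₀ hM hB hBK hBm hL hm (hτ₁.trans hs.1.le)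
          (show s < s + h by linarith) (show s + h < T by linarith) hms' (by
            rw [add_sub_cancel_left]; nlinarith) (by rw [add_sub_cancel_left]; exact hh2) hε
            (r := R₀ + (K + 1) * (τ₂ - (s + h))) (by nlinarith [hs.1]) hv
        rw [add_sub_cancel_left, ← hEr _ (measurableSet_Ioc.prod MeasurableSet.univ),
          he _ _ (by linarith), ← hMdef, hm _ _ (by linarith)] at hle
        have hv'' : v' ∈ 𝒦 s := by
          have e1 : R₀ + (K + 1) * (τ₂ - (s + h)) + (K + 1) * (s + h - s) =
            R₀ + (K + 1) * (τ₂ - s) := by ring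
          rw [e1] at hv'
          exact hv'
        have h4 : flux b M₁ M₂ s v' ≤ A s := le_csSup (hbdd s hsI') (mem_image_of_mem _ hv'')
        have h5 : 0 ≤ 1 + h * C := by positivity
        have h6 := mul_le_mul_of_nonneg_left h4 h5
        linarith
      rw [inv_mul_le_iff₀ hh0]
      have e2 : h * (C * A s + c * (m s * (2 * (C * ψ ε) + h)) +
          Λ * (h⁻¹ * (∫ x in s..s + h, e x) +
            h * ((L * (1 + K)) * (h⁻¹ * ∫ x in s..s + h, m x)))) =
          h * C * A s + c * (m s * (2 * (h * C * ψ ε) + h ^ 2)) +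
          Λ * ((∫ x in s..s + h, e x) + h * (L * (1 + K)) * ∫ x in s..s + h, m x) := by
        field_simp
      rw [e2]
      linarith
    refine hfin.trans (le_of_eq ?_)
    simp only [hf]; ring
  have hgron := le_exp_mul_of_deriv_le hτ hC hAnn
    ((hmi.const_mul (Λ * K)).intervalIntegrable (a := τ₁) (b := τ₂))
    (fun s => mul_nonneg (mul_nonneg hΛ.le hK0) (hm0 s)) hAF hfi.intervalIntegrable
    (fun s => add_nonneg (mul_nonneg (by positivity) (hm0 s)) (mul_nonneg hΛ.le (he0 s))) hder
  have hu' : u ∈ 𝒦 τ₂ := by simpa [h𝒦] using hu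
  have h1 : flux b M₁ M₂ τ₂ u ≤ A τ₂ := le_csSup (hbdd τ₂ ⟨hτ, le_rfl⟩) (mem_image_of_mem _ hu')
  refine h1.trans (hgron.trans (mul_le_mul_of_nonneg_left ?_ (Real.exp_pos _).le))
  have h2 : ∫ x in τ₁..τ₂, f x ≤ ∫ x, f x := by
    rw [intervalIntegral.integral_of_le hτ]
    exact setIntegral_le_integral hfi (ae_of_all _ fun s =>
      add_nonneg (mul_nonneg (by positivity) (hm0 s)) (mul_nonneg hΛ.le (he0 s)))
  have h3 : ∫ x, f x = c * (2 * C * ψ ε) * M.real univ + Λ * E.real univ := by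
    rw [← hmt, ← het, ← integral_const_mul, ← integral_const_mul]
    exact integral_add (hmi.const_mul _) (hei.const_mul _)
  have h4 : E.real univ ≤ δ := by
    rw [hEr _ MeasurableSet.univ, setIntegral_univ]; exact hBδ.le
  have := mul_le_mul_of_nonneg_left h4 hΛ.le
  linarith

/-- Vanishing of the flux propagates forward on short time windows. -/
theorem LocalWeakSolution.flux_eq_zero_window {R₀ C : ℝ} {w : ℝ → ℝ} (hw : OsgoodModulus w)
    (hb : OsgoodField b K C w) (hR₀ : 0 ≤ R₀) (hM : LocalWeakSolution T (R₀ + 3) b M₁ M₂) {R₁ : ℝ}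
    (hsupp : ∀ t x, t ∉ Ioo 0 T ∨ R₁ ≤ ‖x‖ → b t x = 0) {τ₁ τ₂ : ℝ} (hτ₁ : 0 ≤ τ₁)
    (hτ : τ₁ ≤ τ₂) (hτ₂ : τ₂ < T) (hKτ : (K + 1) * (τ₂ - τ₁) ≤ 1)
    (hzero : ∀ g : Rn n → ℝ, ContDiff ℝ ∞ g → (∀ x, R₀ + 1 ≤ ‖x‖ → g x = 0) →
      flux b M₁ M₂ τ₁ g = 0) {g : Rn n → ℝ} (hg : ContDiff ℝ ∞ g)
    (hg0 : ∀ x, R₀ ≤ ‖x‖ → g x = 0) : flux b M₁ M₂ τ₂ g = 0 := by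
  obtain ⟨ψ, hψ⟩ := hw.exists_gauge
  obtain ⟨c, hc, hwin⟩ := exists_flux_le_window
  have hgc : HasCompactSupport g := HasCompactSupport.intro
    (isCompact_closedBall (0 : Rn n) R₀) fun x hx =>
      hg0 x (not_le.1 fun h => hx (by simpa using h)).le
  obtain ⟨N₁, hN₁⟩ := hgc.exists_bound_of_continuous hg.continuous
  obtain ⟨N₂, hN₂⟩ := (hgc.fderiv ℝ).exists_bound_of_continuous (hg.continuous_fderiv (by simp))
  set N : ℝ := 2 * |N₁| + |N₂| + 1 with hN
  have hN0 : 0 < N := by positivity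
  have hgm : ∀ x y, |g x - g y| ≤ N * min ‖x - y‖ 1 := by
    intro x y
    have h1 : |g x - g y| ≤ N₂ * ‖x - y‖ := by
      have := convex_univ.norm_image_sub_le_of_norm_fderiv_le (𝕜 := ℝ) (f := g) (C := N₂)
        (fun q _ => hg.differentiable (by simp) q) (fun q _ => hN₂ q) (mem_univ y) (mem_univ x)
      simpa using this
    have h2 : |g x - g y| ≤ 2 * |N₁| := by
      have h3 := hN₁ x
      have h4 := hN₁ y
      rw [Real.norm_eq_abs] at h3 h4
      have := abs_sub (g x) (g y)
      have := le_abs_self N₁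
      linarith
    rcases le_total ‖x - y‖ 1 with h | h
    · rw [min_eq_left h]
      refine h1.trans (mul_le_mul_of_nonneg_right ?_ (norm_nonneg _))
      have := le_abs_self N₂
      have := abs_nonneg N₁
      linarith
    · rw [min_eq_right h, mul_one]
      have := abs_nonneg N₂
      linarith
  have hψ1 := hψ.pos 1 one_pos
  set q : ℝ := ψ 1 / (2 * N) with hq
  have hq0 : 0 < q := by positivity
  have key : ∀ σ : ℝ, |σ| = 1 → σ * flux b M₁ M₂ τ₂ g ≤ 0 := by
    intro σ hσ
    have hle : (σ * q) * flux b M₁ M₂ τ₂ g ≤ 0 := by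
      have l1 : Tendsto (fun ε => Real.exp (C * (τ₂ - τ₁)) *
          (c * (2 * C * ψ ε) * (M₁ + M₂).real univ)) (𝓝[>] 0) (𝓝 0) := by
        have := (((hψ.lim.const_mul (2 * C)).const_mul c).mul_const
          ((M₁ + M₂).real univ)).const_mul (Real.exp (C * (τ₂ - τ₁)))
        simpa using this
      refine ge_of_tendsto l1 ?_
      filter_upwards [self_mem_nhdsWithin, hψ.lim.eventually (ge_mem_nhds (half_pos hψ1))]
        with ε hε hε2
      have hε' : 0 < ε := hε
      rw [← flux_const_mul _ hg]
      refine hwin hw hψ hb hR₀ hM hsupp hτ₁ hτ hτ₂ hKτ hzero hε' ⟨contDiff_const.mul hg,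
        fun x hx => by simp only [hg0 x hx, mul_zero], fun x y => ?_⟩
      rw [← mul_sub, abs_mul, abs_mul, hσ, one_mul, abs_of_pos hq0]
      have h1 := hψ.min_mul_le_shift hw hε' (norm_nonneg (x - y))
      have h2 : 0 ≤ min ‖x - y‖ 1 := le_min (norm_nonneg _) zero_le_one
      have h3 := mul_le_mul_of_nonneg_left (hgm x y) hq0.le
      have h4 : q * (N * min ‖x - y‖ 1) = min ‖x - y‖ 1 * (ψ 1 / 2) := by
        rw [hq]; field_simp
      have h5 : min ‖x - y‖ 1 * (ψ 1 / 2) ≤ min ‖x - y‖ 1 * (ψ 1 - ψ ε) :=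
        mul_le_mul_of_nonneg_left (by linarith) h2
      linarith
    have : q * (σ * flux b M₁ M₂ τ₂ g) ≤ q * 0 := by linarith
    exact le_of_mul_le_mul_left this hq0
  have h1 := key 1 (by simp)
  have h2 := key (-1) (by simp)
  linarith

end window

end

section

/-- The difference `M₁ - M₂`, concentrated on `(0, T) × ℝⁿ`, solves the continuity equation with
vanishing initial datum. -/
structure WeakSolutionPair {n : ℕ} (T : ℝ) (b : ℝ → Rn n → Rn n)
    (M₁ M₂ : Measure (ℝ × Rn n)) : Prop where
  ac : (M₁ + M₂).map Prod.fst ≪ volume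
  supp : ∀ᵐ p ∂(M₁ + M₂), p.1 ∈ Ioo 0 T
  weak : ∀ φ, IsTestFunction T φ → integralDiff M₁ M₂ (transportDeriv b φ) = 0

variable {n : ℕ} {T : ℝ} {b : ℝ → Rn n → Rn n} {M₁ M₂ : Measure (ℝ × Rn n)} {G w : ℝ → ℝ}

theorem transportDeriv_radialCutoff {R : ℝ} {Φ : ℝ × Rn n → ℝ} (h : ∀ p, R ≤ ‖p.2‖ → Φ p = 0) :
    transportDeriv (fun t x => radialCutoff R x • b t x) Φ = transportDeriv b Φ := by
  ext p
  simp only [transportDeriv]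
  rcases le_or_gt ‖p.2‖ R with hp | hp
  · rw [radialCutoff_eq_one hp, one_smul]
  · have : Φ =ᶠ[𝓝 p] fun _ => (0 : ℝ) := by
      filter_upwards [(isOpen_lt continuous_const continuous_snd.norm).mem_nhds hp] with q hq
      exact h q (le_of_lt hq)
    rw [this.fderiv_eq]
    simp

theorem flux_radialCutoff {R s : ℝ} {g : Rn n → ℝ} (h : ∀ x, R ≤ ‖x‖ → g x = 0) :
    flux (fun t x => radialCutoff R x • b t x) M₁ M₂ s g = flux b M₁ M₂ s g := by
  rw [flux, flux, transportDeriv_radialCutoff fun p hp => h _ hp]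

theorem WeakSolutionPair.localWeakSolution (hM : WeakSolutionPair T b M₁ M₂) (R : ℝ) :
    LocalWeakSolution T R (fun t x => radialCutoff R x • b t x) M₁ M₂ :=
  ⟨hM.ac, hM.supp, fun φ hφ h0 => by rw [transportDeriv_radialCutoff h0]; exact hM.weak φ hφ⟩

theorem GrowthModulus.tendsto_sum_atTop (hG : GrowthModulus G) {a : ℝ} (ha : 0 ≤ a) :
    Tendsto (fun N => ∑ j ∈ Finset.range N, (G (a + j) + 1)⁻¹) atTop atTop := by
  have hanti : Antitone fun s => (G s)⁻¹ := fun s t hst =>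
    inv_anti₀ (hG.pos s) (hG.mono hst)
  have hint : ∀ c d, IntervalIntegrable (fun s => (G s)⁻¹) volume c d := fun c d =>
    hanti.antitoneOn _ |>.intervalIntegrable
  have h1 : Tendsto (fun N : ℕ => ∫ s in (1 : ℝ)..(a + N), (G s)⁻¹) atTop atTop :=
    hG.tendsto_atTop.comp (tendsto_atTop_add_const_left _ _ tendsto_natCast_atTop_atTop)
  have h2 : Tendsto (fun N : ℕ => ∫ s in a..(a + N), (G s)⁻¹) atTop atTop := by
    have : (fun N : ℕ => ∫ s in a..(a + N), (G s)⁻¹) = fun N : ℕ =>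
        (∫ s in a..1, (G s)⁻¹) + ∫ s in (1 : ℝ)..(a + N), (G s)⁻¹ := by
      ext N
      rw [intervalIntegral.integral_add_adjacent_intervals (hint _ _) (hint _ _)]
    rw [this]
    exact tendsto_atTop_add_const_left _ _ h1
  set q : ℝ := G 0 / (G 0 + 1) with hq
  have hG0 := hG.pos 0
  have hq0 : 0 < q := by positivity
  refine tendsto_atTop_mono (fun N => ?_) (h2.const_mul_atTop hq0)
  refine (mul_le_mul_of_nonneg_left
    ((hanti.antitoneOn (Icc a (a + N))).integral_le_sum) hq0.le).trans ?_
  rw [Finset.mul_sum]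
  refine Finset.sum_le_sum fun j _ => ?_
  have hp := hG.pos (a + j)
  have hle : G 0 ≤ G (a + j) := hG.mono (by positivity)
  rw [hq, ← div_eq_mul_inv, div_div, inv_eq_one_div,
    div_le_div_iff₀ (by positivity) (by positivity)]
  nlinarith

section uniqueness

variable [IsFiniteMeasure M₁] [IsFiniteMeasure M₂]

theorem WeakSolutionPair.flux_eq_zero (hM : WeakSolutionPair T b M₁ M₂)
    (hb : LocalOsgoodField b G w) (hG : GrowthModulus G) (hw : OsgoodModulus w)
    (hb0 : ∀ t x, t ∉ Ioo 0 T → b t x = 0) {t : ℝ} (ht : t < T) {g : Rn n → ℝ}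
    (hg : ContDiff ℝ ∞ g) {R : ℝ} (hR : 0 ≤ R) (hg0 : ∀ x, R ≤ ‖x‖ → g x = 0) :
    flux b M₁ M₂ t g = 0 := by
  have key : ∀ (N : ℕ) (R : ℝ), 0 ≤ R → ∀ t < T,
      t ≤ ∑ j ∈ Finset.range N, (G (R + 4 + j) + 1)⁻¹ → ∀ g : Rn n → ℝ, ContDiff ℝ ∞ g →
      (∀ x, R ≤ ‖x‖ → g x = 0) → flux b M₁ M₂ t g = 0 := by
    intro N
    induction N with
    | zero =>
      intro R _ t _ ht0 g _ _
      have h : LocalWeakSolution T R b M₁ M₂ :=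
        ⟨hM.ac, hM.supp, fun φ hφ _ => hM.weak φ hφ⟩
      exact h.flux_of_nonpos (by simpa using ht0) g
    | succ N ih =>
      intro R hR t htT htN g hg hg0
      obtain ⟨C, hC⟩ := hb.cutoff hG hw (show 0 < R + 3 by linarith)
      have hp := hG.pos (R + 3 + 1)
      set τ : ℝ := max 0 (t - (G (R + 3 + 1) + 1)⁻¹) with hτ
      have hi : 0 < (G (R + 3 + 1) + 1)⁻¹ := by positivity
      rcases le_or_gt t 0 with ht0 | ht0
      · have h : LocalWeakSolution T R b M₁ M₂ :=
          ⟨hM.ac, hM.supp, fun φ hφ _ => hM.weak φ hφ⟩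
        exact h.flux_of_nonpos ht0 g
      have hτt : τ ≤ t := max_le ht0.le (by linarith)
      rw [← flux_radialCutoff (R := R + 3) fun x hx => hg0 x (by linarith)]
      refine (hM.localWeakSolution (R + 3)).flux_eq_zero_window hw hC hR (R₁ := R + 3 + 1) ?_
        (le_max_left _ _) hτt htT ?_ ?_ hg hg0
      · rintro s x (hs | hx)
        · rw [hb0 s x hs, smul_zero]
        · rw [radialCutoff_eq_zero hx, zero_smul]
      · have h1 : t - τ ≤ (G (R + 3 + 1) + 1)⁻¹ := by
          have := le_max_right 0 (t - (G (R + 3 + 1) + 1)⁻¹)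
          linarith
        calc (G (R + 3 + 1) + 1) * (t - τ) ≤ (G (R + 3 + 1) + 1) * (G (R + 3 + 1) + 1)⁻¹ := by
              gcongr
          _ = 1 := mul_inv_cancel₀ (by positivity)
      · intro g' hg' hg0'
        rw [flux_radialCutoff (R := R + 3) fun x hx => hg0' x (by linarith)]
        refine ih (R + 1) (by linarith) τ (hτt.trans_lt htT) ?_ g' hg' hg0'
        rw [hτ]
        refine max_le (Finset.sum_nonneg fun j _ => ?_) ?_
        · have := hG.pos (R + 1 + 4 + j)
          positivity
        · rw [Finset.sum_range_succ'] at htN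
          have e1 : ∀ j : ℕ, R + 4 + ((j + 1 : ℕ) : ℝ) = R + 1 + 4 + j := fun j => by
            push_cast; ring
          simp only [e1] at htN
          have e2 : R + 4 + ((0 : ℕ) : ℝ) = R + 3 + 1 := by push_cast; ring
          rw [e2] at htN
          linarith
  obtain ⟨N, hN⟩ :=
    ((hG.tendsto_sum_atTop (show 0 ≤ R + 4 by linarith)).eventually_ge_atTop t).exists
  exact key N R hR t ht hN g hg hg0

theorem integral_indicator_sub_mul {M : Measure (ℝ × Rn n)} [IsFiniteMeasure M]
    {q : ℝ × Rn n → ℝ} (hq : Integrable q M) (h0 : ∀ᵐ p ∂M, 0 < p.1) (t₀ : ℝ) :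
    ∫ p, {p : ℝ × Rn n | p.1 ≤ t₀}.indicator (fun p => (t₀ - p.1) * q p) p ∂M =
      ∫ t in Ioc 0 t₀, ∫ p, {p : ℝ × Rn n | p.1 ≤ t}.indicator q p ∂M := by
  have hms : MeasurableSet {z : (ℝ × Rn n) × ℝ | z.1.1 ≤ z.2} :=
    measurableSet_le (measurable_fst.comp measurable_fst) measurable_snd
  have hint : Integrable (Function.uncurry fun (p : ℝ × Rn n) (t : ℝ) =>
      {p : ℝ × Rn n | p.1 ≤ t}.indicator q p) (M.prod (volume.restrict (Ioc 0 t₀))) := by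
    have h1 : Integrable (fun z : (ℝ × Rn n) × ℝ => q z.1)
      (M.prod (volume.restrict (Ioc 0 t₀))) := hq.comp_fst _
    refine (h1.indicator hms).congr (ae_of_all _ fun z => ?_)
    by_cases hz : z.1.1 ≤ z.2 <;> simp [Function.uncurry, indicator, hz]
  rw [← integral_integral_swap hint]
  apply integral_congr_ae
  filter_upwards [h0] with p hp
  have e1 : (fun t : ℝ => {p : ℝ × Rn n | p.1 ≤ t}.indicator q p) =
      (Ici p.1).indicator fun _ => q p := by
    ext t
    by_cases h : p.1 ≤ t <;> simp [indicator, h]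
  rw [e1, setIntegral_indicator measurableSet_Ici, setIntegral_const]
  have e2 : Ioc 0 t₀ ∩ Ici p.1 = Icc p.1 t₀ := by
    ext t
    simp only [mem_inter_iff, mem_Ioc, mem_Ici, mem_Icc]
    exact ⟨fun h => ⟨h.2, h.1.2⟩, fun h => ⟨⟨hp.trans_le h.1, h.2⟩, h.1⟩⟩
  rw [e2, measureReal_def, Real.volume_Icc]
  by_cases h : p.1 ≤ t₀
  · rw [indicator_of_mem (show p ∈ {p : ℝ × Rn n | p.1 ≤ t₀} from h),
      ENNReal.toReal_ofReal (by linarith), smul_eq_mul]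
  · rw [indicator_of_notMem (show p ∉ {p : ℝ × Rn n | p.1 ≤ t₀} from h),
      ENNReal.ofReal_of_nonpos (by linarith)]
    simp

theorem WeakSolutionPair.integralDiff_indicator_eq_zero (hM : WeakSolutionPair T b M₁ M₂)
    (hb : LocalOsgoodField b G w) (hG : GrowthModulus G) (hw : OsgoodModulus w)
    (hb0 : ∀ t x, t ∉ Ioo 0 T → b t x = 0) {t₀ : ℝ} (ht₀ : t₀ ∈ Ico 0 T) {g : Rn n → ℝ}
    (hg : ContDiff ℝ ∞ g) (hgc : HasCompactSupport g) :
    integralDiff M₁ M₂ ({p | p.1 ≤ t₀}.indicator fun p => g p.2) = 0 := by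
  obtain ⟨R, hR0, hgR⟩ : ∃ R, 0 < R ∧ ∀ x, R ≤ ‖x‖ → g x = 0 := by
    obtain ⟨R, hR⟩ := hgc.isCompact.isBounded.subset_closedBall (0 : Rn n)
    refine ⟨|R| + 1, by positivity, fun x hx => image_eq_zero_of_notMem_tsupport fun h => ?_⟩
    have h1 := hR h
    rw [mem_closedBall_zero_iff] at h1
    have := le_abs_self R
    linarith
  obtain ⟨C, hC⟩ := hb.cutoff hG hw hR0
  set c : ℝ → Rn n → Rn n := fun t x => radialCutoff R x • b t x with hc
  have hL := hM.localWeakSolution R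
  have hΦ : SpaceSupported R fun p : ℝ × Rn n => (p.1 - t₀) * g p.2 :=
    ⟨(contDiff_fst.sub contDiff_const).mul (hg.comp contDiff_snd), fun p hp => by
      simp only [hgR _ hp, mul_zero]⟩
  have hgS : SpaceSupported R fun p : ℝ × Rn n => g p.2 := SpaceSupported.snd hg hgR
  set q : ℝ × Rn n → ℝ := transportDeriv c fun p => g p.2 with hq
  have hqi : Integrable q (M₁ + M₂) := hL.integrable_transportDeriv hC.meas hC.bound hgS
  have hgi : Integrable (fun p : ℝ × Rn n => g p.2) (M₁ + M₂) := by
    obtain ⟨N, hN⟩ := hgc.exists_bound_of_continuous hg.continuous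
    exact Integrable.of_bound (hg.continuous.comp continuous_snd).aestronglyMeasurable N
      (ae_of_all _ fun p => hN p.2)
  have hD : transportDeriv c (fun p : ℝ × Rn n => (p.1 - t₀) * g p.2) =
      fun p => g p.2 - (t₀ - p.1) * q p := by
    ext p
    have h1 : HasFDerivAt (fun p : ℝ × Rn n => g p.2) (fderiv ℝ (fun p : ℝ × Rn n => g p.2) p) p :=
      (hgS.1.differentiable (by simp) p).hasFDerivAt
    have h2 := HasFDerivAt.fun_mul (hasFDerivAt_fst (p := p) (𝕜 := ℝ) |>.sub_const t₀) h1
    simp only [transportDeriv, h2.fderiv, hq]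
    simp
    ring
  have hflux := hL.flux_eq hC.meas hC.bound hΦ ht₀
  have hz : flux c M₁ M₂ t₀ (fun x => (t₀ - t₀) * g x) = 0 := by
    rw [flux_const_mul _ hg, sub_self, zero_mul]
  simp only at hflux
  rw [hz, hD] at hflux
  have hle := measurableSet_fst_le (n := n) t₀
  have hqti : Integrable ({p : ℝ × Rn n | p.1 ≤ t₀}.indicator fun p => (t₀ - p.1) * q p)
      (M₁ + M₂) := by
    refine ((hqi.norm.const_mul t₀).mono' ((AEStronglyMeasurable.mul
      (measurable_const.sub measurable_fst).aestronglyMeasurable hqi.1).indicator hle) ?_)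
    filter_upwards [hM.supp] with p hp
    by_cases h : p.1 ≤ t₀
    · rw [indicator_of_mem (show p ∈ {p : ℝ × Rn n | p.1 ≤ t₀} from h), norm_mul,
        Real.norm_of_nonneg (by linarith)]
      exact mul_le_mul_of_nonneg_right (by linarith [hp.1]) (norm_nonneg _)
    · rw [indicator_of_notMem (show p ∉ {p : ℝ × Rn n | p.1 ≤ t₀} from h), norm_zero]
      exact mul_nonneg ht₀.1 (norm_nonneg _)
  have hsplit : integralDiff M₁ M₂ ({p | p.1 ≤ t₀}.indicator fun p => g p.2 - (t₀ - p.1) * q p) =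
      integralDiff M₁ M₂ ({p | p.1 ≤ t₀}.indicator fun p => g p.2) -
      integralDiff M₁ M₂ ({p | p.1 ≤ t₀}.indicator fun p => (t₀ - p.1) * q p) := by
    rw [← integralDiff_sub (hgi.indicator hle) hqti]
    congr 1
    ext p
    by_cases h : p.1 ≤ t₀ <;> simp [indicator, h]
  rw [hsplit] at hflux
  have h0 : ∀ᵐ p ∂(M₁ + M₂), 0 < p.1 := hM.supp.mono fun p hp => hp.1
  rw [ae_add_measure_iff] at h0
  have hq12 := integrable_add_measure.1 hqi
  have hFub : integralDiff M₁ M₂ ({p | p.1 ≤ t₀}.indicator fun p => (t₀ - p.1) * q p) = 0 := by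
    rw [integralDiff, integral_indicator_sub_mul hq12.1 h0.1,
      integral_indicator_sub_mul hq12.2 h0.2,
      sub_eq_zero]
    apply setIntegral_congr_fun measurableSet_Ioc
    intro t ht
    have h1 := hM.flux_eq_zero hb hG hw hb0 (ht.2.trans_lt ht₀.2) hg hR0.le hgR
    rw [← flux_radialCutoff hgR, flux, integralDiff, sub_eq_zero] at h1
    exact h1
  rw [hFub] at hflux
  linarith

/-- A finite measure on `ℝⁿ` is determined by the integrals of smooth functions with compact
support. -/
theorem ext_of_integral_smooth {μ ν : Measure (Rn n)} [IsFiniteMeasure μ] [IsFiniteMeasure ν]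
    (h : ∀ g : Rn n → ℝ, ContDiff ℝ ∞ g → HasCompactSupport g → ∫ x, g x ∂μ = ∫ x, g x ∂ν) :
    μ = ν := by
  have hopen : ∀ U : Set (Rn n), IsOpen U → μ U = ν U := by
    intro U hU
    obtain ⟨f, hfs, hf, hfr⟩ := hU.exists_contDiff_support_eq (n := ⊤)
    let κ : ℕ → ContDiffBump (0 : Rn n) := fun k => ⟨k + 1, k + 2, by positivity, by linarith⟩
    set F : ℕ → Rn n → ℝ := fun k x => κ k x * Real.smoothTransition (k * f x) with hF
    have hFs : ∀ k, ContDiff ℝ ∞ (F k) := fun k =>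
      (κ k).contDiff.mul ((Real.smoothTransition.contDiff (n := ⊤)).comp (contDiff_const.mul hf))
    have hFc : ∀ k, HasCompactSupport (F k) := fun k => (κ k).hasCompactSupport.mul_right
    have hF1 : ∀ k x, ‖F k x‖ ≤ 1 := fun k x => by
      rw [Real.norm_of_nonneg (mul_nonneg (κ k).nonneg (Real.smoothTransition.nonneg _))]
      exact mul_le_one₀ (κ k).le_one (Real.smoothTransition.nonneg _)
        (Real.smoothTransition.le_one _)
    have hlim : ∀ x, Tendsto (fun k => F k x) atTop (𝓝 (U.indicator 1 x)) := by
      intro x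
      by_cases hx : x ∈ U
      · have hfx : 0 < f x := by
          have h1 : f x ≠ 0 := by rw [← hfs] at hx; exact hx
          exact lt_of_le_of_ne (hfr (mem_range_self x)).1 h1.symm
        rw [indicator_of_mem hx]
        apply tendsto_const_nhds.congr'
        obtain ⟨k₀, hk₀⟩ := exists_nat_ge (max ‖x‖ (f x)⁻¹)
        filter_upwards [eventually_ge_atTop k₀] with k hk
        have hk' : (k₀ : ℝ) ≤ k := by exact_mod_cast hk
        have h1 : κ k x = 1 := (κ k).one_of_mem_closedBall (by
          have := (le_max_left _ _).trans hk₀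
          rw [mem_closedBall_zero_iff]
          change ‖x‖ ≤ (k : ℝ) + 1
          linarith)
        have h2 : Real.smoothTransition (k * f x) = 1 := by
          apply Real.smoothTransition.one_of_one_le
          have h3 : (f x)⁻¹ ≤ k := ((le_max_right _ _).trans hk₀).trans hk'
          calc (1 : ℝ) = (f x)⁻¹ * f x := (inv_mul_cancel₀ hfx.ne').symm
            _ ≤ k * f x := by gcongr
        simp [hF, h1, h2]
      · have hfx : f x = 0 := by
          by_contra h1
          exact hx (hfs ▸ h1)
        rw [indicator_of_notMem hx]
        apply tendsto_const_nhds.congr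
        intro k
        simp [hF, hfx]
    have hI : ∀ (m : Measure (Rn n)) [IsFiniteMeasure m],
        Tendsto (fun k => ∫ x, F k x ∂m) atTop (𝓝 (m.real U)) := by
      intro m _
      rw [← integral_indicator_one hU.measurableSet]
      exact tendsto_integral_of_dominated_convergence (fun _ => (1 : ℝ))
        (fun k => (hFs k).continuous.aestronglyMeasurable) (integrable_const _)
        (fun k => ae_of_all _ (hF1 k)) (ae_of_all _ hlim)
    have h1 := hI μ
    simp_rw [h (F _) (hFs _) (hFc _)] at h1
    exact (measureReal_eq_measureReal_iff).1 (tendsto_nhds_unique h1 (hI ν))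
  exact ext_of_generate_finite _ BorelSpace.measurable_eq isPiSystem_isOpen
    (fun U hU => hopen U hU) (hopen univ isOpen_univ)

theorem WeakSolutionPair.eq (hM : WeakSolutionPair T b M₁ M₂)
    (hb : LocalOsgoodField b G w) (hG : GrowthModulus G) (hw : OsgoodModulus w) (hT : 0 < T)
    (hb0 : ∀ t x, t ∉ Ioo 0 T → b t x = 0) : M₁ = M₂ := by
  have key : ∀ (t : ℝ) (g : Rn n → ℝ), ContDiff ℝ ∞ g → HasCompactSupport g →
      integralDiff M₁ M₂ ({p | p.1 ≤ t}.indicator fun p => g p.2) = 0 := by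
    intro t g hg hgc
    rcases lt_or_ge t 0 with ht | ht
    · have h : ({p : ℝ × Rn n | p.1 ≤ t}.indicator fun p => g p.2) =ᵐ[M₁ + M₂]
          fun _ => (0 : ℝ) := by
        filter_upwards [hM.supp] with p hp
        refine indicator_of_notMem (fun h => ?_) _
        exact absurd hp.1 (not_lt.2 (le_trans (show p.1 ≤ t from h) ht.le))
      rw [integralDiff_congr h]
      simp [integralDiff]
    rcases lt_or_ge t T with htT | htT
    · exact hM.integralDiff_indicator_eq_zero hb hG hw hb0 ⟨ht, htT⟩ hg hgc
    obtain ⟨N, hN⟩ := hgc.exists_bound_of_continuous hg.continuous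
    have hgm : AEStronglyMeasurable (fun p : ℝ × Rn n => g p.2) (M₁ + M₂) :=
      (hg.continuous.comp continuous_snd).aestronglyMeasurable
    have hlim : Tendsto (fun k : ℕ => integralDiff M₁ M₂
        ({p | p.1 ≤ T - T / (k + 1)}.indicator fun p => g p.2)) atTop
        (𝓝 (integralDiff M₁ M₂ ({p | p.1 ≤ t}.indicator fun p => g p.2))) := by
      refine tendsto_integralDiff (fun _ => N)
        (Eventually.of_forall fun k => hgm.indicator (measurableSet_fst_le _))
        (Eventually.of_forall fun k => ae_of_all _ fun p =>
          (norm_indicator_le_norm_self _ _).trans (hN _)) (integrable_const _) ?_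
      filter_upwards [hM.supp] with p hp
      rw [indicator_of_mem (show p ∈ {p : ℝ × Rn n | p.1 ≤ t} from hp.2.le.trans htT)]
      apply tendsto_const_nhds.congr'
      have h1 : Tendsto (fun k : ℕ => T - T / ((k : ℝ) + 1)) atTop (𝓝 T) := by
        have := (tendsto_one_div_add_atTop_nhds_zero_nat (𝕜 := ℝ)).const_mul T |>.const_sub T
        simpa [div_eq_mul_inv] using this
      filter_upwards [h1.eventually (lt_mem_nhds hp.2)] with k hk
      rw [indicator_of_mem (show p ∈ {p : ℝ × Rn n | p.1 ≤ _} from hk.le)]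
    refine tendsto_nhds_unique hlim (tendsto_const_nhds.congr fun k => ?_)
    refine (hM.integralDiff_indicator_eq_zero hb hG hw hb0 ⟨?_, ?_⟩ hg hgc).symm
    · rw [sub_nonneg, div_le_iff₀ (by positivity)]
      nlinarith [(Nat.cast_nonneg k : (0 : ℝ) ≤ k)]
    · have : 0 < T / ((k : ℝ) + 1) := by positivity
      linarith
  have hslice : ∀ t (A : Set (Rn n)), MeasurableSet A → M₁ (Iic t ×ˢ A) = M₂ (Iic t ×ˢ A) := by
    intro t A hA
    have hle := measurableSet_fst_le (n := n) t
    have h := ext_of_integral_smooth (μ := (M₁.restrict {p | p.1 ≤ t}).map Prod.snd)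
      (ν := (M₂.restrict {p | p.1 ≤ t}).map Prod.snd) (fun g hg hgc => by
        rw [integral_map measurable_snd.aemeasurable hg.continuous.aestronglyMeasurable,
          integral_map measurable_snd.aemeasurable hg.continuous.aestronglyMeasurable,
          ← integral_indicator hle, ← integral_indicator hle]
        exact sub_eq_zero.1 (key t g hg hgc))
    have h1 := congrArg (fun m => m A) h
    simp only [Measure.map_apply measurable_snd hA,
      Measure.restrict_apply (measurable_snd hA)] at h1
    have e : Iic t ×ˢ A = Prod.snd ⁻¹' A ∩ {p : ℝ × Rn n | p.1 ≤ t} := by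
      ext p; simp [and_comm]
    rw [e]; exact h1
  refine Measure.ext_prod fun {S A} hS hA => ?_
  have h := Measure.ext_of_Iic ((M₁.restrict (Prod.snd ⁻¹' A)).map Prod.fst)
    ((M₂.restrict (Prod.snd ⁻¹' A)).map Prod.fst) (fun t => by
      rw [Measure.map_apply measurable_fst measurableSet_Iic,
        Measure.map_apply measurable_fst measurableSet_Iic,
        Measure.restrict_apply (measurable_fst measurableSet_Iic),
        Measure.restrict_apply (measurable_fst measurableSet_Iic), ← Set.prod_eq]
      exact hslice t A hA)
  have h1 := congrArg (fun m => m S) h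
  simp only [Measure.map_apply measurable_fst hS,
    Measure.restrict_apply (measurable_fst hS), ← Set.prod_eq] at h1
  exact h1

end uniqueness

end

section

section signedMeasure

variable {X : Type*} [MeasurableSpace X]

theorem SignedMeasure.integral_eq_sub (s : SignedMeasure X) {f : X → ℝ}
    (hf₁ : Integrable f s.toJordanDecomposition.posPart)
    (hf₂ : Integrable f s.toJordanDecomposition.negPart) :
    ∫ᵛ x, f x ∂•s = ∫ x, f x ∂s.toJordanDecomposition.posPart -
      ∫ x, f x ∂s.toJordanDecomposition.negPart := by
  have hflip : (ContinuousLinearMap.lsmul ℝ ℝ : ℝ →L[ℝ] ℝ →L[ℝ] ℝ) =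
      (ContinuousLinearMap.lsmul ℝ ℝ : ℝ →L[ℝ] ℝ →L[ℝ] ℝ).flip := by
    ext; simp
  have hs := s.toSignedMeasure_toJordanDecomposition
  conv_lhs => rw [← hs, hflip]
  rw [JordanDecomposition.toSignedMeasure, VectorMeasure.integral_sub_vectorMeasure,
    VectorMeasure.integral_toSignedMeasure, VectorMeasure.integral_toSignedMeasure]
  · simpa [VectorMeasure.Integrable] using hf₁
  · simpa [VectorMeasure.Integrable] using hf₂

theorem exists_countable_setAlgebra (X : Type*) [mX : MeasurableSpace X]
    [MeasurableSpace.CountablyGenerated X] :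
    ∃ 𝒜 : Set (Set X), IsSetAlgebra 𝒜 ∧ 𝒜.Countable ∧ mX = MeasurableSpace.generateFrom 𝒜 :=
  ⟨generateSetAlgebra (MeasurableSpace.countableGeneratingSet X), isSetAlgebra_generateSetAlgebra,
    countable_generateSetAlgebra MeasurableSpace.countable_countableGeneratingSet, by
    rw [generateFrom_generateSetAlgebra_eq, MeasurableSpace.generateFrom_countableGeneratingSet]⟩

theorem SignedMeasure.posPart_eq_iSup {𝒜 : Set (Set X)} (h𝒜 : IsSetAlgebra 𝒜)
    (hgen : ‹MeasurableSpace X› = MeasurableSpace.generateFrom 𝒜) (s : SignedMeasure X) {A : Set X}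
    (hA : A ∈ 𝒜) :
    s.toJordanDecomposition.posPart A = ⨆ E ∈ 𝒜, ENNReal.ofReal (s (E ∩ A)) := by
  have hmeas : ∀ E ∈ 𝒜, MeasurableSet E := fun E hE =>
    hgen ▸ MeasurableSpace.measurableSet_generateFrom hE
  set P := s.toJordanDecomposition.posPart with hP
  set N := s.toJordanDecomposition.negPart with hN
  have hsub : ∀ E, MeasurableSet E → s E = P.real E - N.real E := fun E hE =>
    s.apply_eq_posPart_real_sub_negPart_real hE
  apply le_antisymm
  · obtain ⟨S, hS, hS₁, hS₂, hPS, hNS⟩ := s.toJordanDecomposition_spec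
    have hPA : P.real A = s (S ∩ A) := by
      rw [measureReal_def, hP, hPS, SignedMeasure.toMeasureOfZeroLE_apply s hS₁ hS (hmeas A hA)]
      rfl
    refine ENNReal.le_of_forall_pos_le_add fun ε hε _ => ?_
    obtain ⟨E, hE, hEε⟩ := (Measure.MeasureDense.of_generateFrom_isSetAlgebra_finite
      (P + N) h𝒜 hgen).approx S hS (measure_ne_top _ _) ε (by exact_mod_cast hε)
    have hEm := hmeas E hE
    have h1 : s (S ∩ A) ≤ s (E ∩ A) + ε := by
      rw [hsub _ (hS.inter (hmeas A hA)), hsub _ (hEm.inter (hmeas A hA))]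
      have h2 : (P + N).real (symmDiff S E) ≤ ε := by
        rw [measureReal_def]
        exact ENNReal.toReal_le_of_le_ofReal (by positivity) hEε.le
      rw [measureReal_add_apply] at h2
      have h3 : P.real (S ∩ A) ≤ P.real (E ∩ A) + P.real (symmDiff S E) := by
        refine (measureReal_mono ?_).trans (measureReal_union_le _ _)
        intro x hx
        by_cases hxE : x ∈ E
        · exact Or.inl ⟨hxE, hx.2⟩
        · exact Or.inr (Or.inl ⟨hx.1, hxE⟩)
      have h4 : N.real (E ∩ A) ≤ N.real (S ∩ A) + N.real (symmDiff S E) := by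
        refine (measureReal_mono ?_).trans (measureReal_union_le _ _)
        intro x hx
        by_cases hxS : x ∈ S
        · exact Or.inl ⟨hxS, hx.2⟩
        · exact Or.inr (Or.inr ⟨hx.1, hxS⟩)
      linarith
    calc P A = ENNReal.ofReal (P.real A) := (ofReal_measureReal).symm
      _ ≤ ENNReal.ofReal (s (E ∩ A) + ε) := ENNReal.ofReal_le_ofReal (hPA ▸ h1)
      _ ≤ ENNReal.ofReal (s (E ∩ A)) + ENNReal.ofReal ε := ENNReal.ofReal_add_le
      _ ≤ _ := by
        rw [ENNReal.ofReal_coe_nnreal]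
        gcongr
        exact le_iSup₂ (f := fun E (_ : E ∈ 𝒜) => ENNReal.ofReal (s (E ∩ A))) E hE
  · refine iSup₂_le fun E hE => ?_
    rw [hsub _ ((hmeas E hE).inter (hmeas A hA))]
    calc ENNReal.ofReal (P.real (E ∩ A) - N.real (E ∩ A)) ≤ ENNReal.ofReal (P.real (E ∩ A)) :=
          ENNReal.ofReal_le_ofReal (by linarith [measureReal_nonneg (μ := N) (s := E ∩ A)])
      _ = P (E ∩ A) := ofReal_measureReal
      _ ≤ P A := measure_mono inter_subset_right

theorem SignedMeasure.measurable_posPart {Y : Type*} [MeasurableSpace Y] {𝒜 : Set (Set X)}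
    (h𝒜 : IsSetAlgebra 𝒜) (h𝒜c : 𝒜.Countable)
    (hgen : ‹MeasurableSpace X› = MeasurableSpace.generateFrom 𝒜) {ρ : Y → SignedMeasure X}
    (hρ : ∀ A ∈ 𝒜, Measurable fun t => ρ t A) :
    Measurable fun t => (ρ t).toJordanDecomposition.posPart := by
  have hbasic : ∀ A ∈ 𝒜, Measurable fun t => (ρ t).toJordanDecomposition.posPart A := by
    intro A hA
    simp_rw [SignedMeasure.posPart_eq_iSup h𝒜 hgen _ hA]
    exact Measurable.biSup 𝒜 h𝒜c fun E hE => (hρ _ (h𝒜.inter_mem hE hA)).ennreal_ofReal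
  have : ∀ t, IsFiniteMeasure (ρ t).toJordanDecomposition.posPart := fun t => inferInstance
  exact Measurable.measure_of_isPiSystem hgen (fun A hA B hB _ => h𝒜.inter_mem hA hB) hbasic
    (hbasic _ h𝒜.univ_mem)

end signedMeasure

section slices

variable {n : ℕ} {T : ℝ}

/-- The measure `κ_t ⊗ dt` on `(0, T) × ℝⁿ`. -/
noncomputable def sliceMeasure {n : ℕ} (T : ℝ) (κ : ℝ → Measure (Rn n)) : Measure (ℝ × Rn n) :=
  (volume.restrict (Ioo 0 T)).bind fun t => (κ t).map (Prod.mk t)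

variable {κ : ℝ → Measure (Rn n)} [∀ t, IsFiniteMeasure (κ t)]

theorem measurable_map_prodMk (hκ : Measurable κ) : Measurable fun t => (κ t).map (Prod.mk t) := by
  have : ∀ t, IsFiniteMeasure ((κ t).map (Prod.mk t)) := fun t => inferInstance
  have happ : ∀ (S : Set ℝ) (A : Set (Rn n)), MeasurableSet S → MeasurableSet A →
      Measurable fun t => (κ t).map (Prod.mk t) (S ×ˢ A) := by
    intro S A hS hA
    have : (fun t => (κ t).map (Prod.mk t) (S ×ˢ A)) = S.indicator fun t => κ t A := by
      ext t
      rw [Measure.map_apply measurable_prodMk_left (hS.prod hA)]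
      by_cases ht : t ∈ S
      · rw [mk_preimage_prod_right ht, indicator_of_mem ht]
      · rw [mk_preimage_prod_right_eq_empty ht, indicator_of_notMem ht, measure_empty]
    rw [this]
    exact (Measure.measurable_coe hA |>.comp hκ).indicator hS
  refine Measurable.measure_of_isPiSystem generateFrom_prod.symm isPiSystem_prod ?_ ?_
  · rintro _ ⟨S, hS, A, hA, rfl⟩
    exact happ S A hS hA
  · rw [← univ_prod_univ]
    exact happ _ _ MeasurableSet.univ MeasurableSet.univ

theorem lintegral_sliceMeasure (hκ : Measurable κ) {f : ℝ × Rn n → ENNReal} (hf : Measurable f) :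
    ∫⁻ p, f p ∂sliceMeasure T κ = ∫⁻ t in Ioo 0 T, ∫⁻ x, f (t, x) ∂κ t := by
  rw [sliceMeasure, Measure.lintegral_bind (measurable_map_prodMk hκ).aemeasurable hf.aemeasurable]
  exact lintegral_congr fun t => lintegral_map hf measurable_prodMk_left

theorem measurable_lintegral_slice (hκ : Measurable κ) {f : ℝ × Rn n → ENNReal}
    (hf : Measurable f) : Measurable fun t => ∫⁻ x, f (t, x) ∂κ t := by
  have : (fun t => ∫⁻ x, f (t, x) ∂κ t) = fun t => ∫⁻ p, f p ∂(κ t).map (Prod.mk t) :=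
    funext fun t => (lintegral_map hf measurable_prodMk_left).symm
  rw [this]
  exact (Measure.measurable_lintegral hf).comp (measurable_map_prodMk hκ)

theorem sliceMeasure_apply (hκ : Measurable κ) {S : Set (ℝ × Rn n)} (hS : MeasurableSet S) :
    sliceMeasure T κ S = ∫⁻ t in Ioo 0 T, κ t (Prod.mk t ⁻¹' S) := by
  rw [← lintegral_indicator_one hS, lintegral_sliceMeasure hκ (measurable_one.indicator hS)]
  refine lintegral_congr fun t => ?_
  rw [← lintegral_indicator_one (measurable_prodMk_left hS)]
  rfl

theorem isFiniteMeasure_sliceMeasure (hκ : Measurable κ)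
    (hκT : ∫⁻ t in Ioo 0 T, κ t univ < ⊤) : IsFiniteMeasure (sliceMeasure T κ) :=
  ⟨by rw [sliceMeasure_apply hκ MeasurableSet.univ]; simpa using hκT⟩

theorem map_fst_sliceMeasure_ac (hκ : Measurable κ) :
    (sliceMeasure T κ).map Prod.fst ≪ volume := by
  refine Measure.AbsolutelyContinuous.mk fun S hS h0 => ?_
  rw [Measure.map_apply measurable_fst hS, sliceMeasure_apply hκ (measurable_fst hS)]
  have h1 : ∀ᵐ t ∂(volume.restrict (Ioo 0 T)), t ∉ S :=
    ae_restrict_of_ae (measure_eq_zero_iff_ae_notMem.1 h0)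
  rw [lintegral_congr_ae (g := fun _ => 0)]
  · simp
  · filter_upwards [h1] with t ht
    have : Prod.mk t ⁻¹' (Prod.fst ⁻¹' S) = (∅ : Set (Rn n)) := by
      ext x; simp [ht]
    rw [this, measure_empty]

theorem ae_sliceMeasure (hκ : Measurable κ) : ∀ᵐ p ∂sliceMeasure T κ, p.1 ∈ Ioo 0 T := by
  have hms : MeasurableSet {p : ℝ × Rn n | p.1 ∈ Ioo 0 T} := measurable_fst measurableSet_Ioo
  rw [ae_iff, show {p : ℝ × Rn n | ¬ p.1 ∈ Ioo 0 T} = {p : ℝ × Rn n | p.1 ∈ Ioo 0 T}ᶜ from rfl,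
    sliceMeasure_apply hκ hms.compl, lintegral_congr_ae (g := fun _ => 0)]
  · simp
  · filter_upwards [ae_restrict_mem measurableSet_Ioo] with t ht
    have : Prod.mk t ⁻¹' {p : ℝ × Rn n | p.1 ∈ Ioo 0 T}ᶜ = (∅ : Set (Rn n)) := by
      ext x; simp [ht.1, ht.2]
    rw [this, measure_empty]

theorem integral_sliceMeasure_of_nonneg (hκ : Measurable κ)
    (hκT : ∫⁻ t in Ioo 0 T, κ t univ < ⊤) {f : ℝ × Rn n → ℝ} (hf : Measurable f)
    (hf0 : ∀ p, 0 ≤ f p) {N : ℝ} (hN : ∀ p, f p ≤ N) :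
    IntegrableOn (fun t => ∫ x, f (t, x) ∂κ t) (Ioo 0 T) ∧
      ∫ p, f p ∂sliceMeasure T κ = ∫ t in Ioo 0 T, ∫ x, f (t, x) ∂κ t := by
  have hslice : ∀ t, ∫ x, f (t, x) ∂κ t = (∫⁻ x, ENNReal.ofReal (f (t, x)) ∂κ t).toReal :=
    fun t => integral_eq_lintegral_of_nonneg_ae (ae_of_all _ fun x => hf0 _)
      (hf.comp measurable_prodMk_left).aestronglyMeasurable
  have hm := measurable_lintegral_slice hκ hf.ennreal_ofReal
  have hle : ∀ t, ∫⁻ x, ENNReal.ofReal (f (t, x)) ∂κ t ≤ ENNReal.ofReal N * κ t univ := fun t => by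
    rw [← lintegral_const]
    exact lintegral_mono fun x => ENNReal.ofReal_le_ofReal (hN _)
  have hfin : ∫⁻ t in Ioo 0 T, ∫⁻ x, ENNReal.ofReal (f (t, x)) ∂κ t < ⊤ := by
    refine (lintegral_mono hle).trans_lt ?_
    rw [lintegral_const_mul' _ _ ENNReal.ofReal_ne_top]
    exact ENNReal.mul_lt_top ENNReal.ofReal_lt_top hκT
  constructor
  · simp_rw [hslice]
    exact integrable_toReal_of_lintegral_ne_top hm.aemeasurable hfin.ne
  · simp_rw [hslice]
    rw [integral_toReal hm.aemeasurable (ae_of_all _ fun t => (hle t).trans_lt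
      (ENNReal.mul_lt_top ENNReal.ofReal_lt_top (measure_lt_top _ _))),
      ← lintegral_sliceMeasure hκ hf.ennreal_ofReal]
    exact integral_eq_lintegral_of_nonneg_ae (ae_of_all _ hf0) hf.aestronglyMeasurable

theorem integral_sliceMeasure (hκ : Measurable κ)
    (hκT : ∫⁻ t in Ioo 0 T, κ t univ < ⊤) {f : ℝ × Rn n → ℝ} (hf : Measurable f) {N : ℝ}
    (hN : ∀ p, |f p| ≤ N) :
    IntegrableOn (fun t => ∫ x, f (t, x) ∂κ t) (Ioo 0 T) ∧
      ∫ p, f p ∂sliceMeasure T κ = ∫ t in Ioo 0 T, ∫ x, f (t, x) ∂κ t := by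
  have hN0 : 0 ≤ N := (abs_nonneg _).trans (hN 0)
  have := isFiniteMeasure_sliceMeasure hκ hκT
  obtain ⟨i₁, e₁⟩ := integral_sliceMeasure_of_nonneg hκ hκT (f := fun p => f p + N)
    (hf.add measurable_const) (fun p => by linarith [(abs_le.1 (hN p)).1]) (N := N + N)
    (fun p => by linarith [(abs_le.1 (hN p)).2])
  obtain ⟨i₂, e₂⟩ := integral_sliceMeasure_of_nonneg hκ hκT (f := fun _ => N)
    measurable_const (fun p => hN0) (fun _ => le_rfl)
  have hfi : ∀ (t : ℝ), Integrable (fun x => f (t, x)) (κ t) := fun t =>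
    Integrable.of_bound (hf.comp measurable_prodMk_left).aestronglyMeasurable N
      (ae_of_all _ fun x => hN _)
  have hfM : Integrable f (sliceMeasure T κ) :=
    Integrable.of_bound hf.aestronglyMeasurable N (ae_of_all _ fun x => hN _)
  have hsl : (fun t => ∫ x, f (t, x) ∂κ t) =
      fun t => (∫ x, (f (t, x) + N) ∂κ t) - ∫ _, N ∂κ t := by
    ext t
    rw [integral_add (hfi t) (integrable_const _)]
    ring
  rw [hsl]
  refine ⟨i₁.sub i₂, ?_⟩
  rw [integral_sub i₁ i₂, ← e₁, ← e₂, integral_add hfM (integrable_const _)]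
  ring

end slices

/-- A family of signed measures in `L¹(0, T; 𝓜)` is represented by two finite measures on
space-time. -/
theorem MemL1Measures.exists_measures {n : ℕ} {T : ℝ} {ρ : ℝ → SignedMeasure (Rn n)}
    (hρ : MemL1Measures T ρ) :
    ∃ P N : Measure (ℝ × Rn n), IsFiniteMeasure P ∧ IsFiniteMeasure N ∧
      (P + N).map Prod.fst ≪ volume ∧ (∀ᵐ p ∂(P + N), p.1 ∈ Ioo 0 T) ∧
      ∀ f : ℝ × Rn n → ℝ, Measurable f → ∀ C, (∀ p, |f p| ≤ C) →
        IntegrableOn (fun t => ∫ᵛ x, f (t, x) ∂•(ρ t)) (Ioo 0 T) ∧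
        ∫ t in Ioo 0 T, ∫ᵛ x, f (t, x) ∂•(ρ t) = ∫ p, f p ∂P - ∫ p, f p ∂N := by
  classical
  obtain ⟨𝒜, h𝒜, h𝒜c, hgen⟩ := exists_countable_setAlgebra (Rn n)
  have hmeas : ∀ E ∈ 𝒜, MeasurableSet E := fun E hE =>
    hgen.ge E (MeasurableSpace.measurableSet_generateFrom hE)
  have hae : ∀ᵐ t ∂(volume.restrict (Ioo 0 T)), ∀ A, ∀ hA : A ∈ 𝒜,
      ρ t A = (hρ.1 A (hmeas A hA)).mk _ t := by
    rw [ae_ball_iff h𝒜c]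
    exact fun A hA => (hρ.1 A (hmeas A hA)).ae_eq_mk
  obtain ⟨Z, hZ, hZm, hZ0⟩ := exists_measurable_superset_of_null (ae_iff.1 hae)
  set ρ' : ℝ → SignedMeasure (Rn n) := fun t => if t ∈ Z then 0 else ρ t with hρ'
  have hρ'm : ∀ A ∈ 𝒜, Measurable fun t => ρ' t A := by
    intro A hA
    have : (fun t => ρ' t A) = Zᶜ.indicator ((hρ.1 A (hmeas A hA)).mk _) := by
      ext t
      by_cases ht : t ∈ Z
      · simp [hρ', ht]
      · have h1 : ∀ A, ∀ hA : A ∈ 𝒜, ρ t A = (hρ.1 A (hmeas A hA)).mk _ t := by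
          by_contra h
          exact ht (hZ h)
        simp [hρ', ht, h1 A hA]
    rw [this]
    exact (hρ.1 A (hmeas A hA)).measurable_mk.indicator hZm.compl
  have hρρ' : ∀ᵐ t ∂(volume.restrict (Ioo 0 T)), ρ' t = ρ t := by
    filter_upwards [measure_eq_zero_iff_ae_notMem.1 hZ0] with t ht
    simp [hρ', ht]
  set κ₁ : ℝ → Measure (Rn n) := fun t => (ρ' t).toJordanDecomposition.posPart with hκ₁
  set κ₂ : ℝ → Measure (Rn n) := fun t => (ρ' t).toJordanDecomposition.negPart with hκ₂
  have m₁ : Measurable κ₁ := SignedMeasure.measurable_posPart h𝒜 h𝒜c hgen hρ'm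
  have m₂ : Measurable κ₂ := by
    have h := SignedMeasure.measurable_posPart h𝒜 h𝒜c hgen (ρ := fun t => -ρ' t)
      (fun A hA => by simpa using hρ'm A hA)
    simpa [SignedMeasure.toJordanDecomposition_neg] using h
  have i₁ : ∀ t, IsFiniteMeasure (κ₁ t) := fun t => by simp only [hκ₁]; infer_instance
  have i₂ : ∀ t, IsFiniteMeasure (κ₂ t) := fun t => by simp only [hκ₂]; infer_instance
  have hvar : ∀ᵐ t ∂(volume.restrict (Ioo 0 T)), κ₁ t univ + κ₂ t univ = (ρ t).variation univ := by
    filter_upwards [hρρ'] with t ht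
    rw [← ht, ← SignedMeasure.totalVariation_eq_variation]
    rfl
  have f₁ : ∫⁻ t in Ioo 0 T, κ₁ t univ < ⊤ :=
    (lintegral_mono_ae (hvar.mono fun t ht => ht ▸ le_self_add)).trans_lt hρ.2
  have f₂ : ∫⁻ t in Ioo 0 T, κ₂ t univ < ⊤ :=
    (lintegral_mono_ae (hvar.mono fun t ht => ht ▸ le_add_self)).trans_lt hρ.2
  refine ⟨sliceMeasure T κ₁, sliceMeasure T κ₂, isFiniteMeasure_sliceMeasure m₁ f₁,
    isFiniteMeasure_sliceMeasure m₂ f₂, ?_, ?_, ?_⟩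
  · rw [Measure.map_add _ _ measurable_fst]
    exact Measure.AbsolutelyContinuous.add_left (map_fst_sliceMeasure_ac m₁)
      (map_fst_sliceMeasure_ac m₂)
  · exact ae_add_measure_iff.2 ⟨ae_sliceMeasure m₁, ae_sliceMeasure m₂⟩
  · intro f hf C hC
    obtain ⟨j₁, e₁⟩ := integral_sliceMeasure m₁ f₁ hf hC
    obtain ⟨j₂, e₂⟩ := integral_sliceMeasure m₂ f₂ hf hC
    have heq : (fun t => (∫ x, f (t, x) ∂κ₁ t) - ∫ x, f (t, x) ∂κ₂ t)
        =ᵐ[volume.restrict (Ioo 0 T)] fun t => ∫ᵛ x, f (t, x) ∂•(ρ t) := by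
      filter_upwards [hρρ'] with t ht
      rw [← ht]
      have hb : ∀ (m : Measure (Rn n)) [IsFiniteMeasure m], Integrable (fun x => f (t, x)) m :=
        fun m _ => Integrable.of_bound (hf.comp measurable_prodMk_left).aestronglyMeasurable C
          (ae_of_all _ fun x => hC _)
      exact (SignedMeasure.integral_eq_sub _ (hb _) (hb _)).symm
    refine ⟨(j₁.sub j₂).congr heq, ?_⟩
    rw [← integral_congr_ae heq, integral_sub j₁ j₂, e₁, e₂]

/-- Two families of signed measures with the same space-time integrals agree almost everywhere. -/
theorem MemL1Measures.ae_eq {n : ℕ} {T : ℝ} {ρ σ : ℝ → SignedMeasure (Rn n)}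
    (hρ : MemL1Measures T ρ) (hσ : MemL1Measures T σ)
    (h : ∀ f : ℝ × Rn n → ℝ, Measurable f → (∀ p, |f p| ≤ 1) →
      ∫ t in Ioo 0 T, ∫ᵛ x, f (t, x) ∂•(ρ t) = ∫ t in Ioo 0 T, ∫ᵛ x, f (t, x) ∂•(σ t)) :
    ∀ᵐ t ∂(volume.restrict (Ioo 0 T)), ρ t = σ t := by
  obtain ⟨_, _, _, _, _, _, hρf⟩ := hρ.exists_measures
  obtain ⟨_, _, _, _, _, _, hσf⟩ := hσ.exists_measures
  obtain ⟨𝒜, h𝒜, h𝒜c, hgen⟩ := exists_countable_setAlgebra (Rn n)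
  have hmeas : ∀ E ∈ 𝒜, MeasurableSet E := fun E hE =>
    hgen.ge E (MeasurableSpace.measurableSet_generateFrom hE)
  have hind : ∀ (s : SignedMeasure (Rn n)) {A : Set (Rn n)}, MeasurableSet A →
      ∫ᵛ x, A.indicator (fun _ => (1 : ℝ)) x ∂•s = s A := by
    intro s A hA
    have hb : ∀ (m : Measure (Rn n)) [IsFiniteMeasure m],
        Integrable (A.indicator fun _ => (1 : ℝ)) m :=
      fun m _ => (integrable_const _).indicator hA
    rw [SignedMeasure.integral_eq_sub _ (hb _) (hb _), integral_indicator_const _ hA,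
      integral_indicator_const _ hA, s.apply_eq_posPart_real_sub_negPart_real hA]
    simp
  have key : ∀ A, MeasurableSet A → ∀ᵐ t ∂(volume.restrict (Ioo 0 T)), ρ t A = σ t A := by
    intro A hA
    have hfm : ∀ S : Set ℝ, MeasurableSet S →
        Measurable fun p : ℝ × Rn n =>
          S.indicator (fun _ => A.indicator (fun _ => (1 : ℝ)) p.2) p.1 :=
      fun S hS => by
        have : (fun p : ℝ × Rn n => S.indicator (fun _ => A.indicator (fun _ => (1 : ℝ)) p.2) p.1) =
            (S ×ˢ A).indicator fun _ => (1 : ℝ) := by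
          ext p
          by_cases h1 : p.1 ∈ S <;> by_cases h2 : p.2 ∈ A <;> simp [indicator, h1, h2]
        rw [this]
        exact measurable_const.indicator (hS.prod hA)
    have hfb : ∀ (S : Set ℝ) (p : ℝ × Rn n),
        |S.indicator (fun _ => A.indicator (fun _ => (1 : ℝ)) p.2) p.1| ≤ 1 := fun S p => by
      by_cases h1 : p.1 ∈ S <;> by_cases h2 : p.2 ∈ A <;> simp [indicator, h1, h2]
    have hsl : ∀ (τ : ℝ → SignedMeasure (Rn n)) (S : Set ℝ) t,
        ∫ᵛ x, S.indicator (fun _ => A.indicator (fun _ => (1 : ℝ)) x) t ∂•(τ t) =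
          S.indicator (fun t => τ t A) t := by
      intro τ S t
      by_cases ht : t ∈ S
      · simp only [indicator_of_mem ht]
        exact hind _ hA
      · simp only [indicator_of_notMem ht]
        exact VectorMeasure.integral_zero
    have hiu : ∀ (τ : ℝ → SignedMeasure (Rn n)), (∀ f : ℝ × Rn n → ℝ, Measurable f → ∀ C,
        (∀ p, |f p| ≤ C) → IntegrableOn (fun t => ∫ᵛ x, f (t, x) ∂•(τ t)) (Ioo 0 T)) →
        IntegrableOn (fun t => τ t A) (Ioo 0 T) := by
      intro τ hτ
      have := hτ _ (hfm univ MeasurableSet.univ) 1 (hfb univ)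
      simp only [hsl] at this
      simpa using this
    refine Integrable.ae_eq_of_forall_setIntegral_eq _ _ (hiu ρ fun f hf C hC => (hρf f hf C hC).1)
      (hiu σ fun f hf C hC => (hσf f hf C hC).1) fun S hS _ => ?_
    have h1 := h _ (hfm S hS) (hfb S)
    simp only [hsl] at h1
    rwa [integral_indicator hS, integral_indicator hS] at h1
  have hall : ∀ᵐ t ∂(volume.restrict (Ioo 0 T)), ∀ A ∈ 𝒜, ρ t A = σ t A := by
    rw [ae_ball_iff h𝒜c]
    exact fun A hA => key A (hmeas A hA)
  filter_upwards [hall] with t ht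
  ext A hA
  induction A, hA using MeasurableSpace.induction_on_inter hgen
    (fun A hA B hB _ => h𝒜.inter_mem hA hB) with
  | empty => simp
  | basic A hA => exact ht A hA
  | compl A hA ih =>
    have h1 := VectorMeasure.of_add_of_sdiff (v := ρ t) hA MeasurableSet.univ (subset_univ A)
    have h2 := VectorMeasure.of_add_of_sdiff (v := σ t) hA MeasurableSet.univ (subset_univ A)
    rw [← compl_eq_univ_sdiff, ht univ h𝒜.univ_mem, ← h2, ih, ← compl_eq_univ_sdiff] at h1
    linarith
  | iUnion f hfd hfm ih =>
    rw [VectorMeasure.of_disjoint_iUnion hfm hfd, VectorMeasure.of_disjoint_iUnion hfm hfd]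
    exact tsum_congr ih

end

section

/-- Adding the identity to an Osgood modulus. -/
theorem osgoodModulus_add_id {v : ℝ → ℝ} (hc : ContinuousOn v (Ici 0)) (hm : MonotoneOn v (Ici 0))
    (hn : ∀ s ∈ Ici (0 : ℝ), 0 ≤ v s)
    (hdiv : ∃ r : ℝ, 0 < r ∧ ∫⁻ s in Ioo 0 r, (ENNReal.ofReal (v s))⁻¹ = (⊤ : ENNReal)) :
    OsgoodModulus fun s => v (max s 0) + max s 0 := by
  have hmax : ∀ s : ℝ, max s 0 ∈ Ici (0 : ℝ) := fun s => mem_Ici.2 (le_max_right _ _)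
  set w : ℝ → ℝ := fun s => v (max s 0) + max s 0 with hw
  have hcont : Continuous w := by
    have h1 : Continuous fun s : ℝ => max s 0 := by fun_prop
    exact (hc.comp_continuous h1 hmax).add h1
  have hmono : Monotone w := fun s t hst =>
    add_le_add (hm (hmax s) (hmax t) (max_le_max hst le_rfl)) (max_le_max hst le_rfl)
  have hws : ∀ s, 0 ≤ s → w s = v s + s := fun s hs => by simp [hw, max_eq_left hs]
  have hwpos : ∀ s, 0 < s → 0 < w s := fun s hs => by
    rw [hws s hs.le]; linarith [hn s hs.le]
  refine ⟨hcont, hmono, ?_, ?_, ?_⟩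
  · intro r s hr hrs
    rw [hws r hr, hws s (hr.trans hrs)]
    have := hm (mem_Ici.2 hr) (mem_Ici.2 (hr.trans hrs)) hrs
    linarith
  · intro s hs
    rw [hws s hs]
    linarith [hn s hs]
  · by_contra hfin
    obtain ⟨r, hr, hr'⟩ := hdiv
    obtain ⟨δ₀, hδ₀, hδ⟩ := exists_pos_setLIntegral_lt_of_measure_lt hfin
      (ε := ENNReal.ofReal (1 / 2)) (by simp)
    obtain ⟨δ, hδ0, hδ1, hδm⟩ : ∃ δ : ℝ, 0 < δ ∧ δ ≤ 1 ∧ ENNReal.ofReal δ < δ₀ := by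
      rcases eq_or_ne δ₀ ⊤ with h | h
      · exact ⟨1, one_pos, le_rfl, h ▸ ENNReal.ofReal_lt_top⟩
      · have h1 : 0 < δ₀.toReal := ENNReal.toReal_pos hδ₀.ne' h
        refine ⟨min 1 (δ₀.toReal / 2), by positivity, min_le_left _ _, ?_⟩
        rw [ENNReal.ofReal_lt_iff_lt_toReal (by positivity) h]
        exact (min_le_right _ _).trans_lt (by linarith)
    have hhalf : ∀ s ∈ Ioc 0 δ, w s / 2 ≤ v s := by
      intro s hs
      have h1 : ∫⁻ x in Ioo 0 s, (ENNReal.ofReal (w x))⁻¹ < ENNReal.ofReal (1 / 2) := by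
        have h2 := hδ (Ioo 0 s) ((Measure.restrict_apply_le _ _).trans_lt (by
          rw [Real.volume_Ioo, sub_zero]
          exact (ENNReal.ofReal_le_ofReal hs.2).trans_lt hδm))
        rwa [Measure.restrict_restrict measurableSet_Ioo, Ioo_inter_Ioo, sup_idem,
          inf_eq_left.2 (hs.2.trans hδ1)] at h2
      have h3 : ENNReal.ofReal (s / w s) ≤ ∫⁻ x in Ioo 0 s, (ENNReal.ofReal (w x))⁻¹ := by
        calc ENNReal.ofReal (s / w s) = ∫⁻ _ in Ioo 0 s, (ENNReal.ofReal (w s))⁻¹ := by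
              rw [setLIntegral_const, Real.volume_Ioo, sub_zero,
                ENNReal.ofReal_div_of_pos (hwpos s hs.1), div_eq_mul_inv, mul_comm]
          _ ≤ _ := by
              refine setLIntegral_mono' measurableSet_Ioo fun x hx => ?_
              exact ENNReal.inv_le_inv.2 (ENNReal.ofReal_le_ofReal (hmono hx.2.le))
      have h4 := (ENNReal.ofReal_lt_ofReal_iff (by norm_num)).1 (h3.trans_lt h1)
      rw [div_lt_iff₀ (hwpos s hs.1)] at h4
      have h5 := hws s hs.1.le
      linarith
    have hinv : ∀ s ∈ Ioo 0 δ, (ENNReal.ofReal (v s))⁻¹ ≤ 2 * (ENNReal.ofReal (w s))⁻¹ := by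
      intro s hs
      have h1 := hhalf s ⟨hs.1, hs.2.le⟩
      have h2 := hwpos s hs.1
      calc (ENNReal.ofReal (v s))⁻¹ ≤ (ENNReal.ofReal (w s / 2))⁻¹ :=
            ENNReal.inv_le_inv.2 (ENNReal.ofReal_le_ofReal h1)
        _ = 2 * (ENNReal.ofReal (w s))⁻¹ := by
            rw [← ENNReal.ofReal_inv_of_pos (by positivity), ← ENNReal.ofReal_inv_of_pos h2,
              ← ENNReal.ofReal_ofNat, ← ENNReal.ofReal_mul (by norm_num)]
            congr 1
            field_simp
    have hsub : Ioo 0 r ⊆ Ioo 0 δ ∪ Ico δ r := fun s hs => by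
      rcases lt_or_ge s δ with h | h
      · exact Or.inl ⟨hs.1, h⟩
      · exact Or.inr ⟨h, hs.2⟩
    have hωδ : 0 < v δ := by
      have := hhalf δ ⟨hδ0, le_rfl⟩
      linarith [hwpos δ hδ0]
    have hlt : ∫⁻ s in Ioo 0 r, (ENNReal.ofReal (v s))⁻¹ < ⊤ := by
      refine (lintegral_mono_set hsub).trans_lt ((lintegral_union_le _ _ _).trans_lt
        (ENNReal.add_lt_top.2 ⟨?_, ?_⟩))
      · refine (setLIntegral_mono' measurableSet_Ioo hinv).trans_lt ?_
        rw [lintegral_const_mul' _ _ (by simp)]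
        refine ENNReal.mul_lt_top (by simp)
          (lt_of_le_of_lt (lintegral_mono_set ?_) (Ne.lt_top hfin))
        exact Ioo_subset_Ioo_right hδ1
      · refine (setLIntegral_mono' measurableSet_Ico (g := fun _ => (ENNReal.ofReal (v δ))⁻¹)
          fun s hs => ?_).trans_lt ?_
        · exact ENNReal.inv_le_inv.2 (ENNReal.ofReal_le_ofReal
            (hm (mem_Ici.2 hδ0.le) (mem_Ici.2 (hδ0.le.trans hs.1)) hs.1))
        · rw [setLIntegral_const, Real.volume_Ico]
          exact ENNReal.mul_lt_top (by simp [hωδ]) ENNReal.ofReal_lt_top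
    exact hlt.ne hr'

theorem growthModulus_const_mul {G : ℝ → ℝ} (hc : ContinuousOn G (Ici 0))
    (hm : MonotoneOn G (Ici 0)) (hp : ∀ s ∈ Ici (0 : ℝ), 0 < G s)
    (hdiv : ∃ r : ℝ, 0 < r ∧ ∫⁻ s in Ioi r, (ENNReal.ofReal (G s))⁻¹ = (⊤ : ENNReal)) {C : ℝ}
    (hC : 0 < C) : GrowthModulus fun s => C * G (max s 0) := by
  have hmax : ∀ s : ℝ, max s 0 ∈ Ici (0 : ℝ) := fun s => mem_Ici.2 (le_max_right _ _)
  refine ⟨continuous_const.mul (hc.comp_continuous (by fun_prop) hmax),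
    fun s t hst => mul_le_mul_of_nonneg_left (hm (hmax s) (hmax t) (max_le_max hst le_rfl)) hC.le,
    fun s => mul_pos hC (hp _ (hmax s)), ?_⟩
  obtain ⟨r, hr, hr'⟩ := hdiv
  refine ⟨r, hr, ?_⟩
  have : ∫⁻ s in Ioi r, (ENNReal.ofReal (C * G (max s 0)))⁻¹ =
      ∫⁻ s in Ioi r, (ENNReal.ofReal C)⁻¹ * (ENNReal.ofReal (G s))⁻¹ := by
    refine setLIntegral_congr_fun measurableSet_Ioi fun s hs => ?_
    have hs' : 0 ≤ s := hr.le.trans (le_of_lt hs)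
    rw [max_eq_left hs', ENNReal.ofReal_mul hC.le, ENNReal.mul_inv (Or.inr ENNReal.ofReal_ne_top)
      (Or.inl ENNReal.ofReal_ne_top)]
  rw [this, lintegral_const_mul' _ _ (by simp [hC]), hr']
  exact ENNReal.mul_top (by simp)

/-- A field as in the theorem agrees for almost every time with a jointly measurable field which
satisfies the estimates for every time. -/
theorem exists_localOsgoodField {n : ℕ} {T : ℝ} {b : ℝ → Rn n → Rn n}
    (hb : MeasurableInTime T b) (hB1 : GrowthCondition T b) (hB2 : OsgoodCondition T b) :
    ∃ (c : ℝ → Rn n → Rn n) (G w : ℝ → ℝ), LocalOsgoodField c G w ∧ GrowthModulus G ∧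
      OsgoodModulus w ∧ (∀ t x, t ∉ Ioo 0 T → c t x = 0) ∧
      ∀ᵐ t ∂(volume.restrict (Ioo 0 T)), ∀ x, b t x = c t x := by
  classical
  obtain ⟨G, hGc, hGm, hGp, hGd, C, hC⟩ := hB1
  obtain ⟨v, hωc, hωm, hωn, hωd, hω⟩ := hB2
  have hG := growthModulus_const_mul hGc hGm hGp hGd (show 0 < max C 1 by positivity)
  have hw := osgoodModulus_add_id hωc hωm hωn hωd
  choose D hD using fun N : ℕ => hω (N + 1) (by positivity)
  have hDall := ae_all_iff.2 hD
  have hmk : ∀ᵐ t ∂(volume.restrict (Ioo 0 T)), ∀ k,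
      b t (TopologicalSpace.denseSeq (Rn n) k) = (hb (TopologicalSpace.denseSeq (Rn n) k)).mk _ t :=
    ae_all_iff.2 fun k => (hb _).ae_eq_mk
  have hgood := hC.and (hDall.and hmk)
  obtain ⟨Z, hZ, hZm, hZ0⟩ := exists_measurable_superset_of_null (ae_iff.1 hgood)
  have hZ' : ∀ t, t ∉ Z → (∀ x : Rn n, ‖b t x‖ ≤ C * G ‖x‖) ∧
      (∀ N : ℕ, ∀ x ∈ Metric.ball (0 : Rn n) (N + 1), ∀ y ∈ Metric.ball (0 : Rn n) (N + 1),
        ‖b t x - b t y‖ ≤ D N * v ‖x - y‖) ∧ ∀ k,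
      b t (TopologicalSpace.denseSeq (Rn n) k) =
        (hb (TopologicalSpace.denseSeq (Rn n) k)).mk _ t := by
    intro t ht
    by_contra h
    exact ht (hZ h)
  set c : ℝ → Rn n → Rn n := fun t x => if t ∈ Ioo 0 T \ Z then b t x else 0 with hc
  have hcb : ∀ t ∈ Ioo 0 T \ Z, ∀ x, c t x = b t x := fun t ht x => by simp only [hc, if_pos ht]
  have hc0 : ∀ t ∉ Ioo 0 T \ Z, ∀ x, c t x = 0 := fun t ht x => by simp only [hc, if_neg ht]
  have hωw : ∀ x y : Rn n, v ‖x - y‖ ≤ v (max ‖x - y‖ 0) + max ‖x - y‖ 0 := fun x y => by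
    rw [max_eq_left (norm_nonneg _)]; linarith [norm_nonneg (x - y)]
  have hwn : ∀ x y : Rn n, 0 ≤ v (max ‖x - y‖ 0) + max ‖x - y‖ 0 := fun x y =>
    (hωn _ (norm_nonneg (x - y))).trans (hωw x y)
  have hmodN : ∀ (N : ℕ) t, ∀ x ∈ Metric.ball (0 : Rn n) (N + 1),
      ∀ y ∈ Metric.ball (0 : Rn n) (N + 1),
      ‖c t x - c t y‖ ≤ max (D N) 0 * (v (max ‖x - y‖ 0) + max ‖x - y‖ 0) := by
    intro N t x hx y hy
    by_cases ht : t ∈ Ioo 0 T \ Z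
    · rw [hcb t ht, hcb t ht]
      refine ((hZ' t ht.2).2.1 N x hx y hy).trans ?_
      exact mul_le_mul (le_max_left _ _) (hωw x y) (hωn _ (norm_nonneg (x - y)))
        (le_max_right _ _)
    · rw [hc0 t ht, hc0 t ht, sub_zero, norm_zero]
      exact mul_nonneg (le_max_right _ _) (hwn x y)
  have hcont : ∀ t, Continuous (c t) := by
    intro t
    rw [continuous_iff_continuousAt]
    intro x
    obtain ⟨N, hN⟩ := exists_nat_ge ‖x‖
    have hx : x ∈ Metric.ball (0 : Rn n) (N + 1) := by
      rw [mem_ball_zero_iff]; linarith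
    rw [ContinuousAt, tendsto_iff_norm_sub_tendsto_zero]
    have h1 : Tendsto (fun y => max (D N) 0 * (v (max ‖y - x‖ 0) + max ‖y - x‖ 0)) (𝓝 x) (𝓝 0) := by
      have : Continuous fun y => max (D N) 0 * (v (max ‖y - x‖ 0) + max ‖y - x‖ 0) :=
        continuous_const.mul (hw.cont.comp (continuous_id.sub continuous_const).norm)
      have h0 := hw.apply_zero
      simp only [max_self, add_zero] at h0
      simpa [h0] using this.tendsto x
    refine squeeze_zero' (Eventually.of_forall fun _ => norm_nonneg _) ?_ h1
    filter_upwards [Metric.isOpen_ball.mem_nhds hx] with y hy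
    exact hmodN N t y hy x hx
  have hmeasD : ∀ k, Measurable fun t => c t (TopologicalSpace.denseSeq (Rn n) k) := by
    intro k
    have : (fun t => c t (TopologicalSpace.denseSeq (Rn n) k)) =
        (Ioo 0 T \ Z).indicator ((hb (TopologicalSpace.denseSeq (Rn n) k)).mk _) := by
      ext1 t
      by_cases ht : t ∈ Ioo 0 T \ Z
      · rw [indicator_of_mem ht, hcb t ht, (hZ' t ht.2).2.2 k]
      · rw [indicator_of_notMem ht, hc0 t ht]
    rw [this]
    exact (hb _).measurable_mk.indicator (measurableSet_Ioo.diff hZm)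
  have hmeas : ∀ x, Measurable fun t => c t x := by
    intro x
    obtain ⟨u, hu, hux⟩ := mem_closure_iff_seq_limit.1
      ((TopologicalSpace.denseRange_denseSeq (Rn n)) x)
    choose k hk using hu
    refine measurable_of_tendsto_metrizable (f := fun j t => c t (u j)) (fun j => ?_) ?_
    · rw [← hk j]; exact hmeasD (k j)
    · rw [tendsto_pi_nhds]
      exact fun t => ((hcont t).tendsto x).comp hux
  refine ⟨c, _, _, ⟨?_, ?_, ?_⟩, hG, hw, ?_, ?_⟩
  · have := measurable_uncurry_of_continuous_of_measurable (u := fun x t => c t x) hcont hmeas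
    exact this.comp measurable_swap
  · intro t x
    have hG0 : 0 < G ‖x‖ := hGp _ (norm_nonneg x)
    rw [max_eq_left (norm_nonneg x)]
    by_cases ht : t ∈ Ioo 0 T \ Z
    · rw [hcb t ht]
      exact ((hZ' t ht.2).1 x).trans (mul_le_mul_of_nonneg_right (le_max_left _ _) hG0.le)
    · rw [hc0 t ht, norm_zero]
      positivity
  · intro R hR
    obtain ⟨N, hN⟩ := exists_nat_ge R
    refine ⟨max (D N) 0, le_max_right _ _, fun t x hx y hy => hmodN N t x ?_ y ?_⟩
    · exact Metric.ball_subset_ball (by linarith) hx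
    · exact Metric.ball_subset_ball (by linarith) hy
  · exact fun t x ht => hc0 t (fun h => ht h.1) x
  · filter_upwards [ae_restrict_mem measurableSet_Ioo,
      measure_eq_zero_iff_ae_notMem.1 hZ0] with t ht htZ x
    exact (hcb t ⟨ht, htZ⟩ x).symm

end

section

variable {n : ℕ} {T : ℝ} {b c : ℝ → Rn n → Rn n} {G w : ℝ → ℝ}

theorem HasCompactSupport.exists_radius {θ : ℝ × Rn n → ℝ} (hθ : HasCompactSupport θ) :
    ∃ R, 0 < R ∧ ∀ p, R ≤ ‖p.2‖ → θ p = 0 := by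
  obtain ⟨R, hR⟩ := hθ.isCompact.isBounded.subset_closedBall (0 : ℝ × Rn n)
  refine ⟨|R| + 1, by positivity, fun p hp => image_eq_zero_of_notMem_tsupport fun h => ?_⟩
  have h1 := hR h
  rw [mem_closedBall_zero_iff, Prod.norm_def] at h1
  have h2 := (le_max_right _ _).trans h1
  have := le_abs_self R
  linarith

theorem LocalOsgoodField.exists_abs_transportDeriv_le (hc : LocalOsgoodField c G w)
    (hG : GrowthModulus G) (hw : OsgoodModulus w) {θ : ℝ × Rn n → ℝ} (hθ : ContDiff ℝ ∞ θ)
    (hθc : HasCompactSupport θ) : ∃ N, ∀ p, |transportDeriv c θ p| ≤ N := by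
  obtain ⟨R, hR0, hR⟩ := hθc.exists_radius
  obtain ⟨C, hC⟩ := hc.cutoff hG hw hR0
  obtain ⟨L, hL⟩ := (hθc.fderiv ℝ).exists_bound_of_continuous (hθ.continuous_fderiv (by simp))
  refine ⟨L * (1 + G (R + 1)), fun p => ?_⟩
  rw [← transportDeriv_radialCutoff hR]
  exact abs_transportDeriv_le hC.bound (hL p)

theorem IsTestFunction.eq_zero {θ : ℝ × Rn n → ℝ} (hθ : IsTestFunction T θ) (x : Rn n) :
    θ (T, x) = 0 :=
  image_eq_zero_of_notMem_tsupport fun h => lt_irrefl T (hθ.2.2 h).1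

/-- The chain rule along trajectories. -/
theorem LocalOsgoodField.integral_transportDeriv (hc : LocalOsgoodField c G w)
    (hG : GrowthModulus G) (hc0 : ∀ t x, t ∉ Ioo 0 T → c t x = 0) (hT : 0 < T) {x : Rn n}
    {γ : ℝ → Rn n} (hγ : IsTrajectory c T x γ) {θ : ℝ × Rn n → ℝ} (hθ : IsTestFunction T θ) :
    ∫ t in Ioo 0 T, transportDeriv c θ (t, γ t) = -θ (0, x) := by
  set u : ℝ → Rn n := fun s => c s (γ s) with hu
  have hum : Measurable u := hc.measurable_comp hγ.1.measurable
  obtain ⟨K, hK⟩ : ∃ K, ∀ t, ‖u t‖ ≤ K := by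
    obtain ⟨K, hK⟩ := (isCompact_Icc (a := 0) (b := T)).exists_bound_of_continuousOn
      (hG.cont.comp hγ.1.norm).continuousOn
    refine ⟨|K|, fun t => ?_⟩
    by_cases ht : t ∈ Ioo 0 T
    · have h1 := hK t (Ioo_subset_Icc_self ht)
      exact (hc.growth t _).trans ((le_abs_self _).trans (h1.trans (le_abs_self _)))
    · simp only [hu, hc0 t _ ht, norm_zero]
      positivity
  have hK0 : 0 ≤ K := (norm_nonneg _).trans (hK 0)
  have hui : IntervalIntegrable u volume 0 T := intervalIntegrable_of_bounded hum hK 0 T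
  obtain ⟨L, hL⟩ := (hθ.2.1.fderiv ℝ).exists_bound_of_continuous
    (hθ.1.continuous_fderiv (by simp))
  have hL0 : 0 ≤ L := (norm_nonneg _).trans (hL 0)
  set g : ℝ → ℝ := fun t => θ (t, γ t) with hg
  have hlip : LipschitzOnWith ⟨L * (1 + K), by positivity⟩ g (uIcc 0 T) := by
    refine LipschitzOnWith.of_dist_le_mul fun s hs t ht => ?_
    rw [uIcc_of_le hT.le] at hs ht
    have h1 := convex_univ.norm_image_sub_le_of_norm_fderiv_le (𝕜 := ℝ) (f := θ) (C := L)
      (fun q _ => hθ.1.differentiable (by simp) q) (fun q _ => hL q) (mem_univ (t, γ t))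
      (mem_univ (s, γ s))
    have h2 := norm_primitive_sub_le hum hK s t
    have h3 : ‖((s, γ s) : ℝ × Rn n) - (t, γ t)‖ ≤ (1 + K) * |s - t| := by
      rw [Prod.norm_def]
      refine max_le ?_ ?_
      · simp only [Prod.fst_sub, Real.norm_eq_abs]
        nlinarith [abs_nonneg (s - t)]
      · simp only [Prod.snd_sub]
        rw [hγ.2 s hs, hγ.2 t ht, add_sub_add_left_eq_sub]
        refine h2.trans ?_
        nlinarith [abs_nonneg (s - t)]
    rw [Real.dist_eq, Real.dist_eq]
    calc |g s - g t| ≤ L * ‖((s, γ s) : ℝ × Rn n) - (t, γ t)‖ := h1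
      _ ≤ L * ((1 + K) * |s - t|) := by gcongr
      _ = L * (1 + K) * |s - t| := by ring
  have hFTC := hlip.absolutelyContinuousOnInterval.integral_deriv_eq_sub
  have hgT : g T = 0 := hθ.eq_zero _
  have hg0 : g 0 = θ (0, x) := by
    have : γ 0 = x := by simpa using hγ.2 0 ⟨le_rfl, hT.le⟩
    simp only [hg, this]
  rw [hgT, hg0, zero_sub] at hFTC
  rw [← hFTC, intervalIntegral.integral_of_le hT.le, integral_Ioc_eq_integral_Ioo]
  refine setIntegral_congr_ae measurableSet_Ioo ?_
  filter_upwards [hui.ae_hasDerivAt_integral] with t ht htI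
  have htu : t ∈ uIcc 0 T := by rw [uIcc_of_le hT.le]; exact Ioo_subset_Icc_self htI
  have h1 := (ht htu 0 left_mem_uIcc).const_add x
  have h2 : HasDerivAt γ (u t) t := by
    refine h1.congr_of_eventuallyEq ?_
    filter_upwards [Ioo_mem_nhds htI.1 htI.2] with s hs
    exact hγ.2 s (Ioo_subset_Icc_self hs)
  have h3 : HasDerivAt (fun s => (s, γ s)) ((1 : ℝ), u t) t := (hasDerivAt_id t).prodMk h2
  have h4 := (hθ.1.differentiable (by simp) (t, γ t)).hasFDerivAt.comp_hasDerivAt t h3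
  exact h4.deriv.symm

theorem deriv_add_inner_gradient {θ : ℝ × Rn n → ℝ} (hθ : ContDiff ℝ ∞ θ) (t : ℝ) (x v : Rn n) :
    deriv (fun s => θ (s, x)) t + inner ℝ v (gradient (fun y => θ (t, y)) x) =
      fderiv ℝ θ (t, x) (1, v) := by
  have hd := (hθ.differentiable (by simp) (t, x)).hasFDerivAt
  have h1 : HasDerivAt (fun s => θ (s, x)) (fderiv ℝ θ (t, x) (1, 0)) t :=
    hd.comp_hasDerivAt t ((hasDerivAt_id t).prodMk (hasDerivAt_const t x))
  have h2 : HasFDerivAt (fun y => θ (t, y))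
      ((fderiv ℝ θ (t, x)).comp (ContinuousLinearMap.inr ℝ ℝ (Rn n))) x :=
    hd.comp x (hasFDerivAt_prodMk_right t x)
  rw [h1.deriv, gradient, h2.fderiv, real_inner_comm, InnerProductSpace.toDual_symm_apply]
  simp only [ContinuousLinearMap.comp_apply, ContinuousLinearMap.inr_apply]
  rw [← map_add]
  simp

theorem integral_weak_eq_transportDeriv
    (hbc : ∀ᵐ t ∂(volume.restrict (Ioo 0 T)), ∀ x, b t x = c t x) {θ : ℝ × Rn n → ℝ}
    (hθ : ContDiff ℝ ∞ θ) (ρ : ℝ → SignedMeasure (Rn n)) :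
    (∫ t in Ioo 0 T, ∫ᵛ x, (deriv (fun s => θ (s, x)) t +
        inner ℝ (b t x) (gradient (fun y => θ (t, y)) x)) ∂•(ρ t)) =
      ∫ t in Ioo 0 T, ∫ᵛ x, transportDeriv c θ (t, x) ∂•(ρ t) := by
  refine integral_congr_ae ?_
  filter_upwards [hbc] with t ht
  congr 1
  ext x
  rw [deriv_add_inner_gradient hθ, ht x]
  rfl

/-- Weak solutions with the same initial datum coincide. -/
theorem IsWeakSolution.ae_eq (hc : LocalOsgoodField c G w) (hG : GrowthModulus G)
    (hw : OsgoodModulus w) (hT : 0 < T) (hc0 : ∀ t x, t ∉ Ioo 0 T → c t x = 0)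
    (hbc : ∀ᵐ t ∂(volume.restrict (Ioo 0 T)), ∀ x, b t x = c t x) {ρ₀ : SignedMeasure (Rn n)}
    {ρ σ : ℝ → SignedMeasure (Rn n)} (hρ : IsWeakSolution T b ρ₀ ρ)
    (hσ : IsWeakSolution T b ρ₀ σ) : ∀ᵐ t ∂(volume.restrict (Ioo 0 T)), ρ t = σ t := by
  obtain ⟨P, N, _, _, hac, hsupp, hint⟩ := hρ.1.exists_measures
  obtain ⟨P', N', _, _, hac', hsupp', hint'⟩ := hσ.1.exists_measures
  have hadd : P + N' + (N + P') = (P + N) + (P' + N') := by abel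
  have hdiff : ∀ f : ℝ × Rn n → ℝ, Measurable f → ∀ C, (∀ p, |f p| ≤ C) →
      integralDiff (P + N') (N + P') f = (∫ t in Ioo 0 T, ∫ᵛ x, f (t, x) ∂•(ρ t)) -
        ∫ t in Ioo 0 T, ∫ᵛ x, f (t, x) ∂•(σ t) := by
    intro f hf C hC
    have hi : ∀ (m : Measure (ℝ × Rn n)) [IsFiniteMeasure m], Integrable f m := fun m _ =>
      Integrable.of_bound hf.aestronglyMeasurable C (ae_of_all _ hC)
    rw [(hint f hf C hC).2, (hint' f hf C hC).2, integralDiff, integral_add_measure (hi _) (hi _),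
      integral_add_measure (hi _) (hi _)]
    ring
  have hpair : WeakSolutionPair T c (P + N') (N + P') := by
    refine ⟨?_, ?_, fun θ hθ => ?_⟩
    · rw [hadd, Measure.map_add _ _ measurable_fst]
      exact Measure.AbsolutelyContinuous.add_left hac hac'
    · rw [hadd]
      exact ae_add_measure_iff.2 ⟨hsupp, hsupp'⟩
    · obtain ⟨C, hC⟩ := hc.exists_abs_transportDeriv_le hG hw hθ.1 hθ.2.1
      have h1 := hρ.2 θ hθ
      have h2 := hσ.2 θ hθ
      rw [integral_weak_eq_transportDeriv hbc hθ.1] at h1 h2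
      rw [hdiff _ (measurable_transportDeriv hc.meas hθ.1) C hC]
      linarith
  have heq := hpair.eq hc hG hw hT hc0
  refine hρ.1.ae_eq hσ.1 fun f hf hf1 => ?_
  have h := hdiff f hf 1 hf1
  rw [heq, integralDiff, sub_self] at h
  linarith

section pushforward

variable {φ : ℝ → Rn n → Rn n}

theorem measurable_flow (hT : 0 ≤ T) (hφt : ∀ x, Continuous fun t => φ t x)
    (hφx : ∀ t ∈ Icc 0 T, Continuous (φ t)) :
    Measurable fun p : ℝ × Rn n => φ (max 0 (min p.1 T)) p.2 := by
  have h := measurable_uncurry_of_continuous_of_measurable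
    (u := fun (t : ℝ) (x : Rn n) => φ (max 0 (min t T)) x)
    (fun x => (hφt x).comp (by fun_prop : Continuous fun t : ℝ => max 0 (min t T)))
    (fun t => (hφx _ ⟨le_max_left _ _, max_le hT (min_le_right _ _)⟩).measurable)
  exact h

theorem clamp_eq {t : ℝ} (ht : t ∈ Icc 0 T) : max 0 (min t T) = t := by
  rw [min_eq_left ht.2, max_eq_right ht.1]

instance isFiniteMeasure_variation (s : SignedMeasure (Rn n)) : IsFiniteMeasure s.variation := by
  rw [← SignedMeasure.totalVariation_eq_variation]
  exact inferInstanceAs (IsFiniteMeasure (_ + _))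

theorem memL1Measures_map (hT : 0 ≤ T) (hφt : ∀ x, Continuous fun t => φ t x)
    (hφx : ∀ t ∈ Icc 0 T, Continuous (φ t)) (ρ₀ : SignedMeasure (Rn n)) :
    MemL1Measures T fun t => ρ₀.map (φ t) := by
  have hm := measurable_flow hT hφt hφx
  refine ⟨fun A hA => ?_, ?_⟩
  · have hmA : ∀ (m : Measure (Rn n)) [IsFiniteMeasure m], Measurable fun t =>
        m.real (Prod.mk t ⁻¹' ((fun p : ℝ × Rn n => φ (max 0 (min p.1 T)) p.2) ⁻¹' A)) :=
      fun m _ => (measurable_measure_prodMk_left (hm hA)).ennreal_toReal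
    refine ((hmA ρ₀.toJordanDecomposition.posPart).sub
      (hmA ρ₀.toJordanDecomposition.negPart)).aemeasurable.congr ?_
    filter_upwards [ae_restrict_mem measurableSet_Ioo] with t ht
    have htI := Ioo_subset_Icc_self ht
    have e : Prod.mk t ⁻¹' ((fun p : ℝ × Rn n => φ (max 0 (min p.1 T)) p.2) ⁻¹' A) =
        φ t ⁻¹' A := by
      ext x
      simp only [mem_preimage, clamp_eq htI]
    have hφm := (hφx t htI).measurable
    rw [VectorMeasure.map_apply _ hφm hA, ρ₀.apply_eq_posPart_real_sub_negPart_real (hφm hA)]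
    simp only [Pi.sub_apply, e]
  · have hle : ∀ t, (ρ₀.map (φ t)).variation univ ≤ ρ₀.variation univ := by
      intro t
      by_cases hφ : Measurable (φ t)
      · refine (VectorMeasure.variation_map_le univ).trans ?_
        rw [Measure.map_apply hφ MeasurableSet.univ, preimage_univ]
      · simp [VectorMeasure.map, hφ]
    refine (lintegral_mono hle).trans_lt ?_
    rw [lintegral_const]
    exact ENNReal.mul_lt_top (measure_lt_top _ _) (by simp)

/-- The push-forward of the initial datum under the flow is a weak solution. -/
theorem LocalOsgoodField.isWeakSolution_map (hc : LocalOsgoodField c G w) (hG : GrowthModulus G)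
    (hw : OsgoodModulus w) (hT : 0 < T) (hc0 : ∀ t x, t ∉ Ioo 0 T → c t x = 0)
    (hbc : ∀ᵐ t ∂(volume.restrict (Ioo 0 T)), ∀ x, b t x = c t x)
    (hφ : ∀ x, IsTrajectory c T x fun t => φ t x) (hφx : ∀ t ∈ Icc 0 T, Continuous (φ t))
    (ρ₀ : SignedMeasure (Rn n)) : IsWeakSolution T b ρ₀ fun t => ρ₀.map (φ t) := by
  have hφt : ∀ x, Continuous fun t => φ t x := fun x => (hφ x).1
  refine ⟨memL1Measures_map hT.le hφt hφx ρ₀, fun θ hθ => ?_⟩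
  obtain ⟨C, hC⟩ := hc.exists_abs_transportDeriv_le hG hw hθ.1 hθ.2.1
  obtain ⟨N, hN⟩ := hθ.2.1.exists_bound_of_continuous hθ.1.continuous
  have hDm := measurable_transportDeriv hc.meas hθ.1
  set P := ρ₀.toJordanDecomposition.posPart with hP
  set Q := ρ₀.toJordanDecomposition.negPart with hQ
  set F : ℝ → Rn n → ℝ := fun t x => transportDeriv c θ (t, φ (max 0 (min t T)) x) with hF
  have hFm : Measurable (Function.uncurry F) :=
    hDm.comp (measurable_fst.prodMk (measurable_flow hT.le hφt hφx))
  have hFt : ∀ t, Measurable (F t) := fun t => hFm.comp measurable_prodMk_left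
  have hFi : ∀ (m : Measure (Rn n)) [IsFiniteMeasure m],
      Integrable (Function.uncurry F) ((volume.restrict (Ioo 0 T)).prod m) := fun m _ =>
    Integrable.of_bound hFm.aestronglyMeasurable C (ae_of_all _ fun p => hC _)
  have hswap : ∀ (m : Measure (Rn n)) [IsFiniteMeasure m],
      ∫ t in Ioo 0 T, ∫ x, F t x ∂m = -∫ x, θ (0, x) ∂m := by
    intro m _
    rw [integral_integral_swap (hFi m), ← integral_neg]
    refine integral_congr_ae (ae_of_all _ fun x => ?_)
    change ∫ t in Ioo 0 T, F t x = -θ (0, x)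
    rw [← hc.integral_transportDeriv hG hc0 hT (hφ x) hθ]
    refine setIntegral_congr_fun measurableSet_Ioo fun t ht => ?_
    simp only [hF, clamp_eq (Ioo_subset_Icc_self ht)]
  have hFs : ∀ (m : Measure (Rn n)) [IsFiniteMeasure m],
      IntegrableOn (fun t => ∫ x, F t x ∂m) (Ioo 0 T) := fun m _ => (hFi m).integral_prod_left
  have hslice : ∀ t ∈ Ioo 0 T, ∫ᵛ x, transportDeriv c θ (t, x) ∂•(ρ₀.map (φ t)) =
      (∫ x, F t x ∂P) - ∫ x, F t x ∂Q := by
    intro t ht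
    have htI := Ioo_subset_Icc_self ht
    have hm : Measurable fun x => transportDeriv c θ (t, x) := hDm.comp measurable_prodMk_left
    have hφm := (hφx t htI).measurable
    have hFφ : ((fun x => transportDeriv c θ (t, x)) ∘ φ t) = F t := by
      ext x
      simp only [hF, Function.comp_apply, clamp_eq htI]
    have hb : ∀ (m : Measure (Rn n)) [IsFiniteMeasure m], Integrable (F t) m := fun m _ =>
      Integrable.of_bound (hFt t).aestronglyMeasurable C (ae_of_all _ fun x => hC _)
    rw [VectorMeasure.integral_map hφm hm.aestronglyMeasurable (by rw [hFφ]; exact hb _)]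
    have e : (fun x => transportDeriv c θ (t, φ t x)) = F t := hFφ
    rw [e]
    exact SignedMeasure.integral_eq_sub _ (hb _) (hb _)
  have hθ0 : ∫ᵛ x, θ (0, x) ∂•ρ₀ = (∫ x, θ (0, x) ∂P) - ∫ x, θ (0, x) ∂Q := by
    have hb : ∀ (m : Measure (Rn n)) [IsFiniteMeasure m], Integrable (fun x => θ (0, x)) m :=
      fun m _ => Integrable.of_bound
        (hθ.1.continuous.comp
          (by fun_prop : Continuous fun x : Rn n => ((0 : ℝ), x))).aestronglyMeasurable
        N (ae_of_all _ fun x => hN _)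
    exact SignedMeasure.integral_eq_sub _ (hb _) (hb _)
  rw [integral_weak_eq_transportDeriv hbc hθ.1, setIntegral_congr_fun measurableSet_Ioo hslice,
    integral_sub (hFs P) (hFs Q), hswap P, hswap Q, hθ0]
  ring

end pushforward

theorem isFlow_congr (hT : 0 ≤ T)
    (hbc : ∀ᵐ t ∂(volume.restrict (Ioo 0 T)), ∀ x, b t x = c t x) {φ : ℝ → Rn n → Rn n} :
    IsFlow T b φ ↔ IsFlow T c φ := by
  have hae : ∀ (x : Rn n) (t : ℝ), t ∈ Icc 0 T → (fun s => b s (φ s x))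
      =ᵐ[volume.restrict (uIoc 0 t)] fun s => c s (φ s x) := by
    intro x t ht
    rw [uIoc_of_le ht.1, ← restrict_Ioo_eq_restrict_Ioc]
    filter_upwards [ae_restrict_of_ae_restrict_of_subset (Ioo_subset_Ioo_right ht.2) hbc] with s hs
    exact hs _
  refine forall_congr' fun x => and_congr ?_ ?_
  · exact ⟨fun h => h.congr_ae (hae x T ⟨hT, le_rfl⟩),
      fun h => h.congr_ae (hae x T ⟨hT, le_rfl⟩).symm⟩
  · refine forall₂_congr fun t ht => ?_
    rw [intervalIntegral.integral_congr_ae_restrict (hae x t ht)]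

/-- Flows are unique. -/
theorem LocalOsgoodField.flow_unique (hc : LocalOsgoodField c G w) (hG : GrowthModulus G)
    (hw : OsgoodModulus w) (hT : 0 ≤ T) {φ ψ : ℝ → Rn n → Rn n}
    (hφ : ∀ x, IsTrajectory c T x fun t => φ t x) (hψ : IsFlow T c ψ) :
    ∀ t ∈ Icc 0 T, ψ t = φ t := by
  intro t ht
  ext1 x
  have hη : IsTrajectory c T x fun t => ψ (max 0 (min t T)) x := by
    constructor
    · have h1 : ContinuousOn (fun t => ψ t x) (Icc 0 T) := by
        have h2 := intervalIntegral.continuousOn_primitive_interval' (hψ x).1 left_mem_uIcc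
        rw [uIcc_of_le hT] at h2
        exact (continuousOn_const.add h2).congr fun t ht => (hψ x).2 t ht
      exact h1.comp_continuous (by fun_prop) fun t =>
        ⟨le_max_left _ _, max_le hT (min_le_right _ _)⟩
    · intro t ht
      simp only
      rw [clamp_eq ht, (hψ x).2 t ht]
      congr 1
      refine intervalIntegral.integral_congr fun s hs => ?_
      rw [uIcc_of_le ht.1] at hs
      simp only [clamp_eq ⟨hs.1, hs.2.trans ht.2⟩]
  have h := hc.trajectory_unique hG hw hη (hφ x) t ht
  simpa only [clamp_eq ht] using h

end

theorem theorem1p3 (n : ℕ) (T : ℝ) (hT : 0 < T) (b : ℝ → Rn n → Rn n)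
    (hb : MeasurableInTime T b) (hB1 : GrowthCondition T b) (hB2 : OsgoodCondition T b) :
    ∃ φ : ℝ → Rn n → Rn n,
      -- `φ` is the flow of `b`: it is a flow by homeomorphisms, and the only flow
      IsFlow T b φ ∧ (∀ t ∈ Icc 0 T, IsHomeomorph (φ t)) ∧
      (∀ ψ : ℝ → Rn n → Rn n, IsFlow T b ψ → ∀ t ∈ Icc 0 T, ψ t = φ t) ∧
      -- for each initial datum, the push-forward by the flow is the unique weak solution
      ∀ ρ₀ : SignedMeasure (Rn n),
        IsWeakSolution T b ρ₀ (fun t => ρ₀.map (φ t)) ∧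
        ∀ ρ : ℝ → SignedMeasure (Rn n), IsWeakSolution T b ρ₀ ρ →
          ∀ᵐ t ∂(volume.restrict (Ioo 0 T)), ρ t = ρ₀.map (φ t) := by
  obtain ⟨c, G, w, hc, hG, hw, hc0, hbc⟩ := exists_localOsgoodField hb hB1 hB2
  obtain ⟨φ, hφ, hφh⟩ := hc.exists_flow hG hw hT.le
  have hsol : ∀ ρ₀ : SignedMeasure (Rn n), IsWeakSolution T b ρ₀ fun t => ρ₀.map (φ t) :=
    hc.isWeakSolution_map hG hw hT hc0 hbc hφ fun t ht => (hφh t ht).continuous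
  refine ⟨φ, (isFlow_congr hT.le hbc).2 fun x => ⟨hc.intervalIntegrable hG (hφ x).1 0 T, (hφ x).2⟩,
    hφh, fun ψ hψ => hc.flow_unique hG hw hT.le hφ ((isFlow_congr hT.le hbc).1 hψ),
    fun ρ₀ => ⟨hsol ρ₀, fun ρ hρ => hρ.ae_eq hc hG hw hT hc0 hbc (hsol ρ₀)⟩⟩
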